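/- **Setting.** Let $\mathcal U\subset\mathbb R^N$ be open and convex, and let $f=f^++f^-$ be an entropy flux-splitting on $\mathcal U$: $f^\pm:\mathcal U\to\mathbb R^N$ are smooth, the matrices $\nabla f^\pm(u)$ have real eigenvalues and a basis of eigenvectors, and there are $C^2$ functions $U,F^\pm$ with $\nabla^2U$ positive definite and $\nabla F^\pm=\nabla U\,\nabla f^\pm$ on $\mathcal U$. By a *split entropy* $(U,F^\pm)$ on an open set $V\subset\mathcal U$ we mean $C^2$ functions $U,F^+,F^-:V\to\mathbb R$ with $\nabla F^\pm=\nabla U\,\nabla f^\pm$; then $(U,F)$ with $F=F^++F^-$ is an entropy pair for $f$. It is convex if $\nabla^2U\ge 0$. Fix $\lambda>0$ and put $$g(v,w)=f^-(w)+f^+(v),\qquad G(v,w)=F^-(w)+F^+(v).$$ The split entropy satisfies the *discrete entropy inequality on $V$* if for all $u,v,w\in V$ with $v^*:=v-\lambda g(v,w)+\lambda g(u,v)\in V$ $$U(v^*)-U(v)+\lambda\bigl(G(v,w)-G(u,v)\bigr)\le 0 .$$ The scheme with mesh sizes $h>0$ and $\tau=\lambda h$ and with boundary data $u_B$ defines $u^h(x,t)$,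 $x,t\ge0$, constant in $x$ on each cell $[kh,(k+1)h)$, by $u^h(x,t)=u_B(t)$ for $x<h$, by arbitrary initial cell values for $x\ge h$, $t<\tau$ (for instance cell averages of an initial function $u_I$), and for $x\ge h$, $t\ge 0$ by $$u^h(x,t+\tau)=u^h(x,t)-\lambda g\bigl(u^h(x,t),u^h(x+h,t)\bigr)+\lambda g\bigl(u^h(x-h,t),u^h(x,t)\bigr).$$ Put $v^h(y,t)=u^h(yh,t)$. The Lax–Friedrichs type schemes $g(v,w)=\frac12(f(v)+f(w))-\frac Q\lambda(w-v)$, $G(v,w)=\frac12(F(v)+F(w))-\frac Q\lambda(U(w)-U(v))$ are the special case $f^\pm=\frac12f\pm\frac Q\lambda\,\mathrm{id}$, $F^\pm=\frac12F\pm\frac Q\lambda U$; there every entropy pair of $f$ gives a split entropy. **Theorem.** (1) (Small neighborhoods of a constant state.) Let $c\in\mathcal U$ be such that the eigenvalues of $\nabla f^+(c)$ are $\ge0$, those of $\nabla f^-(c)$ are $\le 0$, those of $\lambda\nabla(f^+-f^-)(c)$ are $<1$, and, for each sign and all $u$ near $c$, $\ker\nabla f^\pm(c)\subset\ker\nabla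 f^\pm(u)$ (an empty condition where $\nabla f^\pm(c)$ is invertible; for the Lax–Friedrichs splitting with $Q>0$ all these conditions hold if $\lambda|a|<2Q<1$ for all eigenvalues $a$ of $\nabla f(c)$). Then every split entropy on $\mathcal U$ with $\nabla^2U$ positive definite satisfies the discrete entropy inequality on some ball around $c$. (2) Let $V\subset\mathcal U$ be open and convex, $u_B:[0,\infty)\to V$ measurable, $h_n>0$ with $h_n\to0$, and suppose that all the functions $u^{h_n}$ take their values in a fixed compact subset of $V$. Let $\nu$ and $\mu$ be Young measures (weak-$\star$ measurable families of probability measures on $V$, indexed by $(x,t)$, respectively $(y,t)$, in $\mathbb R_+^2$) associated with the sequences $u^{h_n}$ and $v^{h_n}$. Then, after modification of $\mu$ on a null set of $(y,t)$, the measure $\mu_{y,t}$ is a probability measure on $V$ for every $y\ge0$ and almost every $t>0$, it is constant in $y\in[k,k+1)$ for every integer $k\ge0$, and $$\mu_{0,t}=\delta_{u_B(t)}\qquad\text{for a.e. }t>0 .$$ Moreover there is a Young measure $\nu_{0,t}$ on $V$, $t>0$, such that for every convex split entropy $(U,F^\pm)$ on $V$ that satisfies the discrete entropy inequality on $V$,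 with $F=F^++F^-$, the following holds. First, $\nu_{0,t}$ is a trace of $\nu_{x,t}$ at $x=0$: for every $\theta\in L^1(0,\infty)$, $$\lim_{x\to0+}\int_0^\infty\langle\nu_{x,t},F\rangle\,\theta(t)\,dt=\int_0^\infty\langle\nu_{0,t},F\rangle\,\theta(t)\,dt ,$$ null sets of $x$ being disregarded in the limit. Second, for all $y\ge0$ and almost every $t>0$, $$\begin{aligned}F^+(u_B(t))+\langle\mu_{1,t},F^-\rangle&\ \ge\ \langle\mu_{y,t},F^+\rangle+\langle\mu_{y+1,t},F^-\rangle\\&\ \ge\ \langle\mu_{y+1,t},F^+\rangle+\langle\mu_{y+2,t},F^-\rangle\\&\ \ge\ \langle\nu_{0,t},F\rangle .\end{aligned}$$ Third, for almost every $t>0$ the following limit exists and $$\lim_{y\to+\infty}\bigl(\langle\mu_{y,t},F^+\rangle+\langle\mu_{y+1,t},F^-\rangle\bigr)\ \ge\ \langle\nu_{0,t},F\rangle .$$ -/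

import Mathlib

open MeasureTheory ProbabilityTheory Filter Topology Set
open scoped ContDiff

namespace BoundaryLayer

/-- The space of states, with its Euclidean norm. -/
abbrev State (N : ℕ) : Type := EuclideanSpace ℝ (Fin N)

/-! ### Entropy pairs and entropy flux-splittings -/

/-- `(U, F)` is an entropy pair of class `C²` on `V` for the flux `f`:
`∇F(u) = ∇U(u) ∇f(u)` for all `u ∈ V`. -/
def IsEntropyPair {N : ℕ} (f : State N → State N) (U F : State N → ℝ)
    (V : Set (State N)) : Prop :=
  ContDiffOn ℝ 2 U V ∧ ContDiffOn ℝ 2 F V ∧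
    ∀ u ∈ V, fderiv ℝ F u = (fderiv ℝ U u).comp (fderiv ℝ f u)

/-- The Hessian matrix of `U` is non-negative on `V`. -/
def HasNonnegHessian {N : ℕ} (U : State N → ℝ) (V : Set (State N)) : Prop :=
  ∀ u ∈ V, ∀ ξ : State N, 0 ≤ fderiv ℝ (fderiv ℝ U) u ξ ξ

/-- The Hessian matrix of `U` is positive definite on `V`. -/
def HasPosDefHessian {N : ℕ} (U : State N → ℝ) (V : Set (State N)) : Prop :=
  ∀ u ∈ V, ∀ ξ : State N, ξ ≠ 0 → 0 < fderiv ℝ (fderiv ℝ U) u ξ ξ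

/-- `U` is an entropy, with entropy fluxes `Fp` and `Fm`, for both parts `fp` and `fm` of a
splitting. Then `(U, Fp + Fm)` is an entropy pair for the flux `fp + fm`. -/
def IsSplitEntropy {N : ℕ} (fp fm : State N → State N) (U Fp Fm : State N → ℝ)
    (V : Set (State N)) : Prop :=
  IsEntropyPair fp U Fp V ∧ IsEntropyPair fm U Fm V

/-- Real eigenvalues and a basis of eigenvectors. -/
def IsRealDiagonalizable {N : ℕ} (A : State N →L[ℝ] State N) : Prop :=
  ∃ b : Module.Basis (Fin N) ℝ (State N), ∀ i, ∃ a : ℝ, A (b i) = a • b i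

/-- `f = fp + fm` is an entropy flux-splitting on `V`: both parts are smooth, their
Jacobian matrices are diagonalizable over the reals, and some strictly convex
entropy is an entropy for both parts. -/
structure IsEntropyFluxSplitting {N : ℕ} (fp fm : State N → State N)
    (V : Set (State N)) : Prop where
  smooth_pos : ContDiffOn ℝ ∞ fp V
  smooth_neg : ContDiffOn ℝ ∞ fm V
  diag_pos : ∀ u ∈ V, IsRealDiagonalizable (fderiv ℝ fp u)
  diag_neg : ∀ u ∈ V, IsRealDiagonalizable (fderiv ℝ fm u)
  exists_entropy : ∃ U Fp Fm : State N → ℝ,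
    IsSplitEntropy fp fm U Fp Fm V ∧ HasPosDefHessian U V

/-! ### Numerical fluxes -/

/-- The numerical flux `g(v, w) = f⁻(w) + f⁺(v)` of the splitting. The same formula with
`F⁻`, `F⁺` gives the numerical entropy flux. -/
def splitFlux {N : ℕ} {X : Type*} [Add X] (fp fm : State N → X) (v w : State N) : X :=
  fm w + fp v

/-- One step of the scheme at a cell with value `v`, left neighbour `u`, right
neighbour `w`. -/
noncomputable def splitStep {N : ℕ} (fp fm : State N → State N) (lam : ℝ)
    (u v w : State N) : State N :=
  v - lam • splitFlux fp fm v w + lam • splitFlux fp fm u v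

/-- The discrete entropy inequality of the scheme for the entropy `U`, as long as all values
lie in `V`. -/
def DiscreteEntropyInequality {N : ℕ} (fp fm : State N → State N) (lam : ℝ)
    (U Fp Fm : State N → ℝ) (V : Set (State N)) : Prop :=
  ∀ u ∈ V, ∀ v ∈ V, ∀ w ∈ V, splitStep fp fm lam u v w ∈ V →
    U (splitStep fp fm lam u v w) - U v
      + lam * (splitFlux Fp Fm v w - splitFlux Fp Fm u v) ≤ 0

/-- Upwinding and stability (CFL) at the state `c`: the eigenvalues of `∇f⁺(c)` are `≥ 0`, those
of `∇f⁻(c)` are `≤ 0`, those of `λ ∇(f⁺ - f⁻)(c)` are `< 1`, and a kernel that `∇f⁺(c)` or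
`∇f⁻(c)` may have is annihilated by `∇f⁺(u)`, respectively `∇f⁻(u)`, for all `u` near `c`. -/
structure IsStableAt {N : ℕ} (fp fm : State N → State N) (lam : ℝ) (c : State N) : Prop where
  eig_pos : ∀ a : ℝ,
    Module.End.HasEigenvalue (fderiv ℝ fp c : State N →ₗ[ℝ] State N) a → 0 ≤ a
  eig_neg : ∀ a : ℝ,
    Module.End.HasEigenvalue (fderiv ℝ fm c : State N →ₗ[ℝ] State N) a → a ≤ 0
  eig_cfl : ∀ a : ℝ,
    Module.End.HasEigenvalue
      (fderiv ℝ fp c - fderiv ℝ fm c : State N →L[ℝ] State N).toLinearMap a → lam * a < 1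
  ker_pos : ∀ᶠ u in 𝓝 c, ∀ ξ, fderiv ℝ fp c ξ = 0 → fderiv ℝ fp u ξ = 0
  ker_neg : ∀ᶠ u in 𝓝 c, ∀ ξ, fderiv ℝ fm c ξ = 0 → fderiv ℝ fm u ξ = 0

/-! ### The scheme with boundary and initial data -/

/-- The cell values `v k t` (cell `k` is `[k h, (k+1) h)`, time `t ≥ 0`) of the flux-splitting
scheme with mesh sizes `h` and `τ = lam * h`: boundary data `uB` in cell `0`, initial values
`a k` in the cells `k ≥ 1` for `t < τ`. -/
structure IsSplittingScheme {N : ℕ} (fp fm : State N → State N) (lam h : ℝ)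
    (uB : ℝ → State N) (a : ℕ → State N) (v : ℕ → ℝ → State N) : Prop where
  boundary : ∀ t, 0 ≤ t → v 0 t = uB t
  initial : ∀ k, 1 ≤ k → ∀ t, 0 ≤ t → t < lam * h → v k t = a k
  step : ∀ k t, 0 ≤ t →
    v (k + 1) (t + lam * h) = splitStep fp fm lam (v k t) (v (k + 1) t) (v (k + 2) t)

/-- The function `u^h(x, t)`, piecewise constant in `x`, with the given cell values. -/
noncomputable def meshFunction {N : ℕ} (h : ℝ) (v : ℕ → ℝ → State N) (x t : ℝ) : State N :=
  v ⌊x / h⌋₊ t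

/-- The rescaled function `v^h(y, t) = u^h(y h, t)`. -/
noncomputable def rescaled {N : ℕ} (h : ℝ) (v : ℕ → ℝ → State N) (y t : ℝ) : State N :=
  meshFunction h v (y * h) t

/-! ### Young measures -/

/-- Lebesgue measure on the quarter plane `x > 0`, `t > 0`. -/
noncomputable def quarterPlane : Measure (ℝ × ℝ) :=
  (volume : Measure (ℝ × ℝ)).restrict (Ioi 0 ×ˢ Ioi 0)

/-- A measurable family of probability measures, carried by `V` at almost every point. -/
def IsYoungMeasure {Z : Type*} [MeasurableSpace Z] {N : ℕ} (m : Measure Z)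
    (V : Set (State N)) (κ : Kernel Z (State N)) : Prop :=
  IsMarkovKernel κ ∧ ∀ᵐ z ∂m, κ z Vᶜ = 0

/-- `κ` is a Young measure associated with the sequence `w`: `g(w n)` converges to `⟨κ, g⟩`
weakly-star in `L^∞(m)` for every continuous `g`. (For sequences with values in a fixed compact
subset of `V` it is the same to test with bounded continuous functions on the whole space
or with all continuous functions on `V`.) -/
def IsYoungMeasureOf {Z : Type*} [MeasurableSpace Z] {N : ℕ} (m : Measure Z)
    (V : Set (State N)) (w : ℕ → Z → State N) (κ : Kernel Z (State N)) : Prop :=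
  IsYoungMeasure m V κ ∧
    ∀ g : BoundedContinuousFunction (State N) ℝ, ∀ φ : Z → ℝ, Integrable φ m →
      Tendsto (fun n => ∫ z, φ z * g (w n z) ∂m) atTop
        (𝓝 (∫ z, φ z * (∫ u, g u ∂(κ z)) ∂m))

/-- `⟨ν_{0,t}, F⟩` is the trace of `⟨ν_{x,t}, F⟩` at `x = 0+`: for every integrable weight
`θ` in time, `∫ ⟨ν_{x,t}, F⟩ θ(t) dt → ∫ ⟨ν_{0,t}, F⟩ θ(t) dt` as `x → 0+`. Since `ν` is only
determined almost everywhere, the limit disregards null sets of `x`. -/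
def IsTraceFor {N : ℕ} (ν : Kernel (ℝ × ℝ) (State N)) (ν₀ : Kernel ℝ (State N))
    (F : State N → ℝ) : Prop :=
  ∀ θ : ℝ → ℝ, IntegrableOn θ (Ioi 0) →
    Tendsto (fun x => ∫ t in Ioi (0 : ℝ), (∫ u, F u ∂(ν (x, t))) * θ t)
      (𝓝[>] (0 : ℝ) ⊓ ae volume)
      (𝓝 (∫ t in Ioi (0 : ℝ), (∫ u, F u ∂(ν₀ t)) * θ t))

/-- `⟨μ_{y,t}, F⁺⟩ + ⟨μ_{y+1,t}, F⁻⟩`. -/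
noncomputable def layerFlux {N : ℕ} (μ : Kernel (ℝ × ℝ) (State N)) (Fp Fm : State N → ℝ)
    (y t : ℝ) : ℝ :=
  (∫ u, Fp u ∂(μ (y, t))) + ∫ u, Fm u ∂(μ (y + 1, t))

/-! ### Lax-Friedrichs type schemes are flux-splitting schemes -/

/-- The numerical flux of the Lax-Friedrichs type scheme; the same formula with `(U, F)`
gives its numerical entropy flux. -/
noncomputable def laxFlux {N : ℕ} {X : Type*} [AddCommGroup X] [Module ℝ X]
    (Q lam : ℝ) (i f : State N → X) (v w : State N) : X :=
  (1 / 2 : ℝ) • (f v + f w) - (Q / lam) • (i w - i v)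

/-- The part `f/2 + (Q/λ) id` of the flux (for entropies: `F/2 + (Q/λ) U`). -/
noncomputable def laxPos {N : ℕ} {X : Type*} [AddCommGroup X] [Module ℝ X]
    (Q lam : ℝ) (i f : State N → X) (u : State N) : X :=
  (1 / 2 : ℝ) • f u + (Q / lam) • i u

/-- The part `f/2 - (Q/λ) id` of the flux (for entropies: `F/2 - (Q/λ) U`). -/
noncomputable def laxNeg {N : ℕ} {X : Type*} [AddCommGroup X] [Module ℝ X]
    (Q lam : ℝ) (i f : State N → X) (u : State N) : X :=
  (1 / 2 : ℝ) • f u - (Q / lam) • i u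

theorem laxFlux_eq_splitFlux {N : ℕ} {X : Type*} [AddCommGroup X] [Module ℝ X]
    (Q lam : ℝ) (i f : State N → X) :
    laxFlux Q lam i f = splitFlux (laxPos Q lam i f) (laxNeg Q lam i f) := by
  funext v w
  simp only [laxFlux, splitFlux, laxPos, laxNeg]
  module

theorem hasFDerivAt_laxPos {N : ℕ} {X : Type*} [NormedAddCommGroup X] [NormedSpace ℝ X]
    (Q lam : ℝ) {i f : State N → X} {u : State N} (hi : DifferentiableAt ℝ i u)
    (hf : DifferentiableAt ℝ f u) :
    HasFDerivAt (laxPos Q lam i f)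
      ((1 / 2 : ℝ) • fderiv ℝ f u + (Q / lam) • fderiv ℝ i u) u :=
  (hf.hasFDerivAt.const_smul (1 / 2 : ℝ)).add (hi.hasFDerivAt.const_smul (Q / lam))

theorem hasFDerivAt_laxNeg {N : ℕ} {X : Type*} [NormedAddCommGroup X] [NormedSpace ℝ X]
    (Q lam : ℝ) {i f : State N → X} {u : State N} (hi : DifferentiableAt ℝ i u)
    (hf : DifferentiableAt ℝ f u) :
    HasFDerivAt (laxNeg Q lam i f)
      ((1 / 2 : ℝ) • fderiv ℝ f u - (Q / lam) • fderiv ℝ i u) u :=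
  (hf.hasFDerivAt.const_smul (1 / 2 : ℝ)).sub (hi.hasFDerivAt.const_smul (Q / lam))

/-- Every entropy pair of `f` splits along the Lax-Friedrichs splitting. -/
theorem isSplitEntropy_lax {N : ℕ} {V : Set (State N)} (hV : IsOpen V) {f : State N → State N}
    (hf : ContDiffOn ℝ ∞ f V) {U F : State N → ℝ} (h : IsEntropyPair f U F V) (Q lam : ℝ) :
    IsSplitEntropy (laxPos Q lam id f) (laxNeg Q lam id f)
      U (laxPos Q lam U F) (laxNeg Q lam U F) V := by
  obtain ⟨hU, hF, hc⟩ := h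
  have key : ∀ u ∈ V, DifferentiableAt ℝ f u ∧ DifferentiableAt ℝ U u ∧
      DifferentiableAt ℝ F u := fun u hu =>
    ⟨(hf.contDiffAt (hV.mem_nhds hu)).differentiableAt (by simp),
      (hU.contDiffAt (hV.mem_nhds hu)).differentiableAt (by simp),
      (hF.contDiffAt (hV.mem_nhds hu)).differentiableAt (by simp)⟩
  refine ⟨⟨hU, (hF.const_smul (1 / 2 : ℝ)).add (hU.const_smul (Q / lam)), fun u hu => ?_⟩,
    ⟨hU, (hF.const_smul (1 / 2 : ℝ)).sub (hU.const_smul (Q / lam)), fun u hu => ?_⟩⟩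
  · obtain ⟨d1, d2, d3⟩ := key u hu
    rw [(hasFDerivAt_laxPos Q lam d2 d3).fderiv,
      (hasFDerivAt_laxPos Q lam differentiableAt_id d1).fderiv, hc u hu, fderiv_id]
    ext x
    simp
  · obtain ⟨d1, d2, d3⟩ := key u hu
    rw [(hasFDerivAt_laxNeg Q lam d2 d3).fderiv,
      (hasFDerivAt_laxNeg Q lam differentiableAt_id d1).fderiv, hc u hu, fderiv_id]
    ext x
    simp

/-- For a hyperbolic flux `f` with a strictly convex entropy, the Lax-Friedrichs splitting is
an entropy flux-splitting. -/
theorem isEntropyFluxSplitting_lax {N : ℕ} {V : Set (State N)} (hV : IsOpen V)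
    {f : State N → State N} (hf : ContDiffOn ℝ ∞ f V)
    (hd : ∀ u ∈ V, IsRealDiagonalizable (fderiv ℝ f u))
    (he : ∃ U F : State N → ℝ, IsEntropyPair f U F V ∧ HasPosDefHessian U V) (Q lam : ℝ) :
    IsEntropyFluxSplitting (laxPos Q lam id f) (laxNeg Q lam id f) V := by
  have d : ∀ u ∈ V, DifferentiableAt ℝ f u := fun u hu =>
    (hf.contDiffAt (hV.mem_nhds hu)).differentiableAt (by simp)
  refine ⟨(hf.const_smul (1 / 2 : ℝ)).add (contDiffOn_id.const_smul (Q / lam)),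
    (hf.const_smul (1 / 2 : ℝ)).sub (contDiffOn_id.const_smul (Q / lam)), ?_, ?_, ?_⟩
  · intro u hu
    obtain ⟨b, hb⟩ := hd u hu
    refine ⟨b, fun i => ?_⟩
    obtain ⟨a, ha⟩ := hb i
    refine ⟨1 / 2 * a + Q / lam, ?_⟩
    rw [(hasFDerivAt_laxPos Q lam differentiableAt_id (d u hu)).fderiv, fderiv_id]
    simp only [add_apply, smul_apply, ha,
      ContinuousLinearMap.id_apply]
    module
  · intro u hu
    obtain ⟨b, hb⟩ := hd u hu
    refine ⟨b, fun i => ?_⟩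
    obtain ⟨a, ha⟩ := hb i
    refine ⟨1 / 2 * a - Q / lam, ?_⟩
    rw [(hasFDerivAt_laxNeg Q lam differentiableAt_id (d u hu)).fderiv, fderiv_id]
    simp only [sub_apply, smul_apply, ha,
      ContinuousLinearMap.id_apply]
    module
  · obtain ⟨U, F, h, hU⟩ := he
    exact ⟨U, _, _, isSplitEntropy_lax hV hf h Q lam, hU⟩

/-- The Lax-Friedrichs splitting is stable at `c` if `λ |a| < 2 Q < 1` for all eigenvalues `a`
of `∇f(c)`. -/
theorem isStableAt_lax {N : ℕ} {f : State N → State N} {c : State N}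
    (hf : DifferentiableAt ℝ f c) {Q lam : ℝ} (hlam : 0 < lam) (hQ0 : 0 < Q) (hQ : 2 * Q < 1)
    (he : ∀ a : ℝ, Module.End.HasEigenvalue (fderiv ℝ f c : State N →ₗ[ℝ] State N) a →
      lam * |a| < 2 * Q) :
    IsStableAt (laxPos Q lam id f) (laxNeg Q lam id f) lam c := by
  have ep : fderiv ℝ (laxPos Q lam id f) c =
      (1 / 2 : ℝ) • fderiv ℝ f c + (Q / lam) • ContinuousLinearMap.id ℝ (State N) := by
    rw [(hasFDerivAt_laxPos Q lam differentiableAt_id hf).fderiv, fderiv_id]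
  have em : fderiv ℝ (laxNeg Q lam id f) c =
      (1 / 2 : ℝ) • fderiv ℝ f c - (Q / lam) • ContinuousLinearMap.id ℝ (State N) := by
    rw [(hasFDerivAt_laxNeg Q lam differentiableAt_id hf).fderiv, fderiv_id]
  have hQl : lam * (Q / lam) = Q := by field_simp
  have hp : ∀ (a : ℝ) (x : State N), x ≠ 0 → fderiv ℝ (laxPos Q lam id f) c x = a • x →
      0 < a := by
    intro a x hx h
    rw [ep] at h
    simp only [add_apply, smul_apply,
      ContinuousLinearMap.id_apply] at h
    have h' : fderiv ℝ f c x = (2 * (a - Q / lam)) • x := by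
      have h2 : fderiv ℝ f c x =
          (2 : ℝ) • ((1 / 2 : ℝ) • fderiv ℝ f c x + (Q / lam) • x) - (2 * (Q / lam)) • x := by
        module
      rw [h2, h]
      module
    have := he _ (Module.End.hasEigenvalue_of_hasEigenvector
      (Module.End.hasEigenvector_iff.2 ⟨Module.End.mem_eigenspace_iff.2 h', hx⟩))
    have h1 := neg_abs_le (2 * (a - Q / lam))
    have h2 : lam * (2 * (a - Q / lam)) = 2 * (lam * a) - 2 * Q := by linear_combination -2 * hQl
    nlinarith
  have hm : ∀ (a : ℝ) (x : State N), x ≠ 0 → fderiv ℝ (laxNeg Q lam id f) c x = a • x →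
      a < 0 := by
    intro a x hx h
    rw [em] at h
    simp only [sub_apply, smul_apply,
      ContinuousLinearMap.id_apply] at h
    have h' : fderiv ℝ f c x = (2 * (a + Q / lam)) • x := by
      have h2 : fderiv ℝ f c x =
          (2 : ℝ) • ((1 / 2 : ℝ) • fderiv ℝ f c x - (Q / lam) • x) + (2 * (Q / lam)) • x := by
        module
      rw [h2, h]
      module
    have := he _ (Module.End.hasEigenvalue_of_hasEigenvector
      (Module.End.hasEigenvector_iff.2 ⟨Module.End.mem_eigenspace_iff.2 h', hx⟩))
    have h1 := le_abs_self (2 * (a + Q / lam))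
    have h2 : lam * (2 * (a + Q / lam)) = 2 * (lam * a) + 2 * Q := by
      linear_combination 2 * hQl
    nlinarith
  refine ⟨fun a ha => ?_, fun a ha => ?_, fun a ha => ?_, ?_, ?_⟩
  · obtain ⟨x, hx⟩ := ha.exists_hasEigenvector
    exact (hp a x hx.2 hx.apply_eq_smul).le
  · obtain ⟨x, hx⟩ := ha.exists_hasEigenvector
    exact (hm a x hx.2 hx.apply_eq_smul).le
  · obtain ⟨x, hx⟩ := ha.exists_hasEigenvector
    have h : (fderiv ℝ (laxPos Q lam id f) c - fderiv ℝ (laxNeg Q lam id f) c) x = a • x :=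
      hx.apply_eq_smul
    rw [ep, em] at h
    simp only [add_apply, sub_apply,
      smul_apply, ContinuousLinearMap.id_apply] at h
    have h' : (a - 2 * (Q / lam)) • x = 0 := by
      have h2 : (a - 2 * (Q / lam)) • x = a • x - (2 * (Q / lam)) • x := by module
      rw [h2, ← h]
      module
    rcases smul_eq_zero.1 h' with h0 | h0
    · have : lam * a = 2 * Q := by linear_combination lam * h0 + 2 * hQl
      linarith
    · exact absurd h0 hx.2
  · refine Eventually.of_forall fun u ξ h => ?_
    by_cases hξ : ξ = 0
    · simp [hξ]
    · exact absurd (hp 0 ξ hξ (by simpa using h)) (lt_irrefl _)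
  · refine Eventually.of_forall fun u ξ h => ?_
    by_cases hξ : ξ = 0
    · simp [hξ]
    · exact absurd (hm 0 ξ hξ (by simpa using h)) (lt_irrefl _)

end BoundaryLayer

namespace BoundaryLayer

/-! ### Symmetric operators for a bilinear form -/

/-! Local entropy inequality. With `p = λ f⁺` and `q = -λ f⁻` the step reads `v* = v + (p(u) - p(v))
+ (q(w) - q(v))`. Put `u = v + a`, `w = v + b` and follow the entropy defect along `t ↦ (v + t a, v
+ t b)`. Its derivative is, to leading order, `-t D(a, b)` with `D(a, b) = ⟨Pa, a⟩ + ⟨Mb, b⟩ - |Pa +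
Mb|²`, where `P`, `M` are the Jacobians of `p`, `q` at `c` and the scalar product is the Hessian of
`U` at `c`. The compatibility of entropy and flux makes `P` and `M` symmetric for it
(`hessian_fderiv_symm`), so the eigenvalue conditions say `P ≥ 0`, `M ≥ 0`, `P + M < 1`. Completing
squares shows that `D` is positive off the kernels (`dissipation_pos`). The kernel condition allows
increments to be projected orthogonally to the kernels without changing fluxes
(`eventually_exists_projection`); there `D` is coercive and absorbs the errors
(`exists_entropy_le_of_coercive`).

Boundary layer. In the rescaled variable the schemes are constant in `y` on unit cells, so the limit
`μ` is too, and it may be replaced by its cell averages; in cell `0` the values are the fixed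
boundary data, which gives a Dirac measure. Integrate the discrete entropy inequality against a
weight `φ(t)` and move the time difference onto `φ`: the flux `A n k` between the cells `k` and `k +
1` satisfies `A n (k + 1) ≤ A n k + C h` (`integral_mul_le_of_time_step`). For fixed `k` the error
disappears in the limit, and the layer fluxes decrease. At a distance `x` about `x / h` steps have
accumulated an error `C x`; hence the weak limit `Φ(x) = ∫ φ ⟨ν_{x,t}, F⟩ dt` is decreasing up to `C
x`, has a limit at `0+`, and this limit lies below all the layer fluxes (`exists_trace_of_cells`).

The trace measure must not depend on the entropy. It is obtained once, by compactness, as a limit of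
the sections `ν_{x,·}` along an ultrafilter (`exists_kernel_limit`). For an entropy flux the true
limit exists and must agree with the ultrafilter limit, so this one measure serves all entropies.
Density of the test weights in `L¹` turns integrated statements into statements for almost every
`t`. -/

theorem isSymmetric_nonneg_of_eigenvalues {E : Type*} [NormedAddCommGroup E]
    [InnerProductSpace ℝ E] [FiniteDimensional ℝ E] {T : E →ₗ[ℝ] E} (hT : T.IsSymmetric)
    (heig : ∀ a : ℝ, Module.End.HasEigenvalue T a → 0 ≤ a) (x : E) :
    0 ≤ inner ℝ (T x) x ∧ (inner ℝ (T x) x = 0 → T x = 0) := by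
  set b := hT.eigenvectorBasis rfl
  have hb : ∀ i, T (b i) = hT.eigenvalues rfl i • b i := fun i =>
    hT.apply_eigenvectorBasis rfl i
  have h0 : ∀ i, 0 ≤ hT.eigenvalues rfl i := fun i => by
    simpa using heig _ (hT.hasEigenvalue_eigenvalues rfl i)
  have hc : ∀ i, inner ℝ (T x) (b i) = hT.eigenvalues rfl i * inner ℝ x (b i) := fun i => by
    rw [hT, hb, inner_smul_right]
  have key : inner ℝ (T x) x = ∑ i, hT.eigenvalues rfl i * inner ℝ x (b i) ^ 2 := by
    rw [← b.sum_inner_mul_inner]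
    refine Finset.sum_congr rfl fun i _ => ?_
    rw [hc, real_inner_comm x (b i)]
    ring
  have hn : ∀ i, 0 ≤ hT.eigenvalues rfl i * inner ℝ x (b i) ^ 2 := fun i =>
    mul_nonneg (h0 i) (sq_nonneg _)
  refine ⟨key ▸ Finset.sum_nonneg fun i _ => hn i, fun h => ?_⟩
  rw [key, Finset.sum_eq_zero_iff_of_nonneg fun i _ => hn i] at h
  refine InnerProductSpace.ext_inner_right_basis b.toBasis fun i => ?_
  rw [b.coe_toBasis, hc, inner_zero_left]
  have := h i (Finset.mem_univ i)
  rcases mul_eq_zero.1 this with h | h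
  · rw [h, zero_mul]
  · rw [pow_eq_zero_iff two_ne_zero] at h
    rw [h, mul_zero]

section Form

variable {E : Type*} [AddCommGroup E] [Module ℝ E] [FiniteDimensional ℝ E]

/-- An operator which is symmetric for a scalar product `B` and has non-negative eigenvalues is
non-negative for `B`. -/
theorem form_nonneg_of_eigenvalues (B : E →ₗ[ℝ] E →ₗ[ℝ] ℝ) (hsymm : ∀ x y, B x y = B y x)
    (hpos : ∀ x, x ≠ 0 → 0 < B x x) {T : E →ₗ[ℝ] E} (hT : ∀ x y, B (T x) y = B x (T y))
    (heig : ∀ a : ℝ, Module.End.HasEigenvalue T a → 0 ≤ a) (x : E) :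
    0 ≤ B (T x) x ∧ (B (T x) x = 0 → T x = 0) := by
  -- With `B` as the inner product, `T` is self-adjoint and the spectral theorem applies.
  let core : InnerProductSpace.Core ℝ E :=
    { inner := fun x y => B x y
      conj_inner_symm := fun x y => by simpa using hsymm y x
      re_inner_nonneg := fun x => by
        rcases eq_or_ne x 0 with rfl | h
        · simp
        · exact (hpos x h).le
      add_left := fun x y z => by simp
      smul_left := fun x y r => by simp
      definite := fun x h => by
        by_contra h0
        exact (hpos x h0).ne' h }
  let : NormedAddCommGroup E := core.toNormedAddCommGroup
  let : InnerProductSpace ℝ E := InnerProductSpace.ofCore core.toCore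
  exact isSymmetric_nonneg_of_eigenvalues (T := T) (fun x y => hT x y) heig x

/-- The dissipation form of two non-negative operators `P`, `M` with `P + M < 1` is
positive definite on complements of the kernels. -/
theorem dissipation_pos (B : E →ₗ[ℝ] E →ₗ[ℝ] ℝ) (hsymm : ∀ x y, B x y = B y x)
    (hpos : ∀ x, x ≠ 0 → 0 < B x x) {P M : E →ₗ[ℝ] E} (hP : ∀ x y, B (P x) y = B x (P y))
    (hM : ∀ x y, B (M x) y = B x (M y))
    (eP : ∀ a : ℝ, Module.End.HasEigenvalue P a → 0 ≤ a)
    (eM : ∀ a : ℝ, Module.End.HasEigenvalue M a → 0 ≤ a)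
    (eS : ∀ a : ℝ, Module.End.HasEigenvalue (P + M) a → a < 1) {a b : E}
    (hab : P a ≠ 0 ∨ M b ≠ 0) :
    0 < B (P a) a + B (M b) b - B (P a + M b) (P a + M b) := by
  have nP := form_nonneg_of_eigenvalues B hsymm hpos hP eP
  have nM := form_nonneg_of_eigenvalues B hsymm hpos hM eM
  -- With this `z` the form equals `B (P (a - z)) (a - z) + B (M (b - z)) (b - z) + B ((1 - P - M)
  -- z) z`, a sum of three non-negative terms.
  set z := P a + M b with hz
  have hT : ∀ x y, B ((1 - (P + M)) x) y = B x ((1 - (P + M)) y) := fun x y => by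
    simp [hP, hM]
  have ev : ∀ s : ℝ, Module.End.HasEigenvalue (1 - (P + M)) s → 0 < s := fun s hs => by
    obtain ⟨x, hx⟩ := hs.exists_hasEigenvector
    have h1 := hx.apply_eq_smul
    have h2 : (P + M) x = (1 - s) • x := by
      rw [sub_smul, one_smul, ← h1]
      simp
    have := eS _ (Module.End.hasEigenvalue_of_hasEigenvector
      (Module.End.hasEigenvector_iff.2 ⟨Module.End.mem_eigenspace_iff.2 h2, hx.2⟩))
    linarith
  have nS := form_nonneg_of_eigenvalues B hsymm hpos hT (fun s hs => (ev s hs).le) z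
  have e1 := (nP (a - z)).1
  have e2 := (nM (b - z)).1
  have x1 : B (P z) a = B (P a) z := by rw [hP, hsymm]
  have x2 : B (M z) b = B (M b) z := by rw [hM, hsymm]
  have x3 : B z z = B (P a) z + B (M b) z := by
    rw [← LinearMap.add_apply, ← map_add]
  have x4 : B ((1 - (P + M)) z) z = B z z - B (P z) z - B (M z) z := by
    simp
    ring
  simp only [map_sub, LinearMap.sub_apply] at e1 e2
  -- If `z ≠ 0` the third square is strictly positive; if `z = 0` only `B (P a) a + B (M b) b`
  -- remains, and it vanishes only if `P a = 0` and `M b = 0`.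
  by_cases h0 : z = 0
  · rw [h0]
    have p1 := (nP a)
    have p2 := (nM b)
    have : B (P a) a ≠ 0 ∨ B (M b) b ≠ 0 :=
      hab.imp (fun h h' => h (p1.2 h')) (fun h h' => h (p2.2 h'))
    simp only [map_zero, sub_zero]
    rcases this with h | h
    · exact add_pos_of_pos_of_nonneg (p1.1.lt_of_ne' h) p2.1
    · exact add_pos_of_nonneg_of_pos p1.1 (p2.1.lt_of_ne' h)
  · have : 0 < B ((1 - (P + M)) z) z := by
      refine nS.1.lt_of_ne' fun h => ?_
      have := nS.2 h
      exact (ev 0 (Module.End.hasEigenvalue_of_hasEigenvector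
        (Module.End.hasEigenvector_iff.2
          ⟨Module.End.mem_eigenspace_iff.2 (by rw [this, zero_smul]), h0⟩))).false
    linarith

end Form

/-- A positive continuous function, homogeneous of degree two, is coercive. -/
theorem exists_coercive {F : Type*} [NormedAddCommGroup F] [NormedSpace ℝ F]
    [FiniteDimensional ℝ F] {q : F → ℝ} (hq : Continuous q)
    (hom : ∀ (c : ℝ) (x : F), q (c • x) = c ^ 2 * q x) (hpos : ∀ x, x ≠ 0 → 0 < q x) :
    ∃ δ : ℝ, 0 < δ ∧ ∀ x, δ * ‖x‖ ^ 2 ≤ q x := by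
  have q0 : q 0 = 0 := by simpa using hom 0 0
  rcases subsingleton_or_nontrivial F with hF | hF
  · refine ⟨1, one_pos, fun x => ?_⟩
    rw [Subsingleton.elim x 0, q0]
    simp
  · have : ProperSpace F := FiniteDimensional.proper_real F
    obtain ⟨x0, hx0, hmin⟩ := (isCompact_sphere (0 : F) 1).exists_isMinOn
      (NormedSpace.sphere_nonempty.2 zero_le_one) hq.continuousOn
    have hx0' : x0 ≠ 0 := by
      rintro rfl
      simp at hx0
    refine ⟨q x0, hpos x0 hx0', fun x => ?_⟩
    rcases eq_or_ne x 0 with rfl | hx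
    · simp [q0]
    · have hn : 0 < ‖x‖ := norm_pos_iff.2 hx
      have h1 : q x0 ≤ q (‖x‖⁻¹ • x) := hmin (by
        simp [norm_smul, hn.ne'])
      have h2 : q x = ‖x‖ ^ 2 * q (‖x‖⁻¹ • x) := by
        rw [← hom, smul_smul, mul_inv_cancel₀ hn.ne', one_smul]
      rw [h2, mul_comm]
      gcongr

/-! ### The discrete entropy inequality near a constant state -/

section Local

variable {E : Type*} [NormedAddCommGroup E] [NormedSpace ℝ E]

/-- Linearization error of one term of the entropy production: `g` is an increment of `∇U` over the
displacement `d ≈ s d₀`, and `y ≈ y₀` is a flux derivative. Replacing `d`, `g`, `y` in turn costs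
`2`, `5` and `10` times `L² ε s m²`. The factor `s` in the error matters, since the leading term
also vanishes with `s`. -/
theorem pairing_le {H : E →L[ℝ] E →L[ℝ] ℝ} {g : E →L[ℝ] ℝ} {d d₀ y y₀ : E} {ε s m L : ℝ}
    (hε : 0 ≤ ε) (hε1 : ε ≤ 1) (hL : 1 ≤ L) (hs : 0 ≤ s) (hm : 0 ≤ m) (hH : ‖H‖ ≤ L)
    (hg : ‖g - H d‖ ≤ ε * ‖d‖) (hd : ‖d - s • d₀‖ ≤ 2 * ε * s * m) (hy : ‖y - y₀‖ ≤ ε * m)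
    (hd₀ : ‖d₀‖ ≤ 3 * L * m) (hy₀ : ‖y₀‖ ≤ L * m) :
    g y ≤ s * H d₀ y₀ + 17 * L ^ 2 * ε * s * m ^ 2 := by
  have hsm : 0 ≤ s * m := mul_nonneg hs hm
  have hdn : ‖d‖ ≤ 5 * L * (s * m) := by
    have h1 : ‖d‖ ≤ ‖d - s • d₀‖ + ‖s • d₀‖ := by
      simpa using norm_add_le (d - s • d₀) (s • d₀)
    rw [norm_smul, Real.norm_of_nonneg hs] at h1
    have h2 : s * ‖d₀‖ ≤ s * (3 * L * m) := by gcongr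
    have h3 : 2 * ε * s * m ≤ 2 * L * (s * m) := by
      nlinarith
    nlinarith
  have hgR : ‖g - H d‖ ≤ 5 * L * ε * (s * m) := by
    refine hg.trans ((mul_le_mul_of_nonneg_left hdn hε).trans_eq ?_)
    ring
  have hgn : ‖g‖ ≤ 10 * L ^ 2 * (s * m) := by
    have h1 : ‖g‖ ≤ ‖g - H d‖ + ‖H d‖ := by simpa using norm_add_le (g - H d) (H d)
    have h2 : ‖H d‖ ≤ L * (5 * L * (s * m)) :=
      (H.le_opNorm d).trans (mul_le_mul hH hdn (norm_nonneg _) (by linarith))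
    have h3 : 5 * L * ε * (s * m) ≤ 5 * L * L * (s * m) := by
      gcongr
      linarith
    nlinarith
  have e : g y = s * H d₀ y₀ + H (d - s • d₀) y₀ + (g - H d) y₀ + g (y - y₀) := by
    simp only [map_sub, map_smul, sub_apply, smul_apply, smul_eq_mul]
    ring
  have b1 : H (d - s • d₀) y₀ ≤ L * (2 * ε * s * m) * (L * m) := by
    refine (le_abs_self _).trans ((H.le_opNorm₂ _ _).trans ?_)
    gcongr
  have b2 : (g - H d) y₀ ≤ 5 * L * ε * (s * m) * (L * m) := by
    refine (le_abs_self _).trans (((g - H d).le_opNorm _).trans ?_)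
    gcongr
  have b3 : g (y - y₀) ≤ 10 * L ^ 2 * (s * m) * (ε * m) := by
    refine (le_abs_self _).trans ((g.le_opNorm _).trans ?_)
    gcongr
  rw [e]
  nlinarith

theorem exists_ball_approx {p : E → E} {c : E} (hp : ContDiffAt ℝ 1 p c) {ε : ℝ}
    (hε : 0 < ε) :
    ∃ ρ > 0, ∀ x ∈ Metric.ball c ρ, HasFDerivAt p (fderiv ℝ p x) x ∧
      ‖fderiv ℝ p x - fderiv ℝ p c‖ ≤ ε ∧
      ∀ y ∈ Metric.ball c ρ, ‖p x - p y - fderiv ℝ p c (x - y)‖ ≤ ε * ‖x - y‖ := by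
  have h1 : ∀ᶠ x in 𝓝 c, HasFDerivAt p (fderiv ℝ p x) x := by
    filter_upwards [hp.eventually (by simp)] with x hx
    exact (hx.differentiableAt (by simp)).hasFDerivAt
  have h2 : ∀ᶠ x in 𝓝 c, ‖fderiv ℝ p x - fderiv ℝ p c‖ ≤ ε := by
    have : ContinuousAt (fderiv ℝ p) c := (hp.fderiv_right (m := 0) (by simp)).continuousAt
    filter_upwards [Metric.tendsto_nhds.1 this ε hε] with x hx
    rw [← dist_eq_norm]
    exact hx.le
  obtain ⟨s, hs, happ⟩ :=
    (hp.hasStrictFDerivAt (by simp)).approximates_deriv_on_nhds (c := ⟨ε, hε.le⟩) (Or.inr hε)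
  obtain ⟨ρ, hρ, hb⟩ := Metric.mem_nhds_iff.1 (h1.and (h2.and hs))
  exact ⟨ρ, hρ, fun x hx => ⟨(hb hx).1, (hb hx).2.1, fun y hy =>
    happ _ (hb hx).2.2 _ (hb hy).2.2⟩⟩

/-- A coercive dissipation form at `c` gives the entropy inequality for increments in
the directions of coercivity. -/
theorem exists_entropy_le_of_coercive {p q : E → E} {U Gp Gq : E → ℝ} {c : E}
    (hp : ContDiffAt ℝ 1 p c) (hq : ContDiffAt ℝ 1 q c) (hU : ContDiffAt ℝ 2 U c)
    (hGp : ∀ᶠ x in 𝓝 c, HasFDerivAt Gp ((fderiv ℝ U x).comp (fderiv ℝ p x)) x)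
    (hGq : ∀ᶠ x in 𝓝 c, HasFDerivAt Gq ((fderiv ℝ U x).comp (fderiv ℝ q x)) x)
    {Wp Wq : Set E} {δ : ℝ} (hδ : 0 < δ)
    (hco : ∀ a ∈ Wp, ∀ b ∈ Wq, δ * max ‖a‖ ‖b‖ ^ 2 ≤
      fderiv ℝ (fderiv ℝ U) c a (fderiv ℝ p c a) + fderiv ℝ (fderiv ℝ U) c b (fderiv ℝ q c b)
        - fderiv ℝ (fderiv ℝ U) c (fderiv ℝ p c a + fderiv ℝ q c b)
            (fderiv ℝ p c a + fderiv ℝ q c b)) :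
    ∃ r > 0, ∀ v ∈ Metric.ball c r, ∀ a ∈ Wp, ∀ b ∈ Wq, ‖a‖ < r → ‖b‖ < r →
      U (v + (p (v + a) - p v) + (q (v + b) - q v)) - U v
        - (Gp (v + a) - Gp v) - (Gq (v + b) - Gq v) ≤ 0 := by
  set P := fderiv ℝ p c
  set M := fderiv ℝ q c
  set H := fderiv ℝ (fderiv ℝ U) c
  obtain ⟨L, hL1, hPL, hML, hHL⟩ : ∃ L : ℝ, 1 ≤ L ∧ ‖P‖ ≤ L ∧ ‖M‖ ≤ L ∧ ‖H‖ ≤ L :=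
    ⟨1 + ‖P‖ + ‖M‖ + ‖H‖, by linarith [norm_nonneg P, norm_nonneg M, norm_nonneg H],
      by linarith [norm_nonneg P, norm_nonneg M, norm_nonneg H],
      by linarith [norm_nonneg P, norm_nonneg M, norm_nonneg H],
      by linarith [norm_nonneg P, norm_nonneg M, norm_nonneg H]⟩
  -- `34 = 2 * 17`: `pairing_le` is applied once for `p` and once for `q`, and coercivity has to
  -- absorb both errors.
  obtain ⟨ε, hε, hε1, hεδ⟩ : ∃ ε : ℝ, 0 < ε ∧ ε ≤ 1 ∧ 34 * L ^ 2 * ε ≤ δ := by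
    refine ⟨min 1 (δ / (34 * L ^ 2)), by positivity, min_le_left _ _, ?_⟩
    calc 34 * L ^ 2 * min 1 (δ / (34 * L ^ 2)) ≤ 34 * L ^ 2 * (δ / (34 * L ^ 2)) := by
          gcongr
          exact min_le_right _ _
      _ = δ := by field_simp
  obtain ⟨ρ₁, hρ₁, ap⟩ := exists_ball_approx hp hε
  obtain ⟨ρ₂, hρ₂, aq⟩ := exists_ball_approx hq hε
  have hU' : ContDiffAt ℝ 1 (fderiv ℝ U) c := hU.fderiv_right (by norm_num)
  obtain ⟨s, hs, aU⟩ := (hU'.hasStrictFDerivAt (by simp)).approximates_deriv_on_nhds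
    (c := ⟨ε, hε.le⟩) (Or.inr hε)
  have hUd : ∀ᶠ x in 𝓝 c, HasFDerivAt U (fderiv ℝ U x) x := by
    filter_upwards [hU.eventually (by simp)] with x hx
    exact (hx.differentiableAt (by simp)).hasFDerivAt
  obtain ⟨ρ₃, hρ₃, hb⟩ := Metric.mem_nhds_iff.1 (hUd.and (hGp.and (hGq.and hs)))
  set ρ := min ρ₁ (min ρ₂ ρ₃) with hρdef
  have hρ : 0 < ρ := lt_min hρ₁ (lt_min hρ₂ hρ₃)
  have i1 : Metric.ball c ρ ⊆ Metric.ball c ρ₁ := Metric.ball_subset_ball (min_le_left _ _)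
  have i2 : Metric.ball c ρ ⊆ Metric.ball c ρ₂ :=
    Metric.ball_subset_ball ((min_le_right _ _).trans (min_le_left _ _))
  have i3 : Metric.ball c ρ ⊆ Metric.ball c ρ₃ :=
    Metric.ball_subset_ball ((min_le_right _ _).trans (min_le_right _ _))
  -- All points used below lie within `4 * L * m < ρ / 2` of `v`, and `v` lies within `ρ / 8` of
  -- `c`.
  have hr : 0 < ρ / (8 * L) := by positivity
  refine ⟨ρ / (8 * L), hr, fun v hv a ha b hb' har hbr => ?_⟩
  set r := ρ / (8 * L) with hrdef
  have hrρ : 8 * L * r = ρ := by rw [hrdef]; field_simp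
  set m := max ‖a‖ ‖b‖ with hmdef
  have hm0 : 0 ≤ m := (norm_nonneg a).trans (le_max_left _ _)
  have ham : ‖a‖ ≤ m := le_max_left _ _
  have hbm : ‖b‖ ≤ m := le_max_right _ _
  have hmr : m < r := max_lt har hbr
  rw [mem_ball_iff_norm] at hv
  have near : ∀ x : E, ‖x - v‖ ≤ 4 * L * m → x ∈ Metric.ball c ρ := fun x hx => by
    rw [mem_ball_iff_norm]
    have h1 : ‖x - c‖ ≤ ‖x - v‖ + ‖v - c‖ := norm_sub_le_norm_sub_add_norm_sub x v c
    have h2 : 4 * L * m ≤ 4 * L * r := by gcongr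
    nlinarith
  have nearS : ∀ (x : E) (t : ℝ), t ∈ Icc (0 : ℝ) 1 → ‖x‖ ≤ m → v + t • x ∈ Metric.ball c ρ := by
    intro x t ht hx
    refine near _ ?_
    rw [add_sub_cancel_left, norm_smul, Real.norm_of_nonneg ht.1]
    nlinarith [ht.1, ht.2, norm_nonneg x]
  have hvρ : v ∈ Metric.ball c ρ := near v (by simpa using by positivity)
  -- The updated state for the increments `t • a`, `t • b`; it runs from `v` at `t = 0` to the state
  -- of the claim at `t = 1`.
  set z : ℝ → E := fun t => v + (p (v + t • a) - p v) + (q (v + t • b) - q v) with hz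
  have hsmul : ∀ (x : E) (t : ℝ), HasDerivAt (fun t : ℝ => v + t • x) x t := fun x t => by
    simpa using ((hasDerivAt_id t).smul_const x).const_add v
  have estp : ∀ t ∈ Icc (0 : ℝ) 1, ‖p (v + t • a) - p v - t • P a‖ ≤ ε * t * m := by
    intro t ht
    have := (ap _ (i1 (nearS a t ht ham))).2.2 v (i1 hvρ)
    rw [add_sub_cancel_left, map_smul, norm_smul, Real.norm_of_nonneg ht.1] at this
    refine this.trans ?_
    rw [mul_assoc]
    have := ht.1
    gcongr
  have estq : ∀ t ∈ Icc (0 : ℝ) 1, ‖q (v + t • b) - q v - t • M b‖ ≤ ε * t * m := by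
    intro t ht
    have := (aq _ (i2 (nearS b t ht hbm))).2.2 v (i2 hvρ)
    rw [add_sub_cancel_left, map_smul, norm_smul, Real.norm_of_nonneg ht.1] at this
    refine this.trans ?_
    rw [mul_assoc]
    have := ht.1
    gcongr
  have hPa : ‖P a‖ ≤ L * m := (P.le_opNorm a).trans (by gcongr)
  have hMb : ‖M b‖ ≤ L * m := (M.le_opNorm b).trans (by gcongr)
  have estz : ∀ t ∈ Icc (0 : ℝ) 1, ‖z t - v - t • (P a + M b)‖ ≤ 2 * ε * t * m := by
    intro t ht
    have e : z t - v - t • (P a + M b) =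
        (p (v + t • a) - p v - t • P a) + (q (v + t • b) - q v - t • M b) := by
      simp only [hz, smul_add]
      abel
    rw [e]
    refine (norm_add_le _ _).trans ((add_le_add (estp t ht) (estq t ht)).trans_eq ?_)
    ring
  have hzρ : ∀ t ∈ Icc (0 : ℝ) 1, z t ∈ Metric.ball c ρ := by
    intro t ht
    refine near _ ?_
    have h1 : ‖z t - v‖ ≤ ‖z t - v - t • (P a + M b)‖ + ‖t • (P a + M b)‖ := by
      simpa using norm_add_le (z t - v - t • (P a + M b)) (t • (P a + M b))
    rw [norm_smul, Real.norm_of_nonneg ht.1] at h1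
    have h2 : ‖P a + M b‖ ≤ 2 * L * m := (norm_add_le _ _).trans (by linarith)
    have h3 : t * ‖P a + M b‖ ≤ 1 * (2 * L * m) :=
      mul_le_mul ht.2 h2 (norm_nonneg _) zero_le_one
    have h4 : 2 * ε * t * m ≤ 2 * 1 * 1 * m := by
      have := ht.1
      have := ht.2
      gcongr
    nlinarith [estz t ht]
  set e : ℝ → ℝ := fun t => U (z t) - U v - (Gp (v + t • a) - Gp v) - (Gq (v + t • b) - Gq v)
    with he
  have hder : ∀ t ∈ Icc (0 : ℝ) 1, HasDerivAt e
      ((fderiv ℝ U (z t) - fderiv ℝ U (v + t • a)) (fderiv ℝ p (v + t • a) a) +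
        (fderiv ℝ U (z t) - fderiv ℝ U (v + t • b)) (fderiv ℝ q (v + t • b) b)) t := by
    intro t ht
    have da := nearS a t ht ham
    have db := nearS b t ht hbm
    have dp := (ap _ (i1 da)).1.comp_hasDerivAt t (hsmul a t)
    have dq := (aq _ (i2 db)).1.comp_hasDerivAt t (hsmul b t)
    have dz : HasDerivAt z (fderiv ℝ p (v + t • a) a + fderiv ℝ q (v + t • b) b) t :=
      ((dp.sub_const (p v)).const_add v).add (dq.sub_const (q v))
    have dU := (hb (i3 (hzρ t ht))).1.comp_hasDerivAt t dz
    have dGp := (hb (i3 da)).2.1.comp_hasDerivAt t (hsmul a t)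
    have dGq := (hb (i3 db)).2.2.1.comp_hasDerivAt t (hsmul b t)
    have := ((dU.sub_const (U v)).sub (dGp.sub_const (Gp v))).sub (dGq.sub_const (Gq v))
    convert! this using 1
    simp only [map_add, sub_apply, ContinuousLinearMap.comp_apply]
    ring
  have hle : ∀ t ∈ Icc (0 : ℝ) 1,
      (fderiv ℝ U (z t) - fderiv ℝ U (v + t • a)) (fderiv ℝ p (v + t • a) a) +
        (fderiv ℝ U (z t) - fderiv ℝ U (v + t • b)) (fderiv ℝ q (v + t • b) b) ≤ 0 := by
    intro t ht
    have da := nearS a t ht ham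
    have db := nearS b t ht hbm
    have k1 := pairing_le (H := H) (g := fderiv ℝ U (z t) - fderiv ℝ U (v + t • a))
      (d := z t - (v + t • a)) (d₀ := P a + M b - a) (y := fderiv ℝ p (v + t • a) a)
      (y₀ := P a) hε.le hε1 hL1 ht.1 hm0 hHL
      (aU _ (hb (i3 (hzρ t ht))).2.2.2 _ (hb (i3 da)).2.2.2)
      (by
        convert! estz t ht using 2
        rw [smul_sub]
        abel)
      (by
        refine ((fderiv ℝ p (v + t • a) - P).le_opNorm a).trans ?_
        have := (ap _ (i1 da)).2.1
        gcongr)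
      (by
        have h1 := norm_sub_le (P a + M b) a
        have h2 := norm_add_le (P a) (M b)
        nlinarith)
      hPa
    have k2 := pairing_le (H := H) (g := fderiv ℝ U (z t) - fderiv ℝ U (v + t • b))
      (d := z t - (v + t • b)) (d₀ := P a + M b - b) (y := fderiv ℝ q (v + t • b) b)
      (y₀ := M b) hε.le hε1 hL1 ht.1 hm0 hHL
      (aU _ (hb (i3 (hzρ t ht))).2.2.2 _ (hb (i3 db)).2.2.2)
      (by
        convert! estz t ht using 2
        rw [smul_sub]
        abel)
      (by
        refine ((fderiv ℝ q (v + t • b) - M).le_opNorm b).trans ?_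
        have := (aq _ (i2 db)).2.1
        gcongr)
      (by
        have h1 := norm_sub_le (P a + M b) b
        have h2 := norm_add_le (P a) (M b)
        nlinarith)
      hMb
    have k3 := hco a ha b hb'
    -- The sum of the two leading terms is exactly minus the dissipation form.
    have k4 : H (P a + M b - a) (P a) + H (P a + M b - b) (M b) ≤ -(δ * m ^ 2) := by
      simp only [map_sub, map_add, sub_apply, add_apply] at k3 ⊢
      linarith
    have k5 : t * (H (P a + M b - a) (P a) + H (P a + M b - b) (M b)) ≤ t * -(δ * m ^ 2) :=
      mul_le_mul_of_nonneg_left k4 ht.1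
    have k6 : 34 * L ^ 2 * ε * (t * m ^ 2) ≤ δ * (t * m ^ 2) :=
      mul_le_mul_of_nonneg_right hεδ (mul_nonneg ht.1 (sq_nonneg m))
    linarith
  have hanti : AntitoneOn e (Icc 0 1) := by
    refine antitoneOn_of_deriv_nonpos (convex_Icc 0 1)
      (fun t ht => (hder t ht).continuousAt.continuousWithinAt)
      (fun t ht => (hder t (interior_subset ht)).differentiableAt.differentiableWithinAt)
      fun t ht => ?_
    rw [(hder t (interior_subset ht)).deriv]
    exact hle t (interior_subset ht)
  have := hanti (left_mem_Icc.2 zero_le_one) (right_mem_Icc.2 zero_le_one) zero_le_one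
  simpa [he, hz] using this

/-- A function is constant in directions annihilated by its derivative on a ball. -/
theorem eq_of_fderiv_apply_eq_zero {F : Type*} [NormedAddCommGroup F] [NormedSpace ℝ F]
    {f : E → F} {s : Set E} (hs : Convex ℝ s) (hf : ∀ x ∈ s, DifferentiableAt ℝ f x) {x y : E}
    (hx : x ∈ s) (hy : y ∈ s) (h : ∀ z ∈ s, fderiv ℝ f z (y - x) = 0) : f y = f x := by
  have hmem : ∀ t ∈ Icc (0 : ℝ) 1, x + t • (y - x) ∈ s := fun t ht =>
    hs.add_smul_sub_mem hx hy ht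
  have hd : ∀ t ∈ Icc (0 : ℝ) 1, HasDerivWithinAt (fun t : ℝ => f (x + t • (y - x))) 0
      (Icc 0 1) t := fun t ht => by
    have h1 : HasDerivAt (fun t : ℝ => x + t • (y - x)) (y - x) t := by
      simpa using ((hasDerivAt_id t).smul_const (y - x)).const_add x
    have h2 := (hf _ (hmem t ht)).hasFDerivAt.comp_hasDerivAt t h1
    rw [h _ (hmem t ht)] at h2
    exact h2.hasDerivWithinAt
  have := (convex_Icc (0 : ℝ) 1).norm_image_sub_le_of_norm_hasDerivWithin_le (C := 0) hd
    (fun t _ => by simp) (left_mem_Icc.2 zero_le_one) (right_mem_Icc.2 zero_le_one)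
  simp only [zero_smul, add_zero, one_smul, add_sub_cancel, zero_mul, norm_le_zero_iff] at this
  exact sub_eq_zero.1 this

end Local

/-! ### Symmetry, kernels and coercivity for the Jacobians at the constant state. -/

/-- The Hessian of an entropy symmetrizes the Jacobian matrix of the flux. -/
theorem hessian_fderiv_symm {E : Type*} [NormedAddCommGroup E] [NormedSpace ℝ E]
    {f : E → E} {U F : E → ℝ} {c : E} (hf : ContDiffAt ℝ 2 f c) (hU : ContDiffAt ℝ 2 U c)
    (hF : ContDiffAt ℝ 2 F c)
    (h : ∀ᶠ x in 𝓝 c, fderiv ℝ F x = (fderiv ℝ U x).comp (fderiv ℝ f x)) (x y : E) :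
    fderiv ℝ (fderiv ℝ U) c (fderiv ℝ f c x) y = fderiv ℝ (fderiv ℝ U) c x (fderiv ℝ f c y) := by
  have dU : DifferentiableAt ℝ (fderiv ℝ U) c :=
    (hU.fderiv_right (m := 1) (by norm_num)).differentiableAt (by simp)
  have df : DifferentiableAt ℝ (fderiv ℝ f) c :=
    (hf.fderiv_right (m := 1) (by norm_num)).differentiableAt (by simp)
  -- Differentiating `∇F = ∇U ∇f` gives `∇²F = ∇²U ∇f + ∇U ∇²f`. The left side and the last term are
  -- symmetric, hence so is `∇²U ∇f`.
  have hd : fderiv ℝ (fderiv ℝ F) c = _ :=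
    (EventuallyEq.fderiv_eq h).trans (dU.hasFDerivAt.clm_comp df.hasFDerivAt).fderiv
  have sF := hF.isSymmSndFDerivAt (by simp)
  have sU := hU.isSymmSndFDerivAt (by simp)
  have sf := hf.isSymmSndFDerivAt (by simp)
  have := sF x y
  rw [hd] at this
  simp only [add_apply, ContinuousLinearMap.comp_apply, ContinuousLinearMap.compL_apply,
    ContinuousLinearMap.flip_apply, sf.eq x y] at this
  rw [sU.eq _ y]
  linarith

theorem hasEigenvalue_of_apply_eq {E : Type*} [AddCommGroup E] [Module ℝ E] {T : E →ₗ[ℝ] E}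
    {a : ℝ} {x : E} (hx : x ≠ 0) (h : T x = a • x) : Module.End.HasEigenvalue T a :=
  Module.End.hasEigenvalue_of_hasEigenvector
    (Module.End.hasEigenvector_iff.2 ⟨Module.End.mem_eigenspace_iff.2 h, hx⟩)

/-- Increments may be projected along the kernel of the derivative at `c`. -/
theorem eventually_exists_projection {N : ℕ} {f : State N → State N} {U F : State N → ℝ}
    {c : State N} (hf : ∀ᶠ x in 𝓝 c, DifferentiableAt ℝ f x)
    (hF : ∀ᶠ x in 𝓝 c, HasFDerivAt F ((fderiv ℝ U x).comp (fderiv ℝ f x)) x)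
    (hker : ∀ᶠ x in 𝓝 c, ∀ ξ, fderiv ℝ f c ξ = 0 → fderiv ℝ f x ξ = 0) :
    ∃ r > 0, ∀ u ∈ Metric.ball c r, ∀ v ∈ Metric.ball c r,
      ∃ a ∈ (LinearMap.ker (fderiv ℝ f c).toLinearMap)ᗮ, ‖a‖ ≤ ‖u - v‖ ∧
        f (v + a) = f u ∧ F (v + a) = F u := by
  obtain ⟨ρ, hρ, hb⟩ := Metric.mem_nhds_iff.1 (hf.and (hF.and hker))
  refine ⟨ρ / 3, by positivity, fun u hu v hv => ?_⟩
  set K := LinearMap.ker (fderiv ℝ f c).toLinearMap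
  rw [mem_ball_iff_norm] at hu hv
  have hle : ‖Kᗮ.starProjection (u - v)‖ ≤ ‖u - v‖ :=
    Kᗮ.norm_orthogonalProjectionOnto_apply_le (u - v)
  have hsum : K.starProjection (u - v) + Kᗮ.starProjection (u - v) = u - v :=
    K.starProjection_add_starProjection_orthogonal (u - v)
  have huv : ‖u - v‖ ≤ ‖u - c‖ + ‖v - c‖ := by
    have := norm_sub_le (u - c) (v - c)
    rwa [sub_sub_sub_cancel_right] at this
  -- The projected increment differs from `u - v` by a vector of `K`, which every nearby Jacobian
  -- kills; `F` inherits this from `f` because its derivative factors through that of `f`.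
  have hk : ∀ z ∈ Metric.ball c ρ,
      fderiv ℝ f z (v + Kᗮ.starProjection (u - v) - u) = 0 := fun z hz => by
    refine (hb hz).2.2 _ ?_
    have e : v + Kᗮ.starProjection (u - v) - u = -K.starProjection (u - v) := by
      rw [← sub_eq_iff_eq_add'.2 hsum.symm]
      abel
    rw [e, map_neg, neg_eq_zero]
    exact LinearMap.mem_ker.1 (K.starProjection_apply_mem (u - v))
  have m1 : u ∈ Metric.ball c ρ := by
    rw [mem_ball_iff_norm]
    linarith
  have m2 : v + Kᗮ.starProjection (u - v) ∈ Metric.ball c ρ := by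
    rw [mem_ball_iff_norm, add_sub_right_comm]
    have := norm_add_le (v - c) (Kᗮ.starProjection (u - v))
    linarith
  refine ⟨_, Kᗮ.starProjection_apply_mem (u - v), hle, ?_, ?_⟩
  · exact eq_of_fderiv_apply_eq_zero (convex_ball c ρ) (fun z hz => (hb hz).1) m1 m2 hk
  · refine eq_of_fderiv_apply_eq_zero (convex_ball c ρ)
      (fun z hz => (hb hz).2.1.differentiableAt) m1 m2 fun z hz => ?_
    rw [(hb hz).2.1.fderiv, ContinuousLinearMap.comp_apply, hk z hz, map_zero]

/-- On the product of the orthogonal complements a non-zero pair has `P a ≠ 0` or `M b ≠ 0`, so the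
form is positive there, and coercive by finite dimension. The maximum is the norm of the product
space. -/
theorem exists_dissipation_coercive {N : ℕ} (H : State N →L[ℝ] State N →L[ℝ] ℝ)
    (hsymm : ∀ x y, H x y = H y x) (hpos : ∀ x, x ≠ 0 → 0 < H x x)
    {P M : State N →L[ℝ] State N} (hP : ∀ x y, H (P x) y = H x (P y))
    (hM : ∀ x y, H (M x) y = H x (M y))
    (eP : ∀ a : ℝ, Module.End.HasEigenvalue P.toLinearMap a → 0 ≤ a)
    (eM : ∀ a : ℝ, Module.End.HasEigenvalue M.toLinearMap a → 0 ≤ a)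
    (eS : ∀ a : ℝ, Module.End.HasEigenvalue (P.toLinearMap + M.toLinearMap) a → a < 1) :
    ∃ δ : ℝ, 0 < δ ∧ ∀ a ∈ (LinearMap.ker P.toLinearMap)ᗮ,
      ∀ b ∈ (LinearMap.ker M.toLinearMap)ᗮ,
        δ * max ‖a‖ ‖b‖ ^ 2 ≤ H a (P a) + H b (M b) - H (P a + M b) (P a + M b) := by
  obtain ⟨δ, hδ, h⟩ := exists_coercive
    (F := ((LinearMap.ker P.toLinearMap)ᗮ : Submodule ℝ (State N)) ×
      ((LinearMap.ker M.toLinearMap)ᗮ : Submodule ℝ (State N)))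
    (q := fun x => H x.1 (P x.1) + H x.2 (M x.2) - H (P x.1 + M x.2) (P x.1 + M x.2))
    (by fun_prop)
    (fun c x => by
      simp only [Prod.smul_fst, Prod.smul_snd, Submodule.coe_smul, map_smul, smul_apply,
        map_add, add_apply, smul_eq_mul]
      ring)
    (fun x hx => by
      have key := dissipation_pos
        (LinearMap.mk₂ ℝ (fun x y => H x y) (by simp) (by simp) (by simp) (by simp))
        hsymm hpos (P := P.toLinearMap) (M := M.toLinearMap) hP hM eP eM eS
        (a := x.1) (b := x.2) (by
          by_contra! h0
          refine hx (Prod.ext (Subtype.ext ?_) (Subtype.ext ?_))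
          · have := Submodule.inner_right_of_mem_orthogonal (LinearMap.mem_ker.2 h0.1) x.1.2
            exact inner_self_eq_zero.1 this
          · have := Submodule.inner_right_of_mem_orthogonal (LinearMap.mem_ker.2 h0.2) x.2.2
            exact inner_self_eq_zero.1 this)
      simp only [LinearMap.mk₂_apply, ContinuousLinearMap.coe_coe] at key
      rwa [hP, hM] at key)
  refine ⟨δ, hδ, fun a ha b hb => ?_⟩
  simpa [Prod.norm_def] using h (⟨a, ha⟩, ⟨b, hb⟩)

/-- Near a state at which the splitting is stable, the discrete entropy inequality holds for
strictly convex split entropies. -/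
theorem exists_ball_discreteEntropyInequality {N : ℕ} {𝒰 : Set (State N)} (h𝒰 : IsOpen 𝒰)
    {fp fm : State N → State N} (hfp : ContDiffOn ℝ ∞ fp 𝒰) (hfm : ContDiffOn ℝ ∞ fm 𝒰)
    {lam : ℝ} (hlam : 0 < lam) {c : State N} (hc : c ∈ 𝒰) (hst : IsStableAt fp fm lam c)
    {U Fp Fm : State N → ℝ} (hs : IsSplitEntropy fp fm U Fp Fm 𝒰)
    (hU : HasPosDefHessian U 𝒰) :
    ∃ r : ℝ, 0 < r ∧ Metric.ball c r ⊆ 𝒰 ∧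
      DiscreteEntropyInequality fp fm lam U Fp Fm (Metric.ball c r) := by
  obtain ⟨⟨cU, cFp, eFp⟩, ⟨-, cFm, eFm⟩⟩ := hs
  have hn : 𝒰 ∈ 𝓝 c := h𝒰.mem_nhds hc
  have sp : ContDiffAt ℝ 2 fp c := (hfp.contDiffAt hn).of_le ENat.LEInfty.out
  have sm : ContDiffAt ℝ 2 fm c := (hfm.contDiffAt hn).of_le ENat.LEInfty.out
  have sU : ContDiffAt ℝ 2 U c := cU.contDiffAt hn
  have dp : ∀ᶠ x in 𝓝 c, DifferentiableAt ℝ fp x := by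
    filter_upwards [hn] with x hx
    exact (hfp.contDiffAt (h𝒰.mem_nhds hx)).differentiableAt (by simp)
  have dm : ∀ᶠ x in 𝓝 c, DifferentiableAt ℝ fm x := by
    filter_upwards [hn] with x hx
    exact (hfm.contDiffAt (h𝒰.mem_nhds hx)).differentiableAt (by simp)
  have dFp : ∀ᶠ x in 𝓝 c, HasFDerivAt Fp ((fderiv ℝ U x).comp (fderiv ℝ fp x)) x := by
    filter_upwards [hn] with x hx
    rw [← eFp x hx]
    exact ((cFp.contDiffAt (h𝒰.mem_nhds hx)).differentiableAt (by simp)).hasFDerivAt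
  have dFm : ∀ᶠ x in 𝓝 c, HasFDerivAt Fm ((fderiv ℝ U x).comp (fderiv ℝ fm x)) x := by
    filter_upwards [hn] with x hx
    rw [← eFm x hx]
    exact ((cFm.contDiffAt (h𝒰.mem_nhds hx)).differentiableAt (by simp)).hasFDerivAt
  have symp := hessian_fderiv_symm sp sU (cFp.contDiffAt hn) (eventually_of_mem hn eFp)
  have symm := hessian_fderiv_symm sm sU (cFm.contDiffAt hn) (eventually_of_mem hn eFm)
  -- The sign in `(-lam) • fm` makes both Jacobians non-negative, and their sum is `λ ∇(f⁺ -
  -- f⁻)(c)`, the matrix in the CFL condition.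
  have hp' : fderiv ℝ (fun x => lam • fp x) c = lam • fderiv ℝ fp c :=
    fderiv_fun_const_smul dp.self_of_nhds lam
  have hm' : fderiv ℝ (fun x => (-lam) • fm x) c = (-lam) • fderiv ℝ fm c :=
    fderiv_fun_const_smul dm.self_of_nhds (-lam)
  have kp : LinearMap.ker (lam • fderiv ℝ fp c).toLinearMap =
      LinearMap.ker (fderiv ℝ fp c).toLinearMap :=
    LinearMap.ker_smul _ _ hlam.ne'
  have km : LinearMap.ker ((-lam) • fderiv ℝ fm c).toLinearMap =
      LinearMap.ker (fderiv ℝ fm c).toLinearMap :=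
    LinearMap.ker_smul _ _ (neg_ne_zero.2 hlam.ne')
  obtain ⟨δ, hδ, hco⟩ := exists_dissipation_coercive (fderiv ℝ (fderiv ℝ U) c)
    (sU.isSymmSndFDerivAt (by simp)).eq (hU c hc) (P := lam • fderiv ℝ fp c)
    (M := (-lam) • fderiv ℝ fm c) (fun x y => by simp [symp]) (fun x y => by simp [symm])
    (fun a ha => by
      obtain ⟨x, hx⟩ := ha.exists_hasEigenvector
      have h1 : lam • fderiv ℝ fp c x = a • x := hx.apply_eq_smul
      have := hst.eig_pos (lam⁻¹ * a) (hasEigenvalue_of_apply_eq hx.2 (by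
        rw [mul_smul, ← h1, inv_smul_smul₀ hlam.ne']
        rfl))
      exact nonneg_of_mul_nonneg_right this (inv_pos.2 hlam))
    (fun a ha => by
      obtain ⟨x, hx⟩ := ha.exists_hasEigenvector
      have h1 : (-lam) • fderiv ℝ fm c x = a • x := hx.apply_eq_smul
      have := hst.eig_neg ((-lam)⁻¹ * a) (hasEigenvalue_of_apply_eq hx.2 (by
        rw [mul_smul, ← h1, inv_smul_smul₀ (neg_ne_zero.2 hlam.ne')]
        rfl))
      rw [inv_neg, neg_mul, neg_nonpos] at this
      exact nonneg_of_mul_nonneg_right this (inv_pos.2 hlam))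
    (fun a ha => by
      obtain ⟨x, hx⟩ := ha.exists_hasEigenvector
      have h1 : lam • fderiv ℝ fp c x + (-lam) • fderiv ℝ fm c x = a • x := hx.apply_eq_smul
      have := hst.eig_cfl (lam⁻¹ * a) (hasEigenvalue_of_apply_eq hx.2 (by
        rw [mul_smul, ← h1, neg_smul, ← sub_eq_add_neg, ← smul_sub, inv_smul_smul₀ hlam.ne']
        rfl))
      rwa [mul_inv_cancel_left₀ hlam.ne'] at this)
  rw [kp, km] at hco
  have d2p : ∀ᶠ x in 𝓝 c, HasFDerivAt (fun x => lam * Fp x)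
      ((fderiv ℝ U x).comp (fderiv ℝ (fun x => lam • fp x) x)) x := by
    filter_upwards [dFp, dp] with x h1 h2
    rw [fderiv_fun_const_smul h2, ContinuousLinearMap.comp_smul]
    exact h1.const_mul lam
  have d2m : ∀ᶠ x in 𝓝 c, HasFDerivAt (fun x => (-lam) * Fm x)
      ((fderiv ℝ U x).comp (fderiv ℝ (fun x => (-lam) • fm x) x)) x := by
    filter_upwards [dFm, dm] with x h1 h2
    rw [fderiv_fun_const_smul h2, ContinuousLinearMap.comp_smul]
    exact h1.const_mul (-lam)
  obtain ⟨r₁, hr₁, H1⟩ := exists_entropy_le_of_coercive (p := fun x => lam • fp x)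
    (q := fun x => (-lam) • fm x) ((sp.of_le (by norm_num)).const_smul lam)
    ((sm.of_le (by norm_num)).const_smul (-lam)) sU d2p d2m hδ (by rw [hp', hm']; exact hco)
  obtain ⟨r₂, hr₂, H2⟩ := eventually_exists_projection dp dFp hst.ker_pos
  obtain ⟨r₃, hr₃, H3⟩ := eventually_exists_projection dm dFm hst.ker_neg
  obtain ⟨r₄, hr₄, H4⟩ := Metric.mem_nhds_iff.1 hn
  refine ⟨min (r₁ / 2) (min r₂ (min r₃ r₄)), by positivity,
    (Metric.ball_subset_ball ((min_le_right _ _).trans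
      ((min_le_right _ _).trans (min_le_right _ _)))).trans H4, ?_⟩
  intro u hu v hv w hw _
  have sub : ∀ x ∈ Metric.ball c (min (r₁ / 2) (min r₂ (min r₃ r₄))),
      ‖x - c‖ < r₁ / 2 ∧ x ∈ Metric.ball c r₂ ∧ x ∈ Metric.ball c r₃ := fun x hx => by
    simp only [Metric.mem_ball, lt_min_iff, dist_eq_norm] at hx ⊢
    exact ⟨hx.1, hx.2.1, hx.2.2.1⟩
  have tri : ∀ x y : State N, ‖x - c‖ < r₁ / 2 → ‖y - c‖ < r₁ / 2 → ‖x - y‖ < r₁ :=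
    fun x y hx hy => by
      have := norm_sub_le (x - c) (y - c)
      rw [sub_sub_sub_cancel_right] at this
      linarith
  obtain ⟨hu1, hu2, -⟩ := sub u hu
  obtain ⟨hv1, hv2, hv3⟩ := sub v hv
  obtain ⟨hw1, -, hw3⟩ := sub w hw
  obtain ⟨a, ha, han, ea, ea'⟩ := H2 u hu2 v hv2
  obtain ⟨b, hb, hbn, eb, eb'⟩ := H3 w hw3 v hv3
  have := H1 v (by rw [mem_ball_iff_norm]; linarith) a ha b hb
    (han.trans_lt (tri u v hu1 hv1)) (hbn.trans_lt (tri w v hw1 hv1))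
  simp only [ea, ea', eb, eb'] at this
  have est : splitStep fp fm lam u v w =
      v + (lam • fp u - lam • fp v) + ((-lam) • fm w - (-lam) • fm v) := by
    simp only [splitStep, splitFlux]
    module
  rw [est]
  simp only [splitFlux]
  linarith

/-! ### Kernels tested with bounded continuous functions -/

theorem ae_le_of_forall_integral_mul_le {Z : Type*} [MeasurableSpace Z] {m : Measure Z}
    [SigmaFinite m] {G₁ G₂ : Z → ℝ} {B : ℝ} (m₁ : AEStronglyMeasurable G₁ m)
    (m₂ : AEStronglyMeasurable G₂ m) (b₁ : ∀ᵐ z ∂m, ‖G₁ z‖ ≤ B) (b₂ : ∀ᵐ z ∂m, ‖G₂ z‖ ≤ B)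
    (h : ∀ φ : Z → ℝ, Integrable φ m → 0 ≤ φ → ∫ z, φ z * G₁ z ∂m ≤ ∫ z, φ z * G₂ z ∂m) :
    G₁ ≤ᵐ[m] G₂ := by
  refine ae_of_forall_measure_lt_top_ae_restrict _ fun s hs hms => ?_
  have : Fact (m s < ⊤) := ⟨hms⟩
  have key : ∀ G : Z → ℝ, AEStronglyMeasurable G m → (∀ᵐ z ∂m, ‖G z‖ ≤ B) →
      Integrable G (m.restrict s) := fun G hG hB =>
    Integrable.of_bound hG.restrict B (ae_restrict_of_ae hB)
  refine ae_le_of_forall_setIntegral_le (key _ m₁ b₁) (key _ m₂ b₂) fun t ht _ => ?_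
  have e : ∀ G : Z → ℝ, ∫ z in t, G z ∂(m.restrict s) =
      ∫ z, (t ∩ s).indicator (fun _ => (1 : ℝ)) z * G z ∂m := fun G => by
    rw [Measure.restrict_restrict ht, ← integral_indicator (ht.inter hs)]
    congr 1
    ext z
    by_cases hz : z ∈ t ∩ s <;> simp [hz]
  rw [e, e]
  refine h _ ?_ fun z => indicator_nonneg (fun _ _ => zero_le_one) z
  rw [integrable_indicator_iff (ht.inter hs)]
  exact integrableOn_const (measure_inter_lt_top_of_right_ne_top hms.ne).ne

section Kernels

variable {Z X : Type*} [MeasurableSpace Z] [MeasurableSpace X] [TopologicalSpace X]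

theorem norm_integral_bcf_le (κ : Kernel Z X) [IsMarkovKernel κ]
    (g : BoundedContinuousFunction X ℝ) (z : Z) : ‖∫ u, g u ∂(κ z)‖ ≤ ‖g‖ := by
  have := norm_integral_le_of_norm_le_const (μ := κ z) (f := g) (C := ‖g‖)
    (Eventually.of_forall fun u => g.norm_coe_le_norm u)
  simpa using this

variable [BorelSpace X]

theorem stronglyMeasurable_integral_bcf (κ : Kernel Z X)
    (g : BoundedContinuousFunction X ℝ) :
    StronglyMeasurable fun z => ∫ u, g u ∂(κ z) :=
  StronglyMeasurable.integral_kernel g.continuous.measurable.stronglyMeasurable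

theorem integral_compProd_snd (m : Measure Z) [IsFiniteMeasure m] (κ : Kernel Z X)
    [IsMarkovKernel κ] (g : BoundedContinuousFunction X ℝ) :
    ∫ u, g u ∂(m ⊗ₘ κ).snd = ∫ z, ∫ u, g u ∂(κ z) ∂m := by
  have hm : Measurable g := g.continuous.measurable
  rw [Measure.snd, integral_map measurable_snd.aemeasurable hm.aestronglyMeasurable,
    Measure.integral_compProd]
  exact Integrable.of_bound (hm.comp measurable_snd).aestronglyMeasurable ‖g‖
    (Eventually.of_forall fun z => g.norm_coe_le_norm z.2)

/-- The mass of `S ×ˢ C` is the mass of `C` under the second marginal of the composition product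
over `m.restrict S`, a finite measure, which bounded continuous functions determine. -/
theorem compProd_prod_eq_of_forall_integral_eq [HasOuterApproxClosed X] {m : Measure Z}
    [IsFiniteMeasure m] {κ η : Kernel Z X} [IsMarkovKernel κ] [IsMarkovKernel η] {S : Set Z}
    (hS : MeasurableSet S)
    (h : ∀ g : BoundedContinuousFunction X ℝ,
      ∫ z in S, ∫ u, g u ∂(κ z) ∂m = ∫ z in S, ∫ u, g u ∂(η z) ∂m) {C : Set X}
    (hC : MeasurableSet C) : (m ⊗ₘ κ) (S ×ˢ C) = (m ⊗ₘ η) (S ×ˢ C) := by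
  have key : (m.restrict S ⊗ₘ κ).snd = (m.restrict S ⊗ₘ η).snd :=
    ext_of_forall_integral_eq_of_IsFiniteMeasure fun g => by
      rw [integral_compProd_snd, integral_compProd_snd, h g]
  have e : ∀ (θ : Kernel Z X) [IsMarkovKernel θ],
      (m ⊗ₘ θ) (S ×ˢ C) = (m.restrict S ⊗ₘ θ).snd C := fun θ _ => by
    rw [Measure.compProd_apply_prod hS hC, Measure.snd_apply hC, ← univ_prod,
      Measure.compProd_apply_prod MeasurableSet.univ hC, Measure.restrict_univ]
  rw [e, e, key]

/-- Markov kernels with the same averages of bounded continuous functions agree almost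
everywhere. -/
theorem kernel_ae_eq_of_forall_integral_eq [HasOuterApproxClosed X]
    [MeasurableSpace.CountablyGenerated X] {m : Measure Z} [SigmaFinite m] {κ η : Kernel Z X}
    [IsMarkovKernel κ] [IsMarkovKernel η]
    (h : ∀ (g : BoundedContinuousFunction X ℝ) (S : Set Z), MeasurableSet S → m S < ⊤ →
      ∫ z in S, ∫ u, g u ∂(κ z) ∂m = ∫ z in S, ∫ u, g u ∂(η z) ∂m) :
    ∀ᵐ z ∂m, κ z = η z := by
  refine ae_of_forall_measure_lt_top_ae_restrict _ fun s hs hms => ?_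
  have : Fact (m s < ⊤) := ⟨hms⟩
  refine Kernel.ae_eq_of_compProd_eq (Measure.ext_prod fun {S C} hS hC =>
    compProd_prod_eq_of_forall_integral_eq hS (fun g => ?_) hC)
  rw [Measure.restrict_restrict hS]
  exact h g _ (hS.inter hs) (measure_inter_lt_top_of_right_ne_top hms.ne)

/-- Version for product spaces, testing with rectangles only. -/
theorem kernel_ae_eq_of_forall_rect [HasOuterApproxClosed X]
    [MeasurableSpace.CountablyGenerated X] {Z' : Type*} [MeasurableSpace Z']
    {m : Measure (Z × Z')} [IsFiniteMeasure m]
    {κ η : Kernel (Z × Z') X} [IsMarkovKernel κ] [IsMarkovKernel η]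
    (h : ∀ (g : BoundedContinuousFunction X ℝ) (S : Set Z) (T : Set Z'), MeasurableSet S →
      MeasurableSet T →
      ∫ z in S ×ˢ T, ∫ u, g u ∂(κ z) ∂m = ∫ z in S ×ˢ T, ∫ u, g u ∂(η z) ∂m) :
    ∀ᵐ z ∂m, κ z = η z := by
  refine Kernel.ae_eq_of_compProd_eq ?_
  let e : (Z × Z') × X ≃ᵐ Z × Z' × X := MeasurableEquiv.prodAssoc
  -- After reassociation, boxes `S ×ˢ T ×ˢ C` determine the measure, which is why rectangles in the
  -- base suffice.
  have key : (m ⊗ₘ κ).map e = (m ⊗ₘ η).map e := by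
    refine Measure.ext_prod₃ fun {S T C} hS hT hC => ?_
    have hpre : e ⁻¹' (S ×ˢ T ×ˢ C) = (S ×ˢ T) ×ˢ C := by
      ext ⟨⟨a, b⟩, c⟩
      simp [e, MeasurableEquiv.prodAssoc, and_assoc]
    rw [e.map_apply, e.map_apply, hpre]
    exact compProd_prod_eq_of_forall_integral_eq (hS.prod hT) (fun g => h g S T hS hT) hC
  have := congrArg (fun ρ => ρ.map e.symm) key
  simpa [MeasurableEquiv.map_map_symm, Measure.map_map e.symm.measurable e.measurable] using this

end Kernels

/-- Tietze extension. It lets entropies and fluxes, given only on `V`, be tested against Young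
measures, since all states lie in a compact subset of `V`. -/
theorem exists_bcf_eqOn {X : Type*} [TopologicalSpace X] [NormalSpace X] [T2Space X] {K : Set X}
    (hK : IsCompact K) {F : X → ℝ} (hF : ContinuousOn F K) :
    ∃ g : BoundedContinuousFunction X ℝ, EqOn F g K := by
  have : CompactSpace K := isCompact_iff_compactSpace.1 hK
  obtain ⟨g, -, hg⟩ := BoundedContinuousFunction.exists_norm_eq_domRestrict_eq_of_closed
    (BoundedContinuousFunction.mkOfCompact ⟨K.domRestrict F, continuousOn_iff_continuous_domRestrict.1 hF⟩)
    hK.isClosed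
  refine ⟨g, fun x hx => ?_⟩
  have := DFunLike.congr_fun hg ⟨x, hx⟩
  exact this.symm

/-- A Young measure of a sequence with values in a closed set is carried by this set. -/
theorem ae_compl_eq_zero_of_isYoungMeasureOf {Z : Type*} [MeasurableSpace Z] {m : Measure Z}
    [SigmaFinite m] {N : ℕ} {V K : Set (State N)} {w : ℕ → Z → State N}
    {κ : Kernel Z (State N)} (hκ : IsYoungMeasureOf m V w κ) (hK : IsClosed K)
    (hne : K.Nonempty) (hw : ∀ n, ∀ᵐ z ∂m, w n z ∈ K) : ∀ᵐ z ∂m, κ z Kᶜ = 0 := by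
  obtain ⟨⟨hM, -⟩, hlim⟩ := hκ
  -- The truncated distance to `K` vanishes along the sequence, so its mean under the limit measures
  -- vanishes, and it is positive off `K`.
  have hdc : Continuous fun u : State N => min 1 (Metric.infDist u K) :=
    continuous_const.min (Metric.continuous_infDist_pt K)
  have hd0 : ∀ u : State N, 0 ≤ min 1 (Metric.infDist u K) := fun u =>
    le_min zero_le_one Metric.infDist_nonneg
  let g : BoundedContinuousFunction (State N) ℝ :=
    BoundedContinuousFunction.ofNormedAddCommGroup _ hdc 1 fun u => by
      rw [Real.norm_of_nonneg (hd0 u)]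
      exact min_le_left _ _
  have hg0 : ∀ u, 0 ≤ g u := hd0
  have hgK : ∀ u ∈ K, g u = 0 := fun u hu => by
    change min 1 (Metric.infDist u K) = 0
    rw [Metric.infDist_zero_of_mem hu]
    exact min_eq_right zero_le_one
  have hle : (fun z => ∫ u, g u ∂(κ z)) ≤ᵐ[m] fun _ => (0 : ℝ) := by
    refine ae_le_of_forall_integral_mul_le (B := ‖g‖)
      (stronglyMeasurable_integral_bcf κ g).aestronglyMeasurable
      aestronglyMeasurable_const (Eventually.of_forall (norm_integral_bcf_le κ g))
      (Eventually.of_forall fun _ => by simp) fun φ hφ _ => ?_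
    have h0 : ∀ n, ∫ z, φ z * g (w n z) ∂m = 0 := fun n => by
      refine integral_eq_zero_of_ae ?_
      filter_upwards [hw n] with z hz
      simp [hgK _ hz]
    have := hlim g φ hφ
    simp only [h0] at this
    simpa using (tendsto_nhds_unique this tendsto_const_nhds).le
  filter_upwards [hle] with z hz
  have hz0 : ∫ u, g u ∂(κ z) = 0 := le_antisymm hz (integral_nonneg hg0)
  rw [integral_eq_zero_iff_of_nonneg hg0 (g.integrable _)] at hz0
  refine measure_mono_null (fun u hu => ?_) hz0
  have hpos : 0 < Metric.infDist u K := (hK.notMem_iff_infDist_pos hne).1 hu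
  exact (lt_min one_pos hpos).ne'

theorem integral_eq_of_eqOn {N : ℕ} {K : Set (State N)} {F : State N → ℝ}
    {g : State N → ℝ} (h : EqOn F g K) {π : Measure (State N)} (hπ : π Kᶜ = 0) :
    ∫ u, F u ∂π = ∫ u, g u ∂π := by
  refine integral_congr_ae ?_
  filter_upwards [mem_ae_iff.2 hπ] with u hu
  exact h hu

/-! ### The boundary layer kernel -/

theorem quarterPlane_eq_prod :
    quarterPlane = (volume.restrict (Ioi (0 : ℝ))).prod (volume.restrict (Ioi (0 : ℝ))) := by
  rw [quarterPlane, Measure.volume_eq_prod, Measure.prod_restrict]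

instance : SigmaFinite quarterPlane := by
  rw [quarterPlane_eq_prod]
  infer_instance

theorem integrable_strip {A : Set ℝ} (hA : MeasurableSet A) (hAfin : volume A < ⊤) {β : ℝ → ℝ}
    (hβ : IntegrableOn β (Ioi 0)) :
    Integrable (fun z : ℝ × ℝ => A.indicator (fun _ => (1 : ℝ)) z.1 * β z.2) quarterPlane := by
  rw [quarterPlane_eq_prod]
  refine Integrable.mul_prod (f := A.indicator fun _ => (1 : ℝ)) (g := β) ?_ hβ
  rw [integrable_indicator_iff hA]
  exact integrableOn_const ((Measure.restrict_apply_le _ _).trans_lt hAfin).ne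

/-- Integrals over a strip `A × (0, ∞)` of a function with product weight. -/
theorem integral_strip {A : Set ℝ} (hA : MeasurableSet A) (hA0 : A ⊆ Ioi 0)
    (hAfin : volume A < ⊤) {β : ℝ → ℝ} (hβ : IntegrableOn β (Ioi 0)) {H : ℝ × ℝ → ℝ} {B : ℝ}
    (hH : AEStronglyMeasurable H quarterPlane) (hB : ∀ z, ‖H z‖ ≤ B) :
    ∫ z, A.indicator (fun _ => (1 : ℝ)) z.1 * β z.2 * H z ∂quarterPlane =
      ∫ t in Ioi (0 : ℝ), β t * ∫ y in A, H (y, t) := by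
  have hint := (integrable_strip hA hAfin hβ).mul_bdd hH (Eventually.of_forall hB)
  rw [quarterPlane_eq_prod] at hint ⊢
  rw [integral_prod_symm _ hint]
  refine integral_congr_ae (Eventually.of_forall fun t => ?_)
  dsimp only
  rw [← integral_const_mul, ← integral_indicator hA, ← integral_indicator measurableSet_Ioi]
  congr 1
  ext y
  by_cases hy : y ∈ A
  · simp [hy, hA0 hy]
  · simp [hy]

theorem integral_strip_of_eqOn {A : Set ℝ} (hA : MeasurableSet A) (hA0 : A ⊆ Ioi 0)
    {β G : ℝ → ℝ} {H : ℝ × ℝ → ℝ} (hG : ∀ y ∈ A, ∀ t, H (y, t) = G t) :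
    ∫ z, A.indicator (fun _ => (1 : ℝ)) z.1 * β z.2 * H z ∂quarterPlane =
      volume.real A * ∫ t in Ioi (0 : ℝ), β t * G t := by
  have e : ∀ z : ℝ × ℝ, A.indicator (fun _ => (1 : ℝ)) z.1 * β z.2 * H z =
      A.indicator (fun _ => (1 : ℝ)) z.1 * (β z.2 * G z.2) := fun z => by
    by_cases hz : z.1 ∈ A
    · rw [mul_assoc, ← hG z.1 hz z.2]
    · simp [hz]
  simp_rw [e]
  rw [quarterPlane_eq_prod, integral_prod_mul (A.indicator fun _ => (1 : ℝ)) fun t => β t * G t,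
    integral_indicator hA, Measure.restrict_restrict hA, inter_eq_self_of_subset_left hA0]
  simp

section Cell

variable {X : Type*} [MeasurableSpace X]

/-- The average of `μ` over the cell `k < y < k + 1`. -/
noncomputable def cellKernel (μ : Kernel (ℝ × ℝ) X) (k : ℕ) : Kernel ℝ X :=
  μ ∘ₖ (Kernel.const ℝ (volume.restrict (Ioo (k : ℝ) (k + 1))) ×ₖ Kernel.id)

instance isProbabilityMeasure_restrict_cell (k : ℕ) :
    IsProbabilityMeasure (volume.restrict (Ioo (k : ℝ) (k + 1))) :=
  ⟨by simp⟩

instance (μ : Kernel (ℝ × ℝ) X) [IsMarkovKernel μ] (k : ℕ) : IsMarkovKernel (cellKernel μ k) := by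
  unfold cellKernel
  infer_instance

theorem cellKernel_apply (μ : Kernel (ℝ × ℝ) X) (k : ℕ) (t : ℝ) {C : Set X}
    (hC : MeasurableSet C) :
    cellKernel μ k t C = ∫⁻ y in Ioo (k : ℝ) (k + 1), μ (y, t) C := by
  rw [cellKernel, Kernel.comp_apply' _ _ _ hC, Kernel.lintegral_prod _ _ _ (μ.measurable_coe hC)]
  simp [Kernel.id_apply]

theorem integral_cellKernel [TopologicalSpace X] [BorelSpace X] (μ : Kernel (ℝ × ℝ) X)
    [IsMarkovKernel μ] (k : ℕ) (t : ℝ) (g : BoundedContinuousFunction X ℝ) :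
    ∫ u, g u ∂(cellKernel μ k t) = ∫ y in Ioo (k : ℝ) (k + 1), ∫ u, g u ∂(μ (y, t)) := by
  have hi : Integrable g (cellKernel μ k t) :=
    Integrable.of_bound g.continuous.measurable.aestronglyMeasurable ‖g‖
      (Eventually.of_forall g.norm_coe_le_norm)
  have hm := stronglyMeasurable_integral_bcf μ g
  rw [cellKernel] at hi ⊢
  rw [Kernel.integral_comp hi, Kernel.prod_apply, Kernel.const_apply, Kernel.id_apply,
    integral_prod]
  · refine integral_congr_ae (Eventually.of_forall fun y => ?_)
    exact integral_dirac' _ _ (hm.comp_measurable measurable_prodMk_left)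
  · exact Integrable.of_bound hm.aestronglyMeasurable ‖g‖
      (Eventually.of_forall (norm_integral_bcf_le μ g))

theorem measurable_cellKernel (μ : Kernel (ℝ × ℝ) X) :
    Measurable fun p : ℕ × ℝ => cellKernel μ p.1 p.2 := by
  refine measurable_from_prod_countable_right (f := fun p : ℕ × ℝ => cellKernel μ p.1 p.2)
    fun k => ?_
  change Measurable (cellKernel μ k)
  exact (cellKernel μ k).measurable

/-- The version of `μ` which is constant in `y` on the cells. -/
noncomputable def layerKernel (μ : Kernel (ℝ × ℝ) X) : Kernel (ℝ × ℝ) X :=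
  ⟨fun z => cellKernel μ ⌊z.1⌋₊ z.2,
    (measurable_cellKernel μ).comp (f := fun z : ℝ × ℝ => (⌊z.1⌋₊, z.2))
      ((Nat.measurable_floor.comp measurable_fst).prodMk measurable_snd)⟩

theorem layerKernel_apply (μ : Kernel (ℝ × ℝ) X) (z : ℝ × ℝ) :
    layerKernel μ z = cellKernel μ ⌊z.1⌋₊ z.2 := rfl

instance (μ : Kernel (ℝ × ℝ) X) [IsMarkovKernel μ] : IsMarkovKernel (layerKernel μ) :=
  ⟨fun z => by
    rw [layerKernel_apply]
    infer_instance⟩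

end Cell

theorem floor_eq_of_mem_cell {k : ℕ} {y : ℝ} (hy : y ∈ Ioo (k : ℝ) (k + 1)) : ⌊y⌋₊ = k :=
  (Nat.floor_eq_iff (k.cast_nonneg.trans hy.1.le)).2 ⟨hy.1.le, hy.2⟩

theorem cell_subset (k : ℕ) : Ioo (k : ℝ) (k + 1) ⊆ Ioi 0 := fun _ hy =>
  (k.cast_nonneg (α := ℝ)).trans_lt hy.1

section Young

variable {N : ℕ} {V : Set (State N)} {h : ℕ → ℝ} {v : ℕ → ℕ → ℝ → State N}
  {μ : Kernel (ℝ × ℝ) (State N)}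

/-- Inside a cell the rescaled function does not depend on `y`, so a test function `1_A(y) β(t)`
just produces the factor `|A|`. Arbitrary subsets `A` of the cell are needed to see that the limit
does not depend on `y` either. -/
theorem tendsto_subcell (hh : ∀ n, 0 < h n)
    (hμ : IsYoungMeasureOf quarterPlane V (fun n z => rescaled (h n) (v n) z.1 z.2) μ) (k : ℕ)
    {A : Set ℝ} (hA : MeasurableSet A) (hAk : A ⊆ Ioo (k : ℝ) (k + 1))
    (g : BoundedContinuousFunction (State N) ℝ) {β : ℝ → ℝ} (hβ : IntegrableOn β (Ioi 0)) :
    Tendsto (fun n => volume.real A * ∫ t in Ioi (0 : ℝ), β t * g (v n k t)) atTop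
      (𝓝 (∫ t in Ioi (0 : ℝ), β t * ∫ y in A, ∫ u, g u ∂(μ (y, t)))) := by
  have hM : IsMarkovKernel μ := hμ.1.1
  have hAfin : volume A < ⊤ := (measure_mono hAk).trans_lt (by simp)
  have hA0 : A ⊆ Ioi 0 := hAk.trans (cell_subset k)
  have := hμ.2 g _ (integrable_strip hA hAfin hβ)
  rw [integral_strip hA hA0 hAfin hβ (stronglyMeasurable_integral_bcf μ g).aestronglyMeasurable
    (norm_integral_bcf_le μ g)] at this
  refine this.congr fun n => ?_
  refine integral_strip_of_eqOn hA hA0 fun y hy t => ?_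
  dsimp only
  rw [rescaled, meshFunction, mul_div_cancel_right₀ _ (hh n).ne', floor_eq_of_mem_cell (hAk hy)]

/-- The cell values converge weakly to the averaged kernels. -/
theorem tendsto_cell (hh : ∀ n, 0 < h n)
    (hμ : IsYoungMeasureOf quarterPlane V (fun n z => rescaled (h n) (v n) z.1 z.2) μ) (k : ℕ)
    (g : BoundedContinuousFunction (State N) ℝ) {β : ℝ → ℝ} (hβ : IntegrableOn β (Ioi 0)) :
    Tendsto (fun n => ∫ t in Ioi (0 : ℝ), β t * g (v n k t)) atTop
      (𝓝 (∫ t in Ioi (0 : ℝ), β t * ∫ u, g u ∂(cellKernel μ k t))) := by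
  have hM : IsMarkovKernel μ := hμ.1.1
  have := tendsto_subcell hh hμ k measurableSet_Ioo Subset.rfl g hβ
  simp only [← integral_cellKernel] at this
  simpa using this

/-- Countably many boxes of finite measure cover the quarter plane up to the null lines `y = k`; on
each box the criterion `kernel_ae_eq_of_forall_rect` for finite measures is available. -/
theorem ae_quarterPlane_of_cells {p : ℝ × ℝ → Prop}
    (hp : ∀ k j : ℕ, ∀ᵐ z ∂((volume.restrict (Ioo (k : ℝ) (k + 1))).prod
      (volume.restrict (Ioo (0 : ℝ) j))), p z) : ∀ᵐ z ∂quarterPlane, p z := by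
  have hn : ∀ᵐ z ∂quarterPlane, ∀ k : ℕ, z.1 ≠ (k : ℝ) := by
    refine ae_all_iff.2 fun k => ?_
    rw [quarterPlane_eq_prod]
    exact Measure.quasiMeasurePreserving_fst.ae (ae_restrict_of_ae (Measure.ae_ne volume (k : ℝ)))
  have hall : ∀ᵐ z ∂quarterPlane, ∀ k j : ℕ, z ∈ Ioo (k : ℝ) (k + 1) ×ˢ Ioo (0 : ℝ) j → p z := by
    refine ae_all_iff.2 fun k => ae_all_iff.2 fun j => ?_
    have := hp k j
    rw [Measure.prod_restrict, ae_restrict_iff' (measurableSet_Ioo.prod measurableSet_Ioo)] at this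
    exact ae_restrict_of_ae this
  have hmem : ∀ᵐ z ∂quarterPlane, z ∈ Ioi (0 : ℝ) ×ˢ Ioi (0 : ℝ) :=
    ae_restrict_mem (measurableSet_Ioi.prod measurableSet_Ioi)
  filter_upwards [hn, hall, hmem] with z h1 h2 h3
  obtain ⟨j, hj⟩ := exists_nat_gt z.2
  exact h2 ⌊z.1⌋₊ j ⟨⟨(Nat.floor_le h3.1.le).lt_of_ne (h1 _).symm, Nat.lt_floor_add_one z.1⟩,
    h3.2, hj⟩

theorem layerKernel_ae_eq (hh : ∀ n, 0 < h n)
    (hμ : IsYoungMeasureOf quarterPlane V (fun n z => rescaled (h n) (v n) z.1 z.2) μ) :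
    ∀ᵐ z ∂quarterPlane, layerKernel μ z = μ z := by
  have hM : IsMarkovKernel μ := hμ.1.1
  refine ae_quarterPlane_of_cells fun k j => kernel_ae_eq_of_forall_rect fun g S T hS hT => ?_
  have hβ : IntegrableOn ((T ∩ Ioo (0 : ℝ) j).indicator fun _ => (1 : ℝ)) (Ioi 0) := by
    refine Integrable.integrableOn ?_
    rw [integrable_indicator_iff (hT.inter measurableSet_Ioo)]
    exact integrableOn_const (measure_inter_lt_top_of_right_ne_top (by simp)).ne
  have hA : MeasurableSet (S ∩ Ioo (k : ℝ) (k + 1)) := hS.inter measurableSet_Ioo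
  -- The same sequence has two limits: the integral of `μ` over the part `S` of the cell, and the
  -- length of that part times the cell average.
  have key := tendsto_nhds_unique (tendsto_subcell hh hμ k hA inter_subset_right g hβ)
    ((tendsto_cell hh hμ k g hβ).const_mul _)
  have conv : ∀ (H : ℝ × ℝ → ℝ), StronglyMeasurable H → (∀ z, ‖H z‖ ≤ ‖g‖) →
      ∫ z in S ×ˢ T, H z ∂((volume.restrict (Ioo (k : ℝ) (k + 1))).prod
        (volume.restrict (Ioo (0 : ℝ) j))) =
      ∫ t in Ioi (0 : ℝ), (T ∩ Ioo (0 : ℝ) j).indicator (fun _ => (1 : ℝ)) t *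
        ∫ y in S ∩ Ioo (k : ℝ) (k + 1), H (y, t) := by
    intro H hH hb
    rw [← Measure.prod_restrict, Measure.restrict_restrict hS, Measure.restrict_restrict hT]
    have hfin : IsFiniteMeasure (volume.restrict (S ∩ Ioo (k : ℝ) (k + 1))) :=
      isFiniteMeasure_restrict.2 (measure_inter_lt_top_of_right_ne_top (by simp)).ne
    have hfin' : IsFiniteMeasure (volume.restrict (T ∩ Ioo (0 : ℝ) j)) :=
      isFiniteMeasure_restrict.2 (measure_inter_lt_top_of_right_ne_top (by simp)).ne
    rw [integral_prod_symm _ (Integrable.of_bound hH.aestronglyMeasurable ‖g‖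
      (Eventually.of_forall hb)), ← integral_indicator (hT.inter measurableSet_Ioo),
      ← integral_indicator measurableSet_Ioi]
    congr 1
    ext t
    by_cases ht : t ∈ T ∩ Ioo (0 : ℝ) j
    · have : t ∈ Ioi (0 : ℝ) := ht.2.1
      rw [indicator_of_mem ht, indicator_of_mem this, indicator_of_mem ht, one_mul]
    · rw [indicator_of_notMem ht]
      by_cases ht0 : t ∈ Ioi (0 : ℝ)
      · rw [indicator_of_mem ht0, indicator_of_notMem ht, zero_mul]
      · rw [indicator_of_notMem ht0]
  rw [conv _ (stronglyMeasurable_integral_bcf _ g) (norm_integral_bcf_le _ g),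
    conv _ (stronglyMeasurable_integral_bcf _ g) (norm_integral_bcf_le _ g), key,
    ← integral_const_mul]
  refine integral_congr_ae (Eventually.of_forall fun t => ?_)
  have : ∫ y in S ∩ Ioo (k : ℝ) (k + 1), ∫ u, g u ∂(layerKernel μ (y, t)) =
      ∫ y in S ∩ Ioo (k : ℝ) (k + 1), ∫ u, g u ∂(cellKernel μ k t) := by
    refine setIntegral_congr_fun hA fun y hy => ?_
    rw [layerKernel_apply, floor_eq_of_mem_cell hy.2]
  dsimp only
  rw [this, setIntegral_const, smul_eq_mul]
  ring

/-- If the values in cell `k` do not depend on `n`, the averaged kernel is a Dirac measure. -/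
theorem cellKernel_ae_eq_dirac (hh : ∀ n, 0 < h n)
    (hμ : IsYoungMeasureOf quarterPlane V (fun n z => rescaled (h n) (v n) z.1 z.2) μ) (k : ℕ)
    {uB : ℝ → State N} (huB : Measurable uB) (hv : ∀ n t, 0 ≤ t → v n k t = uB t) :
    ∀ᵐ t ∂(volume.restrict (Ioi (0 : ℝ))), cellKernel μ k t = Measure.dirac (uB t) := by
  have hM : IsMarkovKernel μ := hμ.1.1
  have := kernel_ae_eq_of_forall_integral_eq (m := volume.restrict (Ioi (0 : ℝ)))
    (κ := cellKernel μ k) (η := Kernel.deterministic uB huB) fun g S hS hfin => ?_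
  · filter_upwards [this] with t ht
    rw [ht, Kernel.deterministic_apply]
  have hβ : IntegrableOn (S.indicator fun _ => (1 : ℝ)) (Ioi 0) := by
    rw [IntegrableOn, integrable_indicator_iff hS]
    exact integrableOn_const hfin.ne
  have key := tendsto_cell hh hμ k g hβ
  have e : ∀ n, ∫ t in Ioi (0 : ℝ), S.indicator (fun _ => (1 : ℝ)) t * g (v n k t) =
      ∫ t in Ioi (0 : ℝ), S.indicator (fun _ => (1 : ℝ)) t * g (uB t) := fun n => by
    refine setIntegral_congr_fun measurableSet_Ioi fun t ht => ?_
    rw [hv n t (le_of_lt ht)]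
  simp only [e] at key
  have key := tendsto_nhds_unique key tendsto_const_nhds
  have conv : ∀ G : ℝ → ℝ, ∫ t in Ioi (0 : ℝ), S.indicator (fun _ => (1 : ℝ)) t * G t =
      ∫ t in S, G t ∂(volume.restrict (Ioi (0 : ℝ))) := fun G => by
    rw [← integral_indicator hS]
    congr 1
    ext t
    by_cases ht : t ∈ S <;> simp [ht]
  rw [conv, conv] at key
  rw [key]
  congr 1
  ext t
  rw [Kernel.deterministic_apply, integral_dirac' _ _ g.continuous.measurable.stronglyMeasurable]

theorem ae_cellKernel_compl_eq_zero {W : Set (State N)} (hW : MeasurableSet W)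
    (hμ : ∀ᵐ z ∂quarterPlane, μ z Wᶜ = 0) (k : ℕ) :
    ∀ᵐ t ∂(volume.restrict (Ioi (0 : ℝ))), cellKernel μ k t Wᶜ = 0 := by
  rw [quarterPlane_eq_prod] at hμ
  have h1 := Measure.ae_ae_of_ae_prod (Measure.measurePreserving_swap.quasiMeasurePreserving.ae hμ)
  filter_upwards [h1] with t ht
  rw [cellKernel_apply _ _ _ hW.compl]
  refine lintegral_eq_zero_of_ae_eq_zero ?_
  exact ae_restrict_of_ae_restrict_of_subset (cell_subset k) ht

end Young

/-! ### Measurability of the scheme -/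

/-- Induction over time slabs of length `lam * h`: the data are measurable, and one step composes
measurable functions. All cells `k` are treated at once because a step involves both neighbours. -/
theorem exists_measurable_time_slab {N : ℕ} {fp fm : State N → State N} {lam h : ℝ}
    {uB : ℝ → State N} {a : ℕ → State N} {v : ℕ → ℝ → State N} {K : Set (State N)}
    (hK : MeasurableSet K) (hfp : ContinuousOn fp K) (hfm : ContinuousOn fm K)
    (huB : Measurable uB) (hτ : 0 < lam * h) (hv : IsSplittingScheme fp fm lam h uB a v)
    (hvK : ∀ k t, 0 ≤ t → v k t ∈ K) (j k : ℕ) :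
    ∃ P : ℝ → State N, Measurable P ∧
      ∀ s, 0 ≤ s → s < lam * h → v k (s + j * (lam * h)) = P s := by
  classical
  -- The fluxes are controlled on `K` only; off `K`, which the scheme never leaves, they are
  -- replaced by `0`.
  have mp : Measurable (K.piecewise fp 0) := hfp.measurable_piecewise continuousOn_const hK
  have mm : Measurable (K.piecewise fm 0) := hfm.measurable_piecewise continuousOn_const hK
  induction j generalizing k with
  | zero =>
    rcases k.eq_zero_or_pos with rfl | hk
    · exact ⟨uB, huB, fun s hs _ => by simpa using hv.boundary s hs⟩
    · exact ⟨fun _ => a k, measurable_const, fun s hs hs' => by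
        simpa using hv.initial k hk s hs hs'⟩
  | succ j ih =>
    rcases k with _ | k
    · refine ⟨fun s => uB (s + (j + 1 : ℕ) * (lam * h)), huB.comp (measurable_id.add_const _),
        fun s hs _ => hv.boundary _ (by positivity)⟩
    · obtain ⟨P₀, m₀, e₀⟩ := ih k
      obtain ⟨P₁, m₁, e₁⟩ := ih (k + 1)
      obtain ⟨P₂, m₂, e₂⟩ := ih (k + 2)
      refine ⟨fun s => splitStep (K.piecewise fp 0) (K.piecewise fm 0) lam (P₀ s) (P₁ s) (P₂ s),
        ?_, fun s hs hs' => ?_⟩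
      · simp only [splitStep, splitFlux]
        exact (m₁.sub (((mm.comp m₂).add (mp.comp m₁)).const_smul lam)).add
          (((mm.comp m₁).add (mp.comp m₀)).const_smul lam)
      · have ht : 0 ≤ s + j * (lam * h) := by positivity
        have e : s + (j + 1 : ℕ) * (lam * h) = s + j * (lam * h) + lam * h := by
          push_cast
          ring
        rw [e, hv.step k _ ht]
        dsimp only
        rw [← e₀ s hs hs', ← e₁ s hs hs', ← e₂ s hs hs']
        simp [splitStep, splitFlux, hvK _ _ ht]

theorem measurable_scheme {N : ℕ} {fp fm : State N → State N} {lam h : ℝ}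
    {uB : ℝ → State N} {a : ℕ → State N} {v : ℕ → ℝ → State N} {K : Set (State N)}
    (hK : MeasurableSet K) (hfp : ContinuousOn fp K) (hfm : ContinuousOn fm K)
    (huB : Measurable uB) (hτ : 0 < lam * h) (hv : IsSplittingScheme fp fm lam h uB a v)
    (hvK : ∀ k t, 0 ≤ t → v k t ∈ K) (k : ℕ) : Measurable fun t => v k (max t 0) := by
  choose P hP eP using fun j => exists_measurable_time_slab hK hfp hfm huB hτ hv hvK j k
  have h1 : Measurable fun p : ℕ × ℝ => P p.1 p.2 :=
    measurable_from_prod_countable_right (f := fun p : ℕ × ℝ => P p.1 p.2) hP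
  have hfl : Measurable fun t : ℝ => ⌊max t 0 / (lam * h)⌋₊ :=
    Nat.measurable_floor.comp ((measurable_id.max measurable_const).div_const _)
  have h2 : Measurable fun t : ℝ => (⌊max t 0 / (lam * h)⌋₊,
      max t 0 - (⌊max t 0 / (lam * h)⌋₊ : ℝ) * (lam * h)) :=
    hfl.prodMk ((measurable_id.max measurable_const).sub
      (((measurable_from_top (f := fun n : ℕ => (n : ℝ))).comp hfl).mul_const _))
  convert! h1.comp h2 using 1
  ext1 t
  set τ := lam * h
  have h3 := Nat.floor_le (div_nonneg (le_max_right t 0) hτ.le)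
  have h4 := Nat.lt_floor_add_one (max t 0 / τ)
  rw [le_div_iff₀ hτ] at h3
  rw [div_lt_iff₀ hτ, add_mul, one_mul] at h4
  have := eP ⌊max t 0 / τ⌋₊ (max t 0 - ⌊max t 0 / τ⌋₊ * τ) (sub_nonneg.2 h3) (by linarith)
  rwa [sub_add_cancel] at this

/-! ### Test functions in time -/

/-- Non-negative weights in time for which the difference quotients of the extension by zero are
bounded in `L¹`. -/
structure IsTimeTest (φ : ℝ → ℝ) : Prop where
  nonneg : 0 ≤ φ
  integrable : Integrable φ
  exists_bound : ∃ C, 0 ≤ C ∧ ∀ τ, 0 < τ → τ ≤ 1 →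
    ∫ t in Ioi (0 : ℝ), |φ t - (Ioi τ).indicator (fun t => φ (t - τ)) t| ≤ C * τ

/-- The weight need not vanish at `t = 0`: the jump of its extension by zero contributes at most `M
τ`, and the Lipschitz part at most `L τ` on an interval of length `2 R + 1`. -/
theorem isTimeTest_of_lipschitz {φ : ℝ → ℝ} {L : NNReal} (hφ : LipschitzWith L φ)
    (hsupp : HasCompactSupport φ) (h0 : 0 ≤ φ) : IsTimeTest φ := by
  have hint : Integrable φ := hφ.continuous.integrable_of_hasCompactSupport hsupp
  obtain ⟨M, hM⟩ := hsupp.exists_bound_of_continuous hφ.continuous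
  have hM0 : 0 ≤ M := (norm_nonneg _).trans (hM 0)
  obtain ⟨R, hR0, hR⟩ := hsupp.isBounded.subset_closedBall_lt 0 0
  have hz : ∀ t, t ∉ Icc (-R) R → φ t = 0 := fun t ht => by
    by_contra h
    have := hR (subset_tsupport φ h)
    rw [Real.closedBall_eq_Icc, zero_sub, zero_add] at this
    exact ht this
  refine ⟨h0, hint, M + L * (2 * R + 1), by positivity, fun τ hτ hτ1 => ?_⟩
  have i1 : Integrable ((Ioc 0 τ).indicator fun _ : ℝ => M) := by
    rw [integrable_indicator_iff measurableSet_Ioc]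
    exact integrableOn_const (by simp)
  have i2 : Integrable ((Icc (-R) (R + 1)).indicator fun _ : ℝ => (L : ℝ) * τ) := by
    rw [integrable_indicator_iff measurableSet_Icc]
    exact integrableOn_const (by simp)
  have hb : ∀ t ∈ Ioi (0 : ℝ), |φ t - (Ioi τ).indicator (fun t => φ (t - τ)) t| ≤
      (Ioc 0 τ).indicator (fun _ : ℝ => M) t +
        (Icc (-R) (R + 1)).indicator (fun _ : ℝ => (L : ℝ) * τ) t := by
    intro t ht
    have p1 : 0 ≤ (Ioc 0 τ).indicator (fun _ : ℝ => M) t := indicator_nonneg (fun _ _ => hM0) t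
    have p2 : 0 ≤ (Icc (-R) (R + 1)).indicator (fun _ : ℝ => (L : ℝ) * τ) t :=
      indicator_nonneg (fun _ _ => by positivity) t
    by_cases htτ : t ∈ Ioi τ
    · rw [indicator_of_mem htτ]
      by_cases hI : t ∈ Icc (-R) (R + 1)
      · rw [indicator_of_mem hI]
        have := hφ.dist_le_mul t (t - τ)
        rw [Real.dist_eq, Real.dist_eq, sub_sub_cancel, abs_of_pos hτ] at this
        linarith
      · rw [hz t fun h => hI ⟨h.1, by linarith [h.2]⟩,
          hz (t - τ) fun h => hI ⟨by linarith [h.1], by linarith [h.2]⟩]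
        simpa using add_nonneg p1 p2
    · rw [indicator_of_notMem htτ, sub_zero, indicator_of_mem (show t ∈ Ioc 0 τ from
        ⟨ht, not_lt.1 htτ⟩)]
      have := hM t
      rw [Real.norm_eq_abs] at this
      linarith
  calc ∫ t in Ioi (0 : ℝ), |φ t - (Ioi τ).indicator (fun t => φ (t - τ)) t|
      ≤ ∫ t in Ioi (0 : ℝ), ((Ioc 0 τ).indicator (fun _ : ℝ => M) t +
        (Icc (-R) (R + 1)).indicator (fun _ : ℝ => (L : ℝ) * τ) t) :=
        setIntegral_mono_on
          ((hint.sub ((hint.comp_sub_right τ).indicator measurableSet_Ioi)).abs.integrableOn)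
          (i1.add i2).integrableOn measurableSet_Ioi hb
    _ ≤ ∫ t, ((Ioc 0 τ).indicator (fun _ : ℝ => M) t +
        (Icc (-R) (R + 1)).indicator (fun _ : ℝ => (L : ℝ) * τ) t) :=
        setIntegral_le_integral (i1.add i2) (Eventually.of_forall fun t => add_nonneg
          (indicator_nonneg (fun _ _ => hM0) t) (indicator_nonneg (fun _ _ => by positivity) t))
    _ = (M + L * (2 * R + 1)) * τ := by
        rw [integral_add i1 i2, integral_indicator measurableSet_Ioc,
          integral_indicator measurableSet_Icc, setIntegral_const, setIntegral_const,
          Real.volume_real_Ioc_of_le hτ.le, Real.volume_real_Icc_of_le (by linarith)]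
        simp only [smul_eq_mul]
        ring

theorem exists_isTimeTest_integral_sub_le {θ : ℝ → ℝ} (hθ : IntegrableOn θ (Ioi 0))
    (h0 : 0 ≤ θ) {ε : ℝ} (hε : 0 < ε) :
    ∃ φ, IsTimeTest φ ∧ ∫ t in Ioi (0 : ℝ), |θ t - φ t| ≤ ε := by
  have hθ' : Integrable ((Ioi (0 : ℝ)).indicator θ) := by
    rwa [integrable_indicator_iff measurableSet_Ioi]
  obtain ⟨g, hgs, hgd, hg⟩ := (memLp_one_iff_integrable.2 hθ').exist_eLpNorm_sub_le
    ENNReal.one_ne_top le_rfl hε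
  obtain ⟨L, hL⟩ := hgd.lipschitzWith_of_hasCompactSupport hgs (by simp)
  have hgi : Integrable g := hgd.continuous.integrable_of_hasCompactSupport hgs
  have hφ : IsTimeTest fun t => max (g t) 0 :=
    isTimeTest_of_lipschitz (hL.max_const 0)
      -- Taking the positive part keeps the Lipschitz constant and does not worsen the approximation
      -- of `θ ≥ 0`.
      (hgs.comp_left (g := fun x : ℝ => max x 0) (max_self 0)) fun t => le_max_right _ _
  refine ⟨_, hφ, ?_⟩
  have h1 : ∫ t in Ioi (0 : ℝ), |θ t - max (g t) 0| ≤
      ∫ t in Ioi (0 : ℝ), ‖((Ioi (0 : ℝ)).indicator θ - g) t‖ := by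
    refine setIntegral_mono_on (hθ.sub hφ.integrable.integrableOn).abs
      (hθ'.sub hgi).norm.integrableOn measurableSet_Ioi fun t ht => ?_
    rw [Pi.sub_apply, indicator_of_mem ht, Real.norm_eq_abs]
    have := abs_max_sub_max_le_abs (θ t) (g t) 0
    rwa [max_eq_left (show 0 ≤ θ t from h0 t)] at this
  refine h1.trans ((setIntegral_le_integral (hθ'.sub hgi).norm
    (Eventually.of_forall fun t => norm_nonneg _)).trans ?_)
  rw [eLpNorm_one_eq_lintegral_enorm, ← ofReal_integral_norm_eq_lintegral_enorm (hθ'.sub hgi),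
    ENNReal.ofReal_le_ofReal_iff hε.le] at hg
  exact hg

/-- The entropy balance of one cell, integrated against a test function in time. -/
theorem integral_mul_le_of_time_step {φ : ℝ → ℝ} (hφ0 : 0 ≤ φ) (hφ : Integrable φ)
    {C τ lam B : ℝ} (hτ : 0 ≤ τ) (hlam : 0 < lam)
    (hC : ∫ t in Ioi (0 : ℝ), |φ t - (Ioi τ).indicator (fun t => φ (t - τ)) t| ≤ C)
    {a W W' : ℝ → ℝ} (ha : Measurable a) (hW : Measurable W) (hW' : Measurable W')
    (ba : ∀ t, |a t| ≤ B) (bW : ∀ t, |W t| ≤ B) (bW' : ∀ t, |W' t| ≤ B)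
    (hstep : ∀ t, 0 < t → a (t + τ) - a t + lam * (W' t - W t) ≤ 0) :
    ∫ t in Ioi (0 : ℝ), φ t * W' t ≤ (∫ t in Ioi (0 : ℝ), φ t * W t) + B * C / lam := by
  have hB : 0 ≤ B := (abs_nonneg _).trans (ba 0)
  have prodI : ∀ {ψ f : ℝ → ℝ}, Integrable ψ → Measurable f → (∀ t, |f t| ≤ B) →
      Integrable fun t => ψ t * f t := fun hψ hf hb =>
    hψ.mul_bdd hf.aestronglyMeasurable (Eventually.of_forall hb)
  set ψ : ℝ → ℝ := (Ioi τ).indicator fun t => φ (t - τ) with hψ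
  have hψi : Integrable ψ := (hφ.comp_sub_right τ).indicator measurableSet_Ioi
  have iW := prodI hφ hW bW
  have iW' := prodI hφ hW' bW'
  have ia := prodI hφ ha ba
  have iaτ : Integrable fun t => φ t * a (t + τ) := prodI hφ (ha.comp (measurable_id.add_const τ)) fun t => ba (t + τ)
  -- Summation by parts in time: the difference in `t` moves from `a`, of which only a bound is
  -- known, to the weight, whose difference is small in `L¹`.
  have shift : ∫ t in Ioi (0 : ℝ), φ t * a (t + τ) = ∫ t in Ioi (0 : ℝ), ψ t * a t := by
    rw [← integral_indicator measurableSet_Ioi, ← integral_indicator measurableSet_Ioi,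
      ← integral_sub_right_eq_self _ τ]
    congr 1
    ext t
    by_cases ht : t ∈ Ioi τ
    · have h1 : t - τ ∈ Ioi (0 : ℝ) := mem_Ioi.2 (sub_pos.2 (mem_Ioi.1 ht))
      have h2 : t ∈ Ioi (0 : ℝ) := hτ.trans_lt ht
      rw [indicator_of_mem h1, indicator_of_mem h2, hψ, indicator_of_mem ht, sub_add_cancel]
    · have h1 : t - τ ∉ Ioi (0 : ℝ) := fun h => ht (mem_Ioi.2 (sub_pos.1 (mem_Ioi.1 h)))
      rw [indicator_of_notMem h1, eq_comm]
      by_cases h2 : t ∈ Ioi (0 : ℝ)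
      · rw [indicator_of_mem h2, hψ, indicator_of_notMem ht, zero_mul]
      · rw [indicator_of_notMem h2]
  have bound : ∫ t in Ioi (0 : ℝ), (φ t - ψ t) * a t ≤ B * C := by
    calc ∫ t in Ioi (0 : ℝ), (φ t - ψ t) * a t ≤ ∫ t in Ioi (0 : ℝ), B * |φ t - ψ t| := by
          refine setIntegral_mono_on (prodI (hφ.sub hψi) ha ba).integrableOn
            ((hφ.sub hψi).abs.const_mul B).integrableOn measurableSet_Ioi fun t _ => ?_
          refine (le_abs_self _).trans ?_
          rw [abs_mul, mul_comm]
          exact mul_le_mul_of_nonneg_right (ba t) (abs_nonneg _)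
      _ ≤ B * C := by
          rw [integral_const_mul]
          exact mul_le_mul_of_nonneg_left hC hB
  have main : ∫ t in Ioi (0 : ℝ), lam * (φ t * W' t - φ t * W t) ≤
      ∫ t in Ioi (0 : ℝ), (φ t * a t - φ t * a (t + τ)) := by
    refine setIntegral_mono_on ((iW'.sub iW).const_mul lam).integrableOn
      (ia.sub iaτ).integrableOn measurableSet_Ioi fun t ht => ?_
    have := mul_le_mul_of_nonneg_left (hstep t ht) (hφ0 t)
    linarith
  rw [integral_const_mul, integral_sub iW'.integrableOn iW.integrableOn,
    integral_sub ia.integrableOn iaτ.integrableOn, shift] at main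
  simp only [sub_mul] at bound
  rw [integral_sub ia.integrableOn (prodI hψi ha ba).integrableOn] at bound
  rw [← sub_le_iff_le_add', le_div_iff₀ hlam, mul_comm]
  exact main.trans bound

/-! ### Traces of almost monotone limits -/

theorem le_add_of_cell_step {A : ℕ → ℝ} {c : ℝ} (hA : ∀ k, A (k + 1) ≤ A k + c) {j k : ℕ}
    (hjk : j ≤ k) : A k ≤ A j + c * (k - j) := by
  induction k, hjk using Nat.le_induction with
  | base => simp
  | succ k _ ih =>
    have := hA k
    push_cast
    linarith

instance neBot_nhdsGT_inf_ae : (𝓝[>] (0 : ℝ) ⊓ ae (volume : Measure ℝ)).NeBot := by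
  refine Filter.inf_neBot_iff.2 fun {s} hs {t} ht => ?_
  by_contra hcon
  rw [not_nonempty_iff_eq_empty] at hcon
  obtain ⟨u, hu, hus⟩ := mem_nhdsGT_iff_exists_Ioo_subset.1 hs
  have hsub : Ioo 0 u ⊆ tᶜ := fun x hx hxt =>
    (hcon ▸ (⟨hus hx, hxt⟩ : x ∈ s ∩ t) : x ∈ (∅ : Set ℝ))
  have hz := measure_mono_null hsub (mem_ae_iff.1 ht)
  rw [Real.volume_Ioo, ENNReal.ofReal_eq_zero, sub_zero] at hz
  exact hz.not_gt hu

/-- A decreasing function bounded above tends to its supremum as `x → 0+`; the values off the set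
`S` of full measure are invisible to the filter. -/
theorem exists_tendsto_of_antitoneOn {E : ℝ → ℝ} {S : Set ℝ} (hS : ∀ᵐ x, x ∈ S)
    (hE : AntitoneOn E (S ∩ Ioi 0)) {B : ℝ} (hB : ∀ x ∈ S ∩ Ioi 0, E x ≤ B) :
    ∃ L, Tendsto E (𝓝[>] (0 : ℝ) ⊓ ae volume) (𝓝 L) := by
  have hne : (S ∩ Ioi (0 : ℝ)).Nonempty :=
    neBot_nhdsGT_inf_ae.nonempty_of_mem (inter_comm (Ioi (0 : ℝ)) S ▸
      inter_mem_inf self_mem_nhdsWithin hS)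
  have hbdd : BddAbove (E '' (S ∩ Ioi 0)) := ⟨B, by
    rintro _ ⟨x, hx, rfl⟩
    exact hB x hx⟩
  refine ⟨sSup (E '' (S ∩ Ioi 0)), Metric.tendsto_nhds.2 fun ε hε => ?_⟩
  obtain ⟨_, ⟨s, hs, rfl⟩, hlt⟩ := exists_lt_of_lt_csSup (hne.image E)
    (sub_lt_self (sSup (E '' (S ∩ Ioi 0))) hε)
  have h1 : ∀ᶠ x in 𝓝[>] (0 : ℝ) ⊓ ae volume, x ∈ Ioo 0 s :=
    Eventually.filter_mono inf_le_left (Ioo_mem_nhdsGT hs.2)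
  have h2 : ∀ᶠ x in 𝓝[>] (0 : ℝ) ⊓ ae volume, x ∈ S := Eventually.filter_mono inf_le_right hS
  filter_upwards [h1, h2] with x hx hxS
  have hxm : x ∈ S ∩ Ioi 0 := ⟨hxS, hx.1⟩
  have k1 := hE hxm hs hx.2.le
  have k2 := le_csSup hbdd (mem_image_of_mem E hxm)
  rw [Real.dist_eq, abs_lt]
  constructor <;> linarith

/-- Divide by `δ` and let `δ → 0+`. With primitives for `Φ` and `Ψ`, this turns inequalities between
averages into pointwise ones at Lebesgue points. -/
theorem le_of_forall_integral_le {Φ Ψ : ℝ → ℝ} {x y : ℝ} {a b : ℝ}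
    (hx : HasDerivAt Φ a x) (hy : HasDerivAt Ψ b y) {D : ℝ → ℝ} {d : ℝ}
    (hD : Tendsto D (𝓝[>] 0) (𝓝 d))
    (h : ∀ δ, 0 < δ → Ψ (y + δ) - Ψ y ≤ Φ (x + δ) - Φ x + δ * D δ) : b ≤ a + d := by
  refine le_of_tendsto_of_tendsto hy.tendsto_slope_zero_right
    (hx.tendsto_slope_zero_right.add hD) ?_
  filter_upwards [self_mem_nhdsWithin] with δ hδ
  have hδ : 0 < δ := hδ
  simp only [smul_eq_mul]
  calc δ⁻¹ * (Ψ (y + δ) - Ψ y) ≤ δ⁻¹ * (Φ (x + δ) - Φ x + δ * D δ) := by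
        have := h δ hδ
        gcongr
    _ = δ⁻¹ * (Φ (x + δ) - Φ x) + D δ := by
        field_simp

/-- Weak limits of cell functions whose increments per cell are at most `C h` have a trace
at `0`, which lies below the limits in the individual cells. -/
theorem exists_trace_of_cells {A : ℕ → ℕ → ℝ} {h : ℕ → ℝ} {B C : ℝ} (hh : ∀ n, 0 < h n)
    (h0 : Tendsto h atTop (𝓝 0)) (hC : 0 ≤ C)
    (hA : ∀ᶠ n in atTop, ∀ k, A n (k + 1) ≤ A n k + C * h n) (hB : ∀ n k, |A n k| ≤ B)
    {Φ : ℝ → ℝ} (hΦ : Measurable Φ) (hΦB : ∀ x, |Φ x| ≤ B)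
    (hlim : ∀ a b, 0 < a → a < b → Tendsto (fun n => ∫ x in a..b, A n ⌊x / h n⌋₊) atTop
      (𝓝 (∫ x in a..b, Φ x))) {M : ℕ → ℝ}
    (hM : ∀ k, Tendsto (fun n => A n k) atTop (𝓝 (M k))) :
    ∃ L, Tendsto Φ (𝓝[>] (0 : ℝ) ⊓ ae volume) (𝓝 L) ∧ ∀ k, L ≤ M k := by
  have hAm : ∀ n, Measurable fun x : ℝ => A n ⌊x / h n⌋₊ := fun n =>
    (measurable_from_top (f := A n)).comp
      (Nat.measurable_floor.comp (measurable_id.div_const _))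
  have bddI : ∀ {f : ℝ → ℝ}, Measurable f → (∀ x, |f x| ≤ B) → LocallyIntegrable f volume :=
    fun {f} hf hb => (locallyIntegrable_const B).mono hf.aestronglyMeasurable
      (Eventually.of_forall fun x => (hb x).trans (le_abs_self B))
  have intI : ∀ {f : ℝ → ℝ}, Measurable f → (∀ x, |f x| ≤ B) → ∀ a b : ℝ,
      IntervalIntegrable f volume a b := fun hf hb a b =>
    ((bddI hf hb).integrableOn_isCompact isCompact_uIcc).intervalIntegrable
  have iA : ∀ n a b, IntervalIntegrable (fun x : ℝ => A n ⌊x / h n⌋₊) volume a b := fun n =>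
    intI (hAm n) fun x => hB n _
  -- Weak convergence controls averages of `Φ` only; on this set of full measure they recover its
  -- values.
  set S : Set ℝ := {x | ∀ c, HasDerivAt (fun x => ∫ t in c..x, Φ t) (Φ x) x} with hSdef
  have hS : ∀ᵐ x, x ∈ S := LocallyIntegrable.ae_hasDerivAt_integral (bddI hΦ hΦB)
  have split : ∀ x δ : ℝ, (∫ t in (0 : ℝ)..(x + δ), Φ t) - ∫ t in (0 : ℝ)..x, Φ t =
      ∫ t in x..(x + δ), Φ t := fun x δ =>
    intervalIntegral.integral_interval_sub_left (intI hΦ hΦB _ _) (intI hΦ hΦB _ _)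
  have mono : ∀ x y, 0 < x → x ≤ y → ∀ δ, 0 < δ →
      ∫ t in y..(y + δ), Φ t ≤ (∫ t in x..(x + δ), Φ t) + δ * (C * (y - x)) := by
    intro x y hx hxy δ hδ
    -- The extra `h n` is the rounding error: a shift by `y - x` may cross one cell more than its
    -- length suggests. It disappears in the limit.
    have lim2 : Tendsto (fun n => (∫ t in x..(x + δ), A n ⌊t / h n⌋₊) + δ * (C * (y - x + h n)))
        atTop (𝓝 ((∫ t in x..(x + δ), Φ t) + δ * (C * (y - x + 0)))) :=
      (hlim x (x + δ) hx (by linarith)).add (((h0.const_add _).const_mul C).const_mul δ)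
    rw [add_zero] at lim2
    refine le_of_tendsto_of_tendsto (hlim y (y + δ) (by linarith) (by linarith)) lim2 ?_
    filter_upwards [hA] with n hn
    have hpt : ∀ t ∈ Icc x (x + δ), A n ⌊(t + (y - x)) / h n⌋₊ ≤
        A n ⌊t / h n⌋₊ + C * (y - x + h n) := by
      intro t ht
      have ht0 : 0 ≤ t := hx.le.trans ht.1
      have hle : ⌊t / h n⌋₊ ≤ ⌊(t + (y - x)) / h n⌋₊ :=
        Nat.floor_mono (div_le_div_of_nonneg_right (by linarith) (hh n).le)
      refine (le_add_of_cell_step hn hle).trans ?_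
      rw [mul_assoc]
      have u1 := Nat.floor_le (div_nonneg (show 0 ≤ t + (y - x) by linarith) (hh n).le)
      have u2 := Nat.lt_floor_add_one (t / h n)
      rw [le_div_iff₀ (hh n)] at u1
      rw [div_lt_iff₀ (hh n)] at u2
      gcongr
      linarith
    have e : ∫ t in y..(y + δ), A n ⌊t / h n⌋₊ =
        ∫ t in x..(x + δ), A n ⌊(t + (y - x)) / h n⌋₊ := by
      rw [intervalIntegral.integral_comp_add_right fun t => A n ⌊t / h n⌋₊]
      congr 1 <;> ring
    have e2 : (∫ t in x..(x + δ), A n ⌊t / h n⌋₊) + δ * (C * (y - x + h n)) =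
        ∫ t in x..(x + δ), (A n ⌊t / h n⌋₊ + C * (y - x + h n)) := by
      rw [intervalIntegral.integral_add (iA n _ _) intervalIntegrable_const,
        intervalIntegral.integral_const, add_sub_cancel_left, smul_eq_mul]
    rw [e, e2]
    exact intervalIntegral.integral_mono_on (by linarith)
      (intI ((hAm n).comp (measurable_id.add_const _)) (fun t => hB n _) _ _)
      ((iA n _ _).add intervalIntegrable_const) hpt
  have below : ∀ k x, 0 < x → ∀ δ, 0 < δ →
      ∫ t in x..(x + δ), Φ t ≤ δ * (M k + C * (x + δ)) := by
    intro k x hx δ hδ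
    -- For fixed `k` the cell `k` shrinks to the boundary, so eventually it lies to the left of `x`
    -- and the cells from there to `t` cost at most `C t`.
    refine le_of_tendsto_of_tendsto (hlim x (x + δ) hx (by linarith))
      (((hM k).add_const (C * (x + δ))).const_mul δ) ?_
    have hsmall : ∀ᶠ n in atTop, k * h n < x := by
      have := h0.const_mul (k : ℝ)
      rw [mul_zero] at this
      exact this.eventually_lt_const hx
    filter_upwards [hA, hsmall] with n hn hk
    have hpt : ∀ t ∈ Icc x (x + δ), A n ⌊t / h n⌋₊ ≤ A n k + C * (x + δ) := by
      intro t ht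
      have hle : k ≤ ⌊t / h n⌋₊ := Nat.le_floor (by
        rw [le_div_iff₀ (hh n)]
        linarith [ht.1])
      refine (le_add_of_cell_step hn hle).trans ?_
      rw [mul_assoc]
      have u1 := Nat.floor_le (div_nonneg (hx.le.trans ht.1) (hh n).le)
      rw [le_div_iff₀ (hh n)] at u1
      have u3 : 0 ≤ (k : ℝ) * h n := mul_nonneg k.cast_nonneg (hh n).le
      gcongr
      linarith [ht.2]
    have := intervalIntegral.integral_mono_on (by linarith) (iA n x (x + δ))
      intervalIntegrable_const hpt
    rwa [intervalIntegral.integral_const, add_sub_cancel_left, smul_eq_mul] at this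
  have monoS : ∀ x ∈ S, ∀ y ∈ S, 0 < x → x ≤ y → Φ y ≤ Φ x + C * (y - x) := by
    intro x hx y hy hx0 hxy
    refine le_of_forall_integral_le (hx 0) (hy 0) (D := fun _ => C * (y - x)) tendsto_const_nhds
      fun δ hδ => ?_
    rw [split, split]
    exact mono x y hx0 hxy δ hδ
  have belowS : ∀ k, ∀ x ∈ S, 0 < x → Φ x ≤ M k + C * x := by
    intro k x hx hx0
    have hD : Tendsto (fun δ => M k + C * (x + δ)) (𝓝[>] 0) (𝓝 (M k + C * x)) := by
      have : Continuous fun δ : ℝ => M k + C * (x + δ) := by fun_prop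
      simpa using (this.tendsto 0).mono_left nhdsWithin_le_nhds
    have := le_of_forall_integral_le (hasDerivAt_const x (0 : ℝ)) (hx 0) hD fun δ hδ => by
      rw [split, sub_zero, zero_add]
      exact below k x hx0 δ hδ
    rwa [zero_add] at this
  -- Subtracting the accumulated error `C x` makes `Φ` truly decreasing, and the correction vanishes
  -- at `0`.
  obtain ⟨L, hL⟩ := exists_tendsto_of_antitoneOn (E := fun x => Φ x - C * x) hS
    (fun x hx y hy hxy => by
      have := monoS x hx.1 y hy.1 hx.2 hxy
      dsimp only
      linarith)
    (B := B) (fun x hx => by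
      have h1 := (le_abs_self _).trans (hΦB x)
      have h2 : 0 ≤ C * x := mul_nonneg hC (le_of_lt hx.2)
      linarith)
  have hid : Tendsto (fun x : ℝ => C * x) (𝓝[>] (0 : ℝ) ⊓ ae volume) (𝓝 0) := by
    have : Continuous fun x : ℝ => C * x := by fun_prop
    simpa using (this.tendsto 0).mono_left (inf_le_left.trans nhdsWithin_le_nhds)
  have hLΦ : Tendsto Φ (𝓝[>] (0 : ℝ) ⊓ ae volume) (𝓝 L) := by
    simpa using hL.add hid
  refine ⟨L, hLΦ, fun k => ?_⟩
  have lim3 : Tendsto (fun x : ℝ => M k + C * x) (𝓝[>] (0 : ℝ) ⊓ ae volume) (𝓝 (M k)) := by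
    simpa using hid.const_add (M k)
  refine le_of_tendsto_of_tendsto hLΦ lim3 ?_
  have h1 : ∀ᶠ x in 𝓝[>] (0 : ℝ) ⊓ ae volume, x ∈ Ioi (0 : ℝ) :=
    Eventually.filter_mono inf_le_left self_mem_nhdsWithin
  have h2 : ∀ᶠ x in 𝓝[>] (0 : ℝ) ⊓ ae volume, x ∈ S := Eventually.filter_mono inf_le_right hS
  filter_upwards [h1, h2] with x hx hxS
  exact belowS k x hxS hx

/-! ### Weak limits of sections of a kernel -/

theorem abs_integral_mul_sub_le {Z : Type*} [MeasurableSpace Z] {m : Measure Z} {f θ ψ : Z → ℝ}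
    {B : ℝ} (hf : AEStronglyMeasurable f m) (hB : ∀ z, ‖f z‖ ≤ B) (hθ : Integrable θ m)
    (hψ : Integrable ψ m) :
    |∫ z, f z * θ z ∂m - ∫ z, f z * ψ z ∂m| ≤ B * ∫ z, |θ z - ψ z| ∂m := by
  rw [← integral_sub (hθ.bdd_mul hf (Eventually.of_forall hB))
    (hψ.bdd_mul hf (Eventually.of_forall hB)), ← integral_const_mul]
  refine (abs_integral_le_integral_abs).trans
    (integral_mono_of_nonneg (Eventually.of_forall fun z => abs_nonneg _)
      ((hθ.sub hψ).abs.const_mul B) (Eventually.of_forall fun z => ?_))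
  dsimp only
  rw [← mul_sub, abs_mul]
  exact mul_le_mul_of_nonneg_right (hB z) (abs_nonneg _)

/-- Weak convergence of bounded functions may be tested on weights that approximate in `L¹`. -/
theorem tendsto_integral_mul_of_approx {Z ι : Type*} [MeasurableSpace Z] {m : Measure Z}
    {l : Filter ι} {f : ι → Z → ℝ} {f₀ : Z → ℝ} {B : ℝ} (hf : ∀ i, AEStronglyMeasurable (f i) m)
    (hf₀ : AEStronglyMeasurable f₀ m) (hB : ∀ i z, ‖f i z‖ ≤ B) (hB₀ : ∀ z, ‖f₀ z‖ ≤ B)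
    {θ : Z → ℝ} (hθ : Integrable θ m)
    (happ : ∀ ε, 0 < ε → ∃ ψ, Integrable ψ m ∧ ∫ z, |θ z - ψ z| ∂m ≤ ε ∧
      Tendsto (fun i => ∫ z, f i z * ψ z ∂m) l (𝓝 (∫ z, f₀ z * ψ z ∂m))) :
    Tendsto (fun i => ∫ z, f i z * θ z ∂m) l (𝓝 (∫ z, f₀ z * θ z ∂m)) := by
  refine Metric.tendsto_nhds.2 fun ε hε => ?_
  have hB1 : 0 < |B| + 1 := by positivity
  obtain ⟨ψ, hψ, happψ, hlim⟩ := happ (ε / (3 * (|B| + 1))) (by positivity)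
  have hsmall : B * ∫ z, |θ z - ψ z| ∂m ≤ ε / 3 := by
    calc B * ∫ z, |θ z - ψ z| ∂m ≤ (|B| + 1) * (ε / (3 * (|B| + 1))) :=
          mul_le_mul (by linarith [le_abs_self B]) happψ
            (integral_nonneg fun z => abs_nonneg _) hB1.le
      _ = ε / 3 := by field_simp
  filter_upwards [Metric.tendsto_nhds.1 hlim (ε / 3) (by positivity)] with i hi
  have e1 := (abs_integral_mul_sub_le (hf i) (hB i) hθ hψ).trans hsmall
  have e2 := (abs_integral_mul_sub_le hf₀ hB₀ hθ hψ).trans hsmall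
  rw [Real.dist_eq, abs_lt] at *
  rw [abs_le] at e1 e2
  constructor <;> linarith [e1.1, e1.2, e2.1, e2.2, hi.1, hi.2]

/-- Compactness of Young measures: along an ultrafilter, the sections `ν (x, ·)` of a kernel
carried by a compact set converge weakly to a kernel. -/
theorem exists_kernel_limit {N : ℕ} (ν : Kernel (ℝ × ℝ) (State N)) [IsMarkovKernel ν]
    {m : Measure ℝ} [SigmaFinite m] [NeZero m] {K : Set (State N)} (hK : IsCompact K)
    (𝒢 : Ultrafilter ℝ) (hν : ∀ᶠ x in (𝒢 : Filter ℝ), ∀ᵐ t ∂m, ν (x, t) Kᶜ = 0) :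
    ∃ ν₀ : Kernel ℝ (State N), IsMarkovKernel ν₀ ∧ (∀ᵐ t ∂m, ν₀ t Kᶜ = 0) ∧
      ∀ (g : BoundedContinuousFunction (State N) ℝ) (θ : ℝ → ℝ), Integrable θ m →
        Tendsto (fun x => ∫ t, (∫ u, g u ∂(ν (x, t))) * θ t ∂m) 𝒢
          (𝓝 (∫ t, (∫ u, g u ∂(ν₀ t)) * θ t ∂m)) := by
  -- A probability measure with the same null sets as `m`; it makes each `ρ ⊗ₘ sec x` a probability
  -- measure, with fixed first marginal and values in `K`, hence a tight family.
  set ρ := m.toFinite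
  let sec : ℝ → Kernel ℝ (State N) := fun x => ν.comap (fun t => (x, t)) measurable_prodMk_left
  let π : ℝ → ProbabilityMeasure (ℝ × State N) := fun x => ⟨ρ ⊗ₘ sec x, inferInstance⟩
  have hKc : MeasurableSet Kᶜ := hK.isClosed.measurableSet.compl
  have carried : ∀ x, (∀ᵐ t ∂m, ν (x, t) Kᶜ = 0) → (ρ ⊗ₘ sec x) (univ ×ˢ Kᶜ) = 0 := by
    intro x hx
    rw [Measure.compProd_apply_prod MeasurableSet.univ hKc, Measure.restrict_univ]
    refine lintegral_eq_zero_of_ae_eq_zero ?_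
    exact (toFinite_absolutelyContinuous m).ae_le hx
  let G : Set ℝ := {x | ∀ᵐ t ∂m, ν (x, t) Kᶜ = 0}
  have htight : IsTightMeasureSet {x | ∃ p ∈ π '' G, (p : Measure (ℝ × State N)) = x} := by
    refine IsTightMeasureSet.prodMk ((isTightMeasureSet_singleton (μ := ρ)).subset ?_) ?_
    · rintro _ ⟨_, ⟨_, ⟨x, -, rfl⟩, rfl⟩, rfl⟩
      exact Measure.fst_compProd _ _
    · rw [isTightMeasureSet_iff_exists_isCompact_measure_compl_le]
      intro ε _
      refine ⟨K, hK, ?_⟩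
      rintro _ ⟨_, ⟨_, ⟨x, hx, rfl⟩, rfl⟩, rfl⟩
      rw [Measure.snd_apply hKc, ← univ_prod]
      exact (carried x hx).le.trans (zero_le)
  obtain ⟨p, -, hp⟩ := (isCompact_closure_of_isTightMeasureSet htight).ultrafilter_le_nhds'
    (𝒢.map π) (by
      refine Filter.mem_of_superset ?_ subset_closure
      change π ⁻¹' (π '' G) ∈ (𝒢 : Filter ℝ)
      exact Filter.mem_of_superset hν (subset_preimage_image π G))
  have hlim : Tendsto π 𝒢 (𝓝 p) := hp
  have hint := ProbabilityMeasure.tendsto_iff_forall_integral_tendsto.1 hlim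
  have hfst : (p : Measure (ℝ × State N)).fst = ρ := by
    refine ext_of_forall_integral_eq_of_IsFiniteMeasure fun g => ?_
    have h1 := hint (g.compContinuous ⟨Prod.fst, continuous_fst⟩)
    have h2 : ∀ σ : Measure (ℝ × State N),
        ∫ q, (g.compContinuous ⟨Prod.fst, continuous_fst⟩) q ∂σ = ∫ t, g t ∂σ.fst := fun σ => by
      rw [Measure.fst, integral_map measurable_fst.aemeasurable
        g.continuous.measurable.aestronglyMeasurable]
      rfl
    simp only [h2] at h1
    have h3 : ∀ x, (π x : Measure (ℝ × State N)).fst = ρ := fun x => Measure.fst_compProd _ _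
    simp only [h3] at h1
    exact tendsto_nhds_unique h1 tendsto_const_nhds
  -- The first marginal survives the limit, so the limit measure disintegrates over `ρ`; its
  -- conditional kernel is the limit kernel.
  have hdis : ρ ⊗ₘ (p : Measure (ℝ × State N)).condKernel = p := by
    rw [← hfst]
    exact Measure.disintegrate _ _
  refine ⟨(p : Measure (ℝ × State N)).condKernel, inferInstance, ?_, fun g θ hθ => ?_⟩
  · have hopen : IsOpen (univ ×ˢ Kᶜ : Set (ℝ × State N)) :=
      -- Portmanteau: the open set `univ ×ˢ Kᶜ` has no mass along the ultrafilter, hence none in the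
      -- limit.
      isOpen_univ.prod hK.isClosed.isOpen_compl
    have h1 := ProbabilityMeasure.le_liminf_measure_open_of_tendsto hlim hopen
    have h2 : liminf (fun x => (π x : Measure (ℝ × State N)) (univ ×ˢ Kᶜ)) (𝒢 : Filter ℝ) = 0 := by
      rw [liminf_congr (v := fun _ => 0) (by
        filter_upwards [hν] with x hx
        exact carried x hx)]
      exact liminf_const 0
    rw [h2, ← hdis, nonpos_iff_eq_zero, Measure.compProd_apply_prod MeasurableSet.univ hKc,
      Measure.restrict_univ, lintegral_eq_zero_iff (Kernel.measurable_coe _ hKc)] at h1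
    exact (absolutelyContinuous_toFinite m).ae_le h1
  · have hac := absolutelyContinuous_toFinite m
    -- The density of `m` with respect to `ρ` is absorbed into the weight.
    have conv : ∀ f : ℝ → ℝ, ∫ t, f t * θ t ∂m =
        ∫ t, f t * ((m.rnDeriv ρ t).toReal • θ t) ∂ρ := fun f => by
      rw [← integral_rnDeriv_smul hac]
      refine integral_congr_ae (Eventually.of_forall fun t => ?_)
      simp only [smul_eq_mul]
      ring
    simp_rw [conv]
    have hθ' : Integrable (fun t => (m.rnDeriv ρ t).toReal • θ t) ρ :=
      (integrable_rnDeriv_smul_iff hac).2 hθ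
    refine tendsto_integral_mul_of_approx (B := ‖g‖)
      (fun x => (stronglyMeasurable_integral_bcf (sec x) g).aestronglyMeasurable)
      (stronglyMeasurable_integral_bcf _ g).aestronglyMeasurable
      (fun x t => norm_integral_bcf_le (sec x) g t) (norm_integral_bcf_le _ g) hθ' fun ε hε => ?_
    -- Weak convergence on the product needs weights that are continuous in `t`; the others are
    -- reached by `L¹` approximation.
    obtain ⟨ψ, hψ, hψi⟩ := hθ'.exists_boundedContinuous_integral_sub_le hε
    refine ⟨ψ, hψi, hψ, ?_⟩
    have key := hint (g.compContinuous ⟨Prod.snd, continuous_snd⟩ *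
      ψ.compContinuous ⟨Prod.fst, continuous_fst⟩)
    have h4 : ∀ (η : Kernel ℝ (State N)) [IsMarkovKernel η],
        ∫ q, (g.compContinuous ⟨Prod.snd, continuous_snd⟩ *
          ψ.compContinuous ⟨Prod.fst, continuous_fst⟩ :
            BoundedContinuousFunction (ℝ × State N) ℝ) q ∂(ρ ⊗ₘ η) =
        ∫ t, (∫ u, g u ∂(η t)) * ψ t ∂ρ := fun η _ => by
      rw [Measure.integral_compProd (BoundedContinuousFunction.integrable _ _)]
      refine integral_congr_ae (Eventually.of_forall fun t => ?_)
      dsimp only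
      rw [← integral_mul_const]
      rfl
    rw [← h4, hdis]
    refine key.congr fun x => ?_
    exact h4 (sec x)

/-! ### Entropy fluxes in the limit of vanishing mesh size -/

theorem ae_le_of_forall_isTimeTest {f₁ f₂ : ℝ → ℝ} {B : ℝ}
    (m₁ : AEStronglyMeasurable f₁ (volume.restrict (Ioi (0 : ℝ))))
    (m₂ : AEStronglyMeasurable f₂ (volume.restrict (Ioi (0 : ℝ)))) (b₁ : ∀ t, ‖f₁ t‖ ≤ B)
    (b₂ : ∀ t, ‖f₂ t‖ ≤ B)
    (h : ∀ φ, IsTimeTest φ →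
      ∫ t in Ioi (0 : ℝ), f₁ t * φ t ≤ ∫ t in Ioi (0 : ℝ), f₂ t * φ t) :
    f₁ ≤ᵐ[volume.restrict (Ioi (0 : ℝ))] f₂ := by
  have hB : 0 ≤ B := (norm_nonneg _).trans (b₁ 0)
  refine ae_le_of_forall_integral_mul_le m₁ m₂ (Eventually.of_forall b₁)
    (Eventually.of_forall b₂) fun θ hθ h0 => ?_
  simp only [mul_comm (θ _)]
  refine le_of_forall_pos_le_add fun ε hε => ?_
  obtain ⟨φ, hφ, happ⟩ := exists_isTimeTest_integral_sub_le hθ h0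
    (ε := ε / (2 * (B + 1))) (by positivity)
  have e1 := abs_integral_mul_sub_le m₁ b₁ hθ hφ.integrable.integrableOn
  have e2 := abs_integral_mul_sub_le m₂ b₂ hθ hφ.integrable.integrableOn
  have e3 : B * ∫ t in Ioi (0 : ℝ), |θ t - φ t| ≤ ε / 2 := by
    calc B * ∫ t in Ioi (0 : ℝ), |θ t - φ t| ≤ (B + 1) * (ε / (2 * (B + 1))) :=
          mul_le_mul (by linarith) happ (integral_nonneg fun z => abs_nonneg _) (by linarith)
      _ = ε / 2 := by field_simp
  have := h φ hφ
  rw [abs_le] at e1 e2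
  linarith [e1.2, e2.1]

theorem integral_strip_left {A : Set ℝ} (hA : MeasurableSet A) (hA0 : A ⊆ Ioi 0)
    (hAfin : volume A < ⊤) {β : ℝ → ℝ} (hβ : IntegrableOn β (Ioi 0)) {H : ℝ × ℝ → ℝ} {B : ℝ}
    (hH : AEStronglyMeasurable H quarterPlane) (hB : ∀ z, ‖H z‖ ≤ B) :
    ∫ z, A.indicator (fun _ => (1 : ℝ)) z.1 * β z.2 * H z ∂quarterPlane =
      ∫ x in A, ∫ t in Ioi (0 : ℝ), β t * H (x, t) := by
  have hint := (integrable_strip hA hAfin hβ).mul_bdd hH (Eventually.of_forall hB)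
  rw [quarterPlane_eq_prod] at hint ⊢
  rw [integral_prod _ hint, ← integral_indicator hA, ← integral_indicator measurableSet_Ioi]
  congr 1
  ext x
  by_cases hx : x ∈ A
  · simp [hx, hA0 hx]
  · simp [hx]

theorem measurable_meshFunction {N : ℕ} {h : ℝ} {v : ℕ → ℝ → State N}
    (hv : ∀ k, Measurable (v k)) : Measurable fun z : ℝ × ℝ => meshFunction h v z.1 z.2 := by
  have h1 : Measurable fun p : ℕ × ℝ => v p.1 p.2 :=
    measurable_from_prod_countable_right (f := fun p : ℕ × ℝ => v p.1 p.2) hv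
  have h2 : Measurable fun z : ℝ × ℝ => (⌊z.1 / h⌋₊, z.2) :=
    (Nat.measurable_floor.comp (measurable_fst.div_const h)).prodMk measurable_snd
  exact h1.comp h2

theorem abs_integral_test_mul_le {φ f : ℝ → ℝ} {B : ℝ} (hφ : IsTimeTest φ)
    (hB : ∀ t, |f t| ≤ B) : |∫ t in Ioi (0 : ℝ), φ t * f t| ≤ B * ∫ t in Ioi (0 : ℝ), φ t := by
  rw [← integral_const_mul]
  refine abs_integral_le_integral_abs.trans (integral_mono_of_nonneg
    (Eventually.of_forall fun t => abs_nonneg _) (hφ.integrable.integrableOn.const_mul B)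
    (Eventually.of_forall fun t => ?_))
  dsimp only
  rw [abs_mul, abs_of_nonneg (hφ.nonneg t), mul_comm]
  exact mul_le_mul_of_nonneg_right (hB t) (hφ.nonneg t)

/-- Shifting the domain of integration by a length tending to zero does not change limits. -/
theorem tendsto_integral_shift {R : ℕ → ℝ → ℝ} {h : ℕ → ℝ} {B a b l : ℝ}
    (h0 : Tendsto h atTop (𝓝 0)) (hR : ∀ n, Measurable (R n)) (hB : ∀ n x, |R n x| ≤ B)
    (hl : Tendsto (fun n => ∫ x in a..b, R n x) atTop (𝓝 l)) :
    Tendsto (fun n => ∫ x in a..b, R n (x + h n)) atTop (𝓝 l) := by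
  have hI : ∀ n c d, IntervalIntegrable (R n) volume c d := fun n c d =>
    ((locallyIntegrable_const B).mono (hR n).aestronglyMeasurable
      (Eventually.of_forall fun x => (hB n x).trans (le_abs_self B))
      |>.integrableOn_isCompact isCompact_uIcc).intervalIntegrable
  have e : ∀ n, ∫ x in a..b, R n (x + h n) =
      (∫ x in a..b, R n x) + ((∫ x in b..(b + h n), R n x) - ∫ x in a..(a + h n), R n x) := by
    intro n
    rw [intervalIntegral.integral_comp_add_right (R n),
      ← intervalIntegral.integral_interval_sub_interval_comm' (hI n _ _) (hI n _ _) (hI n _ _)]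
    ring
  have small : ∀ c, Tendsto (fun n => ∫ x in c..(c + h n), R n x) atTop (𝓝 0) := fun c => by
    have hb : Tendsto (fun n => B * |h n|) atTop (𝓝 0) := by
      simpa using (h0.abs).const_mul B
    refine squeeze_zero_norm (fun n => ?_) hb
    have := intervalIntegral.norm_integral_le_of_norm_le_const (a := c) (b := c + h n)
      (f := R n) (C := B) fun x _ => hB n x
    simpa using this
  simp_rw [e]
  simpa using hl.add ((small b).sub (small a))

/-- The weak limit of the numerical flux across the boundary between the cells `k`, `k + 1`. -/
noncomputable def cellFlux {N : ℕ} (μ : Kernel (ℝ × ℝ) (State N))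
    (gp gm : BoundedContinuousFunction (State N) ℝ) (k : ℕ) (t : ℝ) : ℝ :=
  (∫ u, gp u ∂(cellKernel μ k t)) + ∫ u, gm u ∂(cellKernel μ (k + 1) t)

theorem measurable_cellFlux {N : ℕ} (μ : Kernel (ℝ × ℝ) (State N))
    (gp gm : BoundedContinuousFunction (State N) ℝ) (k : ℕ) :
    StronglyMeasurable (cellFlux μ gp gm k) :=
  (stronglyMeasurable_integral_bcf (cellKernel μ k) gp).add
    (stronglyMeasurable_integral_bcf (cellKernel μ (k + 1)) gm)

theorem norm_cellFlux_le {N : ℕ} (μ : Kernel (ℝ × ℝ) (State N)) [IsMarkovKernel μ]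
    (gp gm : BoundedContinuousFunction (State N) ℝ) (k : ℕ) (t : ℝ) :
    ‖cellFlux μ gp gm k t‖ ≤ ‖gp‖ + ‖gm‖ :=
  (norm_add_le _ _).trans (add_le_add (norm_integral_bcf_le _ gp t) (norm_integral_bcf_le _ gm t))

section Core

variable {N : ℕ} {V : Set (State N)} {h : ℕ → ℝ} {v : ℕ → ℕ → ℝ → State N}
  {ν μ : Kernel (ℝ × ℝ) (State N)} {lam : ℝ}
  {gU gp gm : BoundedContinuousFunction (State N) ℝ}

/-- For test functions in time, the flux `⟨ν, F⟩` has a trace at the boundary, and the discrete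
boundary layer fluxes decrease and lie above this trace. -/
theorem exists_trace_of_test (hlam : 0 < lam) (hh : ∀ n, 0 < h n) (h0 : Tendsto h atTop (𝓝 0))
    (hv : ∀ n k, Measurable (v n k))
    (hstep : ∀ n k t, 0 < t → gU (v n (k + 1) (t + lam * h n)) - gU (v n (k + 1) t) +
      lam * ((gm (v n (k + 2) t) + gp (v n (k + 1) t)) - (gm (v n (k + 1) t) + gp (v n k t))) ≤ 0)
    (hν : IsYoungMeasureOf quarterPlane V (fun n z => meshFunction (h n) (v n) z.1 z.2) ν)
    (hμ : IsYoungMeasureOf quarterPlane V (fun n z => rescaled (h n) (v n) z.1 z.2) μ)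
    {φ : ℝ → ℝ} (hφ : IsTimeTest φ) :
    (∀ k, ∫ t in Ioi (0 : ℝ), φ t * cellFlux μ gp gm (k + 1) t ≤
      ∫ t in Ioi (0 : ℝ), φ t * cellFlux μ gp gm k t) ∧
    ∃ L, Tendsto (fun x => ∫ t in Ioi (0 : ℝ), φ t * ∫ u, (gp + gm) u ∂(ν (x, t)))
        (𝓝[>] (0 : ℝ) ⊓ ae volume) (𝓝 L) ∧
      ∀ k, L ≤ ∫ t in Ioi (0 : ℝ), φ t * cellFlux μ gp gm k t := by
  have hMν : IsMarkovKernel ν := hν.1.1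
  have hMμ : IsMarkovKernel μ := hμ.1.1
  have hφi : IntegrableOn φ (Ioi 0) := hφ.integrable.integrableOn
  have prodI : ∀ {f : ℝ → ℝ} {b : ℝ}, StronglyMeasurable f → (∀ t, |f t| ≤ b) →
      IntegrableOn (fun t => φ t * f t) (Ioi 0) := fun hf hb =>
    hφi.mul_bdd hf.aestronglyMeasurable (Eventually.of_forall hb)
  have mg : ∀ (g : BoundedContinuousFunction (State N) ℝ) n k,
      Measurable fun t => g (v n k t) := fun g n k => g.continuous.measurable.comp (hv n k)
  have bg : ∀ (g : BoundedContinuousFunction (State N) ℝ) (u : State N), |g u| ≤ ‖g‖ :=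
    fun g u => g.norm_coe_le_norm u
  have ig : ∀ (g : BoundedContinuousFunction (State N) ℝ) n k,
      IntegrableOn (fun t => φ t * g (v n k t)) (Ioi 0) := fun g n k =>
    prodI (mg g n k).stronglyMeasurable fun t => bg g _
  obtain ⟨C, hC0, hC⟩ := hφ.exists_bound
  set b := ‖gU‖ + ‖gm‖ + ‖gp‖ with hb
  have hb0 : 0 ≤ b := by positivity
  set I := ∫ t in Ioi (0 : ℝ), φ t
  have hI : 0 ≤ I := integral_nonneg hφ.nonneg
  set A : ℕ → ℕ → ℝ := fun n k =>
    ∫ t in Ioi (0 : ℝ), φ t * (gm (v n (k + 1) t) + gp (v n k t)) with hAdef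
  have bsum : ∀ u u' : State N, |gm u + gp u'| ≤ b := fun u u' => by
    have := (abs_add_le (gm u) (gp u')).trans (add_le_add (bg gm u) (bg gp u'))
    linarith [norm_nonneg gU]
  -- The time error `b * C * τ` divided by `lam` is `b * C * h n`, as `τ = lam * h n`. The smallness
  -- of `τ` is required by the bound on difference quotients of `φ`.
  have hA : ∀ᶠ n in atTop, ∀ k, A n (k + 1) ≤ A n k + b * C * h n := by
    have hsmall : ∀ᶠ n in atTop, lam * h n < 1 := by
      have := h0.const_mul lam
      rw [mul_zero] at this
      exact this.eventually_lt_const one_pos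
    filter_upwards [hsmall] with n hn k
    have hτ : 0 < lam * h n := mul_pos hlam (hh n)
    refine (integral_mul_le_of_time_step hφ.nonneg hφ.integrable hτ.le hlam
      (hC _ hτ hn.le) (mg gU n (k + 1)) ((mg gm n (k + 1)).add (mg gp n k))
      ((mg gm n (k + 2)).add (mg gp n (k + 1))) (B := b)
      (fun t => (bg gU _).trans (by linarith [norm_nonneg gm, norm_nonneg gp]))
      (fun t => bsum _ _) (fun t => bsum _ _) (hstep n k)).trans_eq ?_
    simp only [hAdef]
    congr 1
    field_simp
  have hAB : ∀ n k, |A n k| ≤ b * I := fun n k => abs_integral_test_mul_le hφ fun t => bsum _ _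
  have hM : ∀ k, Tendsto (fun n => A n k) atTop
      (𝓝 (∫ t in Ioi (0 : ℝ), φ t * cellFlux μ gp gm k t)) := by
    intro k
    have := (tendsto_cell hh hμ k gp hφi).add (tendsto_cell hh hμ (k + 1) gm hφi)
    rw [← integral_add (prodI (stronglyMeasurable_integral_bcf _ gp) (norm_integral_bcf_le _ gp))
      (prodI (stronglyMeasurable_integral_bcf _ gm) (norm_integral_bcf_le _ gm))] at this
    simp only [cellFlux, mul_add]
    refine this.congr fun n => ?_
    rw [← integral_add (ig gp n k) (ig gm n (k + 1))]
    refine integral_congr_ae (Eventually.of_forall fun t => ?_)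
    dsimp only
    ring
  have mmesh : ∀ (g : BoundedContinuousFunction (State N) ℝ) n,
      Measurable fun z : ℝ × ℝ => g (meshFunction (h n) (v n) z.1 z.2) := fun g n =>
    g.continuous.measurable.comp (measurable_meshFunction (hv n))
  have weak : ∀ (g : BoundedContinuousFunction (State N) ℝ) a c, 0 < a → a < c →
      Tendsto (fun n => ∫ x in a..c, ∫ t in Ioi (0 : ℝ), φ t * g (meshFunction (h n) (v n) x t))
        atTop (𝓝 (∫ x in a..c, ∫ t in Ioi (0 : ℝ), φ t * ∫ u, g u ∂(ν (x, t)))) := by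
    intro g a c ha hac
    have hsub : Ioc a c ⊆ Ioi (0 : ℝ) := fun x hx => ha.trans hx.1
    have hfin : volume (Ioc a c) < ⊤ := by simp
    have := hν.2 g _ (integrable_strip measurableSet_Ioc hfin hφi)
    rw [integral_strip_left measurableSet_Ioc hsub hfin hφi
      (stronglyMeasurable_integral_bcf ν g).aestronglyMeasurable (norm_integral_bcf_le ν g)] at this
    simp only [intervalIntegral.integral_of_le hac.le]
    refine this.congr fun n => ?_
    exact integral_strip_left measurableSet_Ioc hsub hfin hφi (mmesh g n).aestronglyMeasurable
      fun z => bg g _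
  have sm : ∀ (H : ℝ × ℝ → ℝ), StronglyMeasurable H →
      StronglyMeasurable fun x => ∫ t in Ioi (0 : ℝ), φ t * H (x, t) := fun H hH => by
    obtain ⟨φ', hφ'm, hφ'⟩ := hφi.aestronglyMeasurable
    have e : (fun x => ∫ t in Ioi (0 : ℝ), φ t * H (x, t)) =
        fun x => ∫ t in Ioi (0 : ℝ), φ' t * H (x, t) := by
      ext x
      refine integral_congr_ae ?_
      filter_upwards [hφ'] with t ht
      rw [ht]
    rw [e]
    exact ((hφ'm.comp_measurable measurable_snd).mul hH).integral_prod_right'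
  have bint : ∀ (g : BoundedContinuousFunction (State N) ℝ) (w : ℝ → State N),
      |∫ t in Ioi (0 : ℝ), φ t * g (w t)| ≤ ‖g‖ * I := fun g w =>
    abs_integral_test_mul_le hφ fun t => bg g _
  -- The right neighbour is the mesh function at `x + h n`; this shift is removed in the limit by
  -- `tendsto_integral_shift`, so both parts of the flux are seen at the same `x`.
  have split : ∀ n x, 0 ≤ x → A n ⌊x / h n⌋₊ =
      (∫ t in Ioi (0 : ℝ), φ t * gp (meshFunction (h n) (v n) x t)) +
        ∫ t in Ioi (0 : ℝ), φ t * gm (meshFunction (h n) (v n) (x + h n) t) := by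
    intro n x hx
    have e : ⌊(x + h n) / h n⌋₊ = ⌊x / h n⌋₊ + 1 := by
      rw [add_div, div_self (hh n).ne', Nat.floor_add_one (div_nonneg hx (hh n).le)]
    simp only [meshFunction, e]
    rw [← integral_add (ig gp n _) (ig gm n _)]
    refine integral_congr_ae (Eventually.of_forall fun t => ?_)
    dsimp only
    ring
  have measM : ∀ (g : BoundedContinuousFunction (State N) ℝ) n,
      Measurable fun x => ∫ t in Ioi (0 : ℝ), φ t * g (meshFunction (h n) (v n) x t) :=
    fun g n => (sm _ (mmesh g n).stronglyMeasurable).measurable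
  have measν : ∀ g : BoundedContinuousFunction (State N) ℝ,
      Measurable fun x => ∫ t in Ioi (0 : ℝ), φ t * ∫ u, g u ∂(ν (x, t)) :=
    fun g => (sm _ (stronglyMeasurable_integral_bcf ν g)).measurable
  have bν : ∀ (g : BoundedContinuousFunction (State N) ℝ) x,
      |∫ t in Ioi (0 : ℝ), φ t * ∫ u, g u ∂(ν (x, t))| ≤ ‖g‖ * I := fun g x =>
    abs_integral_test_mul_le hφ fun t => norm_integral_bcf_le ν g (x, t)
  have intI : ∀ {f : ℝ → ℝ} {c : ℝ}, Measurable f → (∀ x, |f x| ≤ c) → ∀ a d : ℝ,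
      IntervalIntegrable f volume a d := fun {f c} hf hc a d =>
    ((locallyIntegrable_const c).mono hf.aestronglyMeasurable
      (Eventually.of_forall fun x => (hc x).trans (le_abs_self c))
      |>.integrableOn_isCompact isCompact_uIcc).intervalIntegrable
  have hsumν : ∀ x, ∫ t in Ioi (0 : ℝ), φ t * ∫ u, (gp + gm) u ∂(ν (x, t)) =
      (∫ t in Ioi (0 : ℝ), φ t * ∫ u, gp u ∂(ν (x, t))) +
        ∫ t in Ioi (0 : ℝ), φ t * ∫ u, gm u ∂(ν (x, t)) := by
    intro x
    have i : ∀ g : BoundedContinuousFunction (State N) ℝ,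
        IntegrableOn (fun t => φ t * ∫ u, g u ∂(ν (x, t))) (Ioi 0) := fun g =>
      prodI ((stronglyMeasurable_integral_bcf ν g).comp_measurable measurable_prodMk_left)
        fun t => norm_integral_bcf_le ν g (x, t)
    rw [← integral_add (i gp) (i gm)]
    refine integral_congr_ae (Eventually.of_forall fun t => ?_)
    dsimp only
    rw [← mul_add, ← integral_add (gp.integrable _) (gm.integrable _)]
    rfl
  have hlim : ∀ a c, 0 < a → a < c → Tendsto (fun n => ∫ x in a..c, A n ⌊x / h n⌋₊) atTop
      (𝓝 (∫ x in a..c, ∫ t in Ioi (0 : ℝ), φ t * ∫ u, (gp + gm) u ∂(ν (x, t)))) := by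
    intro a c ha hac
    have := (weak gp a c ha hac).add (tendsto_integral_shift h0 (measM gm)
      (fun n x => bint gm _) (weak gm a c ha hac))
    simp only [hsumν]
    rw [intervalIntegral.integral_add (intI (measν gp) (bν gp) _ _)
      (intI (measν gm) (bν gm) _ _)]
    refine this.congr fun n => ?_
    have i : IntervalIntegrable
        (fun x => ∫ t in Ioi (0 : ℝ), φ t * gm (meshFunction (h n) (v n) (x + h n) t))
        volume a c :=
      intI ((measM gm n).comp (measurable_id.add_const (h n))) (fun x => bint gm _) _ _
    rw [← intervalIntegral.integral_add (intI (measM gp n) (fun x => bint gp _) _ _) i]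
    refine intervalIntegral.integral_congr fun x hx => ?_
    rw [uIcc_of_le hac.le] at hx
    exact (split n x (ha.le.trans hx.1)).symm
  refine ⟨fun k => ?_, ?_⟩
  · have : Tendsto (fun n => A n k + b * C * h n) atTop
        (𝓝 ((∫ t in Ioi (0 : ℝ), φ t * cellFlux μ gp gm k t) + b * C * 0)) :=
      (hM k).add (h0.const_mul _)
    rw [mul_zero, add_zero] at this
    exact le_of_tendsto_of_tendsto (hM (k + 1)) this (hA.mono fun n hn => hn k)
  · refine exists_trace_of_cells hh h0 (mul_nonneg hb0 hC0) hA hAB (measν (gp + gm))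
      (fun x => (bν (gp + gm) x).trans ?_) hlim hM
    have : ‖gp + gm‖ ≤ b := (norm_add_le _ _).trans (by linarith [norm_nonneg gU])
    gcongr

/-- The discrete boundary layer: trace of `⟨ν, F⟩` and monotonicity of the layer fluxes. -/
theorem boundary_layer_of_step (hlam : 0 < lam) (hh : ∀ n, 0 < h n)
    (h0 : Tendsto h atTop (𝓝 0)) (hv : ∀ n k, Measurable (v n k))
    (hstep : ∀ n k t, 0 < t → gU (v n (k + 1) (t + lam * h n)) - gU (v n (k + 1) t) +
      lam * ((gm (v n (k + 2) t) + gp (v n (k + 1) t)) - (gm (v n (k + 1) t) + gp (v n k t))) ≤ 0)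
    (hν : IsYoungMeasureOf quarterPlane V (fun n z => meshFunction (h n) (v n) z.1 z.2) ν)
    (hμ : IsYoungMeasureOf quarterPlane V (fun n z => rescaled (h n) (v n) z.1 z.2) μ)
    {ν₀ : Kernel ℝ (State N)} [IsMarkovKernel ν₀] {l : Filter ℝ} [l.NeBot]
    (hl : l ≤ 𝓝[>] (0 : ℝ) ⊓ ae volume)
    (hν₀ : ∀ (g : BoundedContinuousFunction (State N) ℝ) (θ : ℝ → ℝ), IntegrableOn θ (Ioi 0) →
      Tendsto (fun x => ∫ t in Ioi (0 : ℝ), (∫ u, g u ∂(ν (x, t))) * θ t) l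
        (𝓝 (∫ t in Ioi (0 : ℝ), (∫ u, g u ∂(ν₀ t)) * θ t))) :
    IsTraceFor ν ν₀ (gp + gm) ∧
    (∀ᵐ t ∂(volume.restrict (Ioi (0 : ℝ))), ∀ k,
      cellFlux μ gp gm (k + 1) t ≤ cellFlux μ gp gm k t ∧
        ∫ u, (gp + gm) u ∂(ν₀ t) ≤ cellFlux μ gp gm k t) := by
  have hMν : IsMarkovKernel ν := hν.1.1
  have hMμ : IsMarkovKernel μ := hμ.1.1
  have test : ∀ φ, IsTimeTest φ →
      Tendsto (fun x => ∫ t in Ioi (0 : ℝ), (∫ u, (gp + gm) u ∂(ν (x, t))) * φ t)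
        (𝓝[>] (0 : ℝ) ⊓ ae volume)
        (𝓝 (∫ t in Ioi (0 : ℝ), (∫ u, (gp + gm) u ∂(ν₀ t)) * φ t)) ∧
      ∀ k, ∫ t in Ioi (0 : ℝ), (∫ u, (gp + gm) u ∂(ν₀ t)) * φ t ≤
        ∫ t in Ioi (0 : ℝ), cellFlux μ gp gm k t * φ t := by
    intro φ hφ
    obtain ⟨-, L, hL, hLk⟩ := exists_trace_of_test hlam hh h0 hv hstep hν hμ hφ
    simp only [mul_comm (φ _)] at hL hLk
    -- The full limit exists and `l` is a finer filter, so the limit is the one already identified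
    -- along `l`.
    have := tendsto_nhds_unique (hL.mono_left hl) (hν₀ (gp + gm) φ hφ.integrable.integrableOn)
    rw [← this]
    exact ⟨hL, hLk⟩
  have mν : ∀ x, AEStronglyMeasurable (fun t => ∫ u, (gp + gm) u ∂(ν (x, t)))
      (volume.restrict (Ioi (0 : ℝ))) := fun x =>
    ((stronglyMeasurable_integral_bcf ν (gp + gm)).comp_measurable
      measurable_prodMk_left).aestronglyMeasurable
  have mν₀ : AEStronglyMeasurable (fun t => ∫ u, (gp + gm) u ∂(ν₀ t))
      (volume.restrict (Ioi (0 : ℝ))) :=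
    (stronglyMeasurable_integral_bcf ν₀ (gp + gm)).aestronglyMeasurable
  have bν : ∀ x t, ‖∫ u, (gp + gm) u ∂(ν (x, t))‖ ≤ ‖gp‖ + ‖gm‖ := fun x t =>
    (norm_integral_bcf_le ν (gp + gm) (x, t)).trans (norm_add_le _ _)
  have bν₀ : ∀ t, ‖∫ u, (gp + gm) u ∂(ν₀ t)‖ ≤ ‖gp‖ + ‖gm‖ := fun t =>
    (norm_integral_bcf_le ν₀ (gp + gm) t).trans (norm_add_le _ _)
  refine ⟨?_, ?_⟩
  · have pos : ∀ θ : ℝ → ℝ, IntegrableOn θ (Ioi 0) → 0 ≤ θ →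
        Tendsto (fun x => ∫ t in Ioi (0 : ℝ), (∫ u, (gp + gm) u ∂(ν (x, t))) * θ t)
          (𝓝[>] (0 : ℝ) ⊓ ae volume)
          (𝓝 (∫ t in Ioi (0 : ℝ), (∫ u, (gp + gm) u ∂(ν₀ t)) * θ t)) := fun θ hθ hθ0 =>
      tendsto_integral_mul_of_approx mν mν₀ bν bν₀ hθ fun ε hε => by
        obtain ⟨φ, hφ, happ⟩ := exists_isTimeTest_integral_sub_le hθ hθ0 hε
        exact ⟨φ, hφ.integrable.integrableOn, happ, (test φ hφ).1⟩
    intro θ hθ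
    -- Test weights are non-negative, so a general `θ` is split into its positive and negative
    -- parts.
    have hp : IntegrableOn (fun t => max (θ t) 0) (Ioi 0) := hθ.pos_part
    have hn : IntegrableOn (fun t => max (-θ t) 0) (Ioi 0) := hθ.neg_part
    have e : ∀ f : ℝ → ℝ, AEStronglyMeasurable f (volume.restrict (Ioi (0 : ℝ))) →
        (∀ t, ‖f t‖ ≤ ‖gp‖ + ‖gm‖) → ∫ t in Ioi (0 : ℝ), f t * θ t =
          (∫ t in Ioi (0 : ℝ), f t * max (θ t) 0) - ∫ t in Ioi (0 : ℝ), f t * max (-θ t) 0 := by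
      intro f hf hb
      rw [← integral_sub (hp.bdd_mul hf (Eventually.of_forall hb))
        (hn.bdd_mul hf (Eventually.of_forall hb))]
      refine integral_congr_ae (Eventually.of_forall fun t => ?_)
      dsimp only
      rw [← mul_sub]
      congr 1
      rcases le_total (θ t) 0 with h | h
      · rw [max_eq_right h, max_eq_left (by linarith)]
        ring
      · rw [max_eq_left h, max_eq_right (by linarith)]
        ring
    have := (pos _ hp fun t => le_max_right _ _).sub (pos _ hn fun t => le_max_right _ _)
    rw [← e _ mν₀ bν₀] at this
    exact this.congr fun x => (e _ (mν x) (bν x)).symm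
  · rw [ae_all_iff]
    intro k
    have mk : ∀ k, AEStronglyMeasurable (cellFlux μ gp gm k) (volume.restrict (Ioi (0 : ℝ))) :=
      fun k => (measurable_cellFlux μ gp gm k).aestronglyMeasurable
    have h1 := ae_le_of_forall_isTimeTest (mk (k + 1)) (mk k) (norm_cellFlux_le μ gp gm _)
      (norm_cellFlux_le μ gp gm _) fun φ hφ => by
        have := (exists_trace_of_test hlam hh h0 hv hstep hν hμ hφ).1 k
        simpa only [mul_comm (φ _)] using this
    have h2 := ae_le_of_forall_isTimeTest mν₀ (mk k) bν₀ (norm_cellFlux_le μ gp gm _)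
      fun φ hφ => (test φ hφ).2 k
    filter_upwards [h1, h2] with t a1 a2
    exact ⟨a1, a2⟩

end Core

/-! ### Assembly: from the scheme to its discrete boundary layer. -/

theorem IsYoungMeasureOf.congr {Z : Type*} [MeasurableSpace Z] {m : Measure Z} {N : ℕ}
    {V : Set (State N)} {w w' : ℕ → Z → State N} {κ : Kernel Z (State N)}
    (hκ : IsYoungMeasureOf m V w κ) (h : ∀ n, ∀ᵐ z ∂m, w n z = w' n z) :
    IsYoungMeasureOf m V w' κ :=
  ⟨hκ.1, fun g φ hφ => (hκ.2 g φ hφ).congr fun n => integral_congr_ae (by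
    filter_upwards [h n] with z hz
    rw [hz])⟩

theorem ae_quarterPlane_pos : ∀ᵐ z ∂quarterPlane, 0 < z.2 := by
  filter_upwards [ae_restrict_mem (measurableSet_Ioi.prod measurableSet_Ioi)] with z hz
  exact hz.2

instance : NeZero (volume.restrict (Ioi (0 : ℝ))) :=
  ⟨fun h => by simp at h⟩

/-- The discrete entropy inequality for the cell values of the scheme. -/
theorem entropy_step {N : ℕ} {fp fm : State N → State N} {lam h : ℝ} {uB : ℝ → State N}
    {a : ℕ → State N} {v : ℕ → ℝ → State N} {K V : Set (State N)} {U Fp Fm : State N → ℝ}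
    (hv : IsSplittingScheme fp fm lam h uB a v) (hvK : ∀ k t, 0 ≤ t → v k t ∈ K) (hKV : K ⊆ V)
    (hE : DiscreteEntropyInequality fp fm lam U Fp Fm V) (hτ : 0 ≤ lam * h) (k : ℕ) {t : ℝ}
    (ht : 0 ≤ t) :
    U (v (k + 1) (t + lam * h)) - U (v (k + 1) t) +
      lam * ((Fm (v (k + 2) t) + Fp (v (k + 1) t)) - (Fm (v (k + 1) t) + Fp (v k t))) ≤ 0 := by
  have mem := fun k => hKV (hvK k t ht)
  have h1 := hvK (k + 1) (t + lam * h) (by positivity)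
  rw [hv.step k t ht] at h1 ⊢
  exact hE _ (mem k) _ (mem (k + 1)) _ (mem (k + 2)) (hKV h1)

theorem layerFlux_eq_cellFlux {N : ℕ} {μ : Kernel (ℝ × ℝ) (State N)} {K : Set (State N)}
    {Fp Fm : State N → ℝ} {gp gm : BoundedContinuousFunction (State N) ℝ} (hp : EqOn Fp gp K)
    (hm : EqOn Fm gm K) {t : ℝ} (hK : ∀ k, cellKernel μ k t Kᶜ = 0) {y : ℝ} (hy : 0 ≤ y) :
    layerFlux (layerKernel μ) Fp Fm y t = cellFlux μ gp gm ⌊y⌋₊ t := by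
  rw [layerFlux, cellFlux, layerKernel_apply, layerKernel_apply, Nat.floor_add_one hy,
    integral_eq_of_eqOn hp (hK _), integral_eq_of_eqOn hm (hK _)]

/-- The discrete boundary layer of a convergent family of entropy flux-splitting schemes. -/
theorem exists_discrete_boundary_layer {N : ℕ} {fp fm : State N → State N} {lam : ℝ}
    (hlam : 0 < lam) {V : Set (State N)} {uB : ℝ → State N} {h : ℕ → ℝ}
    {a : ℕ → ℕ → State N} {v : ℕ → ℕ → ℝ → State N} {K : Set (State N)}
    (hfp : ContinuousOn fp K) (hfm : ContinuousOn fm K) (huB : Measurable uB)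
    (hh : ∀ n, 0 < h n) (h0 : Tendsto h atTop (𝓝 0))
    (hsch : ∀ n, IsSplittingScheme fp fm lam (h n) uB (a n) (v n)) (hK : IsCompact K)
    (hKV : K ⊆ V) (hvK : ∀ n k t, 0 ≤ t → v n k t ∈ K) {ν μ : Kernel (ℝ × ℝ) (State N)}
    (hν : IsYoungMeasureOf quarterPlane V (fun n z => meshFunction (h n) (v n) z.1 z.2) ν)
    (hμ : IsYoungMeasureOf quarterPlane V (fun n z => rescaled (h n) (v n) z.1 z.2) μ) :
    ∃ (μ' : Kernel (ℝ × ℝ) (State N)) (ν₀ : Kernel ℝ (State N)),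
      (∀ᵐ z ∂quarterPlane, μ' z = μ z) ∧
      IsMarkovKernel μ' ∧
      (∀ y : ℝ, 0 ≤ y → ∀ᵐ t ∂(volume.restrict (Ioi (0 : ℝ))), μ' (y, t) Vᶜ = 0) ∧
      (∀ (k : ℕ) (y : ℝ), y ∈ Ico (k : ℝ) (k + 1) → ∀ t : ℝ, μ' (y, t) = μ' ((k : ℝ), t)) ∧
      (∀ᵐ t ∂(volume.restrict (Ioi (0 : ℝ))), μ' (0, t) = Measure.dirac (uB t)) ∧
      IsYoungMeasure (volume.restrict (Ioi (0 : ℝ))) V ν₀ ∧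
      ∀ U Fp Fm : State N → ℝ, ContinuousOn U V → ContinuousOn Fp V → ContinuousOn Fm V →
        DiscreteEntropyInequality fp fm lam U Fp Fm V →
        IsTraceFor ν ν₀ (fun u => Fp u + Fm u) ∧
        (∀ y : ℝ, 0 ≤ y → ∀ᵐ t ∂(volume.restrict (Ioi (0 : ℝ))),
          Fp (uB t) + (∫ u, Fm u ∂(μ' (1, t))) ≥ layerFlux μ' Fp Fm y t ∧
          layerFlux μ' Fp Fm y t ≥ layerFlux μ' Fp Fm (y + 1) t ∧
          layerFlux μ' Fp Fm (y + 1) t ≥ ∫ u, (Fp u + Fm u) ∂(ν₀ t)) ∧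
        (∀ᵐ t ∂(volume.restrict (Ioi (0 : ℝ))), ∃ L : ℝ,
          Tendsto (fun y : ℝ => layerFlux μ' Fp Fm y t) atTop (𝓝 L) ∧
          L ≥ ∫ u, (Fp u + Fm u) ∂(ν₀ t)) := by
  have hMν : IsMarkovKernel ν := hν.1.1
  have hMμ : IsMarkovKernel μ := hμ.1.1
  have hne : K.Nonempty := ⟨_, hvK 0 0 0 le_rfl⟩
  have hτ : ∀ n, 0 < lam * h n := fun n => mul_pos hlam (hh n)
  -- Nothing is known for `t < 0`; this modification is measurable and `K`-valued everywhere and has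
  -- the same Young measures.
  set w : ℕ → ℕ → ℝ → State N := fun n k t => v n k (max t 0) with hwdef
  have hwv : ∀ n k t, 0 ≤ t → v n k t = w n k t := fun n k t ht => by
    rw [hwdef]
    dsimp only
    rw [max_eq_left ht]
  have hw : ∀ n k, Measurable (w n k) := fun n k =>
    measurable_scheme hK.measurableSet hfp hfm huB (hτ n) (hsch n) (hvK n) k
  have hν' : IsYoungMeasureOf quarterPlane V (fun n z => meshFunction (h n) (w n) z.1 z.2) ν :=
    hν.congr fun n => by
      filter_upwards [ae_quarterPlane_pos] with z hz
      exact hwv n _ _ hz.le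
  have hμ' : IsYoungMeasureOf quarterPlane V (fun n z => rescaled (h n) (w n) z.1 z.2) μ :=
    hμ.congr fun n => by
      filter_upwards [ae_quarterPlane_pos] with z hz
      exact hwv n _ _ hz.le
  have hνK : ∀ᵐ z ∂quarterPlane, ν z Kᶜ = 0 :=
    ae_compl_eq_zero_of_isYoungMeasureOf hν' hK.isClosed hne fun n =>
      Eventually.of_forall fun z => hvK n _ _ (le_max_right _ _)
  have hμK : ∀ᵐ z ∂quarterPlane, μ z Kᶜ = 0 :=
    ae_compl_eq_zero_of_isYoungMeasureOf hμ' hK.isClosed hne fun n =>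
      Eventually.of_forall fun z => hvK n _ _ (le_max_right _ _)
  have hcellK : ∀ k, ∀ᵐ t ∂(volume.restrict (Ioi (0 : ℝ))), cellKernel μ k t Kᶜ = 0 :=
    ae_cellKernel_compl_eq_zero hK.measurableSet hμK
  have hsec : ∀ᶠ x in 𝓝[>] (0 : ℝ) ⊓ ae volume,
      ∀ᵐ t ∂(volume.restrict (Ioi (0 : ℝ))), ν (x, t) Kᶜ = 0 := by
    have h1 := hνK
    rw [quarterPlane_eq_prod] at h1
    have h2 := (ae_restrict_iff' measurableSet_Ioi).1 (Measure.ae_ae_of_ae_prod h1)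
    have h3 : ∀ᶠ x in 𝓝[>] (0 : ℝ) ⊓ ae volume, x ∈ Ioi (0 : ℝ) :=
      Eventually.filter_mono inf_le_left self_mem_nhdsWithin
    filter_upwards [Eventually.filter_mono inf_le_right h2, h3] with x hx hx0
    exact hx hx0
  -- `ν₀` is fixed here, before any entropy is chosen.
  let 𝒢 := Ultrafilter.of (𝓝[>] (0 : ℝ) ⊓ ae volume)
  have h𝒢 : (𝒢 : Filter ℝ) ≤ 𝓝[>] (0 : ℝ) ⊓ ae volume := Ultrafilter.of_le _
  obtain ⟨ν₀, hMν₀, hν₀K, hν₀⟩ := exists_kernel_limit ν hK 𝒢 (h𝒢 hsec)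
  have hdirac := cellKernel_ae_eq_dirac hh hμ 0 huB fun n t ht => (hsch n).boundary t ht
  have huK : ∀ t, 0 < t → uB t ∈ K := fun t ht => by
    rw [← (hsch 0).boundary t ht.le]
    exact hvK 0 0 t ht.le
  refine ⟨layerKernel μ, ν₀, layerKernel_ae_eq hh hμ, inferInstance, fun y _ => ?_,
    fun k y hy t => ?_, ?_, ⟨hMν₀, ?_⟩, ?_⟩
  · filter_upwards [hcellK ⌊y⌋₊] with t ht
    exact measure_mono_null (compl_subset_compl.2 hKV) ht
  · rw [layerKernel_apply, layerKernel_apply, Nat.floor_natCast,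
      (Nat.floor_eq_iff (k.cast_nonneg.trans hy.1)).2 ⟨hy.1, hy.2⟩]
  · filter_upwards [hdirac] with t ht
    rw [layerKernel_apply, Nat.floor_zero, ht]
  · filter_upwards [hν₀K] with t ht
    exact measure_mono_null (compl_subset_compl.2 hKV) ht
  intro U Fp Fm cU cFp cFm hE
  obtain ⟨gU, eU⟩ := exists_bcf_eqOn hK (cU.mono hKV)
  obtain ⟨gp, ep⟩ := exists_bcf_eqOn hK (cFp.mono hKV)
  obtain ⟨gm, em⟩ := exists_bcf_eqOn hK (cFm.mono hKV)
  have hstep : ∀ n k t, 0 < t → gU (w n (k + 1) (t + lam * h n)) - gU (w n (k + 1) t) +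
      lam * ((gm (w n (k + 2) t) + gp (w n (k + 1) t)) -
        (gm (w n (k + 1) t) + gp (w n k t))) ≤ 0 := by
    intro n k t ht
    have ht' : 0 ≤ t + lam * h n := by
      have := hτ n
      positivity
    have := entropy_step (hsch n) (hvK n) hKV hE (hτ n).le k ht.le
    simpa only [← hwv _ _ _ ht.le, ← hwv _ _ _ ht', ← eU (hvK n _ _ ht.le),
      ← eU (hvK n _ _ ht'), ← ep (hvK n _ _ ht.le), ← em (hvK n _ _ ht.le)] using this
  obtain ⟨htrace, hlayer⟩ := boundary_layer_of_step hlam hh h0 hw hstep hν' hμ' h𝒢 hν₀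
  have eF : EqOn (fun u => Fp u + Fm u) (gp + gm) K := fun u hu => by
    simp [ep hu, em hu]
  -- One null set of times serves all `y ≥ 0`, since only the countably many cells enter.
  have good : ∀ᵐ t ∂(volume.restrict (Ioi (0 : ℝ))),
      (∀ y, 0 ≤ y → layerFlux (layerKernel μ) Fp Fm y t = cellFlux μ gp gm ⌊y⌋₊ t) ∧
      Antitone (fun k => cellFlux μ gp gm k t) ∧
      (∀ k, ∫ u, (Fp u + Fm u) ∂(ν₀ t) ≤ cellFlux μ gp gm k t) ∧
      Fp (uB t) + (∫ u, Fm u ∂(layerKernel μ (1, t))) = cellFlux μ gp gm 0 t := by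
    filter_upwards [ae_all_iff.2 hcellK, hν₀K, hlayer, hdirac,
      ae_restrict_mem measurableSet_Ioi] with t h1 h2 h3 h4 h5
    refine ⟨fun y hy => layerFlux_eq_cellFlux ep em h1 hy,
      antitone_nat_of_succ_le fun k => (h3 k).1, fun k => ?_, ?_⟩
    · rw [integral_eq_of_eqOn eF h2]
      exact (h3 k).2
    · rw [cellFlux, h4, integral_dirac' _ _ gp.continuous.measurable.stronglyMeasurable,
        layerKernel_apply, Nat.floor_one, integral_eq_of_eqOn em (h1 1), ep (huK t h5)]
  refine ⟨fun θ hθ => ?_, fun y hy => ?_, ?_⟩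
  · have e₀ : ∫ t in Ioi (0 : ℝ), (∫ u, (Fp u + Fm u) ∂(ν₀ t)) * θ t =
        ∫ t in Ioi (0 : ℝ), (∫ u, (gp + gm) u ∂(ν₀ t)) * θ t := by
      refine integral_congr_ae ?_
      filter_upwards [hν₀K] with t ht
      rw [integral_eq_of_eqOn eF ht]
      rfl
    rw [e₀]
    refine (htrace θ hθ).congr' ?_
    filter_upwards [hsec] with x hx
    refine integral_congr_ae ?_
    filter_upwards [hx] with t ht
    rw [integral_eq_of_eqOn eF ht]
  · filter_upwards [good] with t ht
    obtain ⟨g1, g2, g3, g4⟩ := ht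
    rw [g1 y hy, g1 (y + 1) (by linarith), g4, Nat.floor_add_one hy]
    exact ⟨g2 (Nat.zero_le _), g2 (Nat.le_succ _), g3 _⟩
  · filter_upwards [good] with t ht
    obtain ⟨g1, g2, g3, -⟩ := ht
    have hb : BddBelow (range fun k => cellFlux μ gp gm k t) := ⟨_, by
      rintro _ ⟨k, rfl⟩
      exact g3 k⟩
    -- The layer fluxes decrease in `k` and are bounded below by the trace, so they converge to
    -- their infimum.
    refine ⟨_, ((tendsto_atTop_ciInf g2 hb).comp tendsto_nat_floor_atTop).congr' ?_,
      le_ciInf g3⟩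
    filter_upwards [eventually_ge_atTop 0] with y hy
    exact (g1 y hy).symm

end BoundaryLayer

theorem theorem2p3 {N : ℕ} (𝒰 : Set (BoundaryLayer.State N)) (h𝒰 : IsOpen 𝒰)
    (hconv : Convex ℝ 𝒰) (fp fm : BoundaryLayer.State N → BoundaryLayer.State N)
    (hsplit : BoundaryLayer.IsEntropyFluxSplitting fp fm 𝒰) (lam : ℝ) (hlam : 0 < lam) :
    -- near a constant state the discrete entropy inequality holds
    (∀ c ∈ 𝒰, BoundaryLayer.IsStableAt fp fm lam c →
      ∀ U Fp Fm : BoundaryLayer.State N → ℝ,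
        BoundaryLayer.IsSplitEntropy fp fm U Fp Fm 𝒰 → BoundaryLayer.HasPosDefHessian U 𝒰 →
        ∃ r : ℝ, 0 < r ∧ Metric.ball c r ⊆ 𝒰 ∧
          BoundaryLayer.DiscreteEntropyInequality fp fm lam U Fp Fm (Metric.ball c r)) ∧
    -- the discrete boundary layer, for schemes with values in a convex open set `V`
    (∀ V : Set (BoundaryLayer.State N), IsOpen V → Convex ℝ V → V ⊆ 𝒰 →
      ∀ (uB : ℝ → BoundaryLayer.State N) (h : ℕ → ℝ) (a : ℕ → ℕ → BoundaryLayer.State N)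
        (v : ℕ → ℕ → ℝ → BoundaryLayer.State N) (K : Set (BoundaryLayer.State N)),
      Measurable uB → (∀ n, 0 < h n) → Tendsto h atTop (𝓝 0) →
      (∀ n, BoundaryLayer.IsSplittingScheme fp fm lam (h n) uB (a n) (v n)) →
      IsCompact K → K ⊆ V → (∀ n k t, 0 ≤ t → v n k t ∈ K) →
      ∀ ν μ : Kernel (ℝ × ℝ) (BoundaryLayer.State N),
      BoundaryLayer.IsYoungMeasureOf BoundaryLayer.quarterPlane V
        (fun n z => BoundaryLayer.meshFunction (h n) (v n) z.1 z.2) ν →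
      BoundaryLayer.IsYoungMeasureOf BoundaryLayer.quarterPlane V
        (fun n z => BoundaryLayer.rescaled (h n) (v n) z.1 z.2) μ →
      ∃ (μ' : Kernel (ℝ × ℝ) (BoundaryLayer.State N)) (ν₀ : Kernel ℝ (BoundaryLayer.State N)),
        -- `μ'` is the version of `μ` defined for all `y ≥ 0`, piecewise constant in `y`
        (∀ᵐ z ∂BoundaryLayer.quarterPlane, μ' z = μ z) ∧
        IsMarkovKernel μ' ∧
        (∀ y : ℝ, 0 ≤ y → ∀ᵐ t ∂(volume.restrict (Ioi (0 : ℝ))), μ' (y, t) Vᶜ = 0) ∧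
        (∀ (k : ℕ) (y : ℝ), y ∈ Ico (k : ℝ) (k + 1) → ∀ t : ℝ, μ' (y, t) = μ' ((k : ℝ), t)) ∧
        (∀ᵐ t ∂(volume.restrict (Ioi (0 : ℝ))), μ' (0, t) = Measure.dirac (uB t)) ∧
        -- `ν₀` is a trace of `ν` at `x = 0`
        BoundaryLayer.IsYoungMeasure (volume.restrict (Ioi (0 : ℝ))) V ν₀ ∧
        ∀ U Fp Fm : BoundaryLayer.State N → ℝ,
          BoundaryLayer.IsSplitEntropy fp fm U Fp Fm V → BoundaryLayer.HasNonnegHessian U V →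
          BoundaryLayer.DiscreteEntropyInequality fp fm lam U Fp Fm V →
          BoundaryLayer.IsTraceFor ν ν₀ (fun u => Fp u + Fm u) ∧
          (∀ y : ℝ, 0 ≤ y → ∀ᵐ t ∂(volume.restrict (Ioi (0 : ℝ))),
            Fp (uB t) + (∫ u, Fm u ∂(μ' (1, t))) ≥ BoundaryLayer.layerFlux μ' Fp Fm y t ∧
            BoundaryLayer.layerFlux μ' Fp Fm y t
              ≥ BoundaryLayer.layerFlux μ' Fp Fm (y + 1) t ∧
            BoundaryLayer.layerFlux μ' Fp Fm (y + 1) t ≥ ∫ u, (Fp u + Fm u) ∂(ν₀ t)) ∧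
          (∀ᵐ t ∂(volume.restrict (Ioi (0 : ℝ))), ∃ L : ℝ,
            Tendsto (fun y : ℝ => BoundaryLayer.layerFlux μ' Fp Fm y t) atTop (𝓝 L) ∧
            L ≥ ∫ u, (Fp u + Fm u) ∂(ν₀ t))) := by
  refine ⟨fun c hc hst U Fp Fm hs hU =>
    BoundaryLayer.exists_ball_discreteEntropyInequality h𝒰 hsplit.smooth_pos hsplit.smooth_neg
      hlam hc hst hs hU, ?_⟩
  intro V _ _ hVU uB h a v K huB hh h0 hsch hK hKV hvK ν μ hν hμ
  obtain ⟨μ', ν₀, h1, h2, h3, h4, h5, h6, h7⟩ :=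
    BoundaryLayer.exists_discrete_boundary_layer hlam
      (hsplit.smooth_pos.continuousOn.mono (hKV.trans hVU))
      (hsplit.smooth_neg.continuousOn.mono (hKV.trans hVU)) huB hh h0 hsch hK hKV hvK hν hμ
  exact ⟨μ', ν₀, h1, h2, h3, h4, h5, h6, fun U Fp Fm hs _ hE =>
    h7 U Fp Fm hs.1.1.continuousOn hs.1.2.1.continuousOn hs.2.2.1.continuousOn hE⟩
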